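/- Let $n\ge 1$ and $0<\delta<1$. Let $\psi\in\mathcal S(\mathbb R^n)$ be real and symmetric ($\psi(-x)=\psi(x)$) with $\operatorname{supp}\hat\psi\subset B_1$ (the unit ball) and $\psi(0)=1$, where $\hat f(\xi)=\int_{\mathbb R^n} e^{-2\pi i x\cdot\xi}f(x)\,dx$. Let $F\in L^2(\mathbb R^n/\mathbb Z^n)$ be a (complex-valued) periodic function with $\|F\|_{L^2(\mathbb R^n/\mathbb Z^n)}=1$ and Fourier coefficients $\hat F(\nu)$, $\nu\in\mathbb Z^n$; we write $\hat F\in\ell^2(|\nu|^{s})$ if $\sum_\nu|\nu|^{s}|\hat F(\nu)|^2<\infty$. For $\varepsilon>0$ put $$f_\varepsilon(x)=N_\varepsilon^{-1}\psi(\varepsilon x)F(x),\qquad N_\varepsilon^2=\varepsilon^{-n}\|\psi\|_2^2 .$$ For $f\in L^2(\mathbb R^n)$ let $u$ be the solution of $\partial_t u=\frac{i}{2}\hbar\Delta u$, $u(\cdot,0)=f$, $\hbar=1/(2\pi)$, that is, $\hat u(\xi,t)=e^{-\pi i t|\xi|^2}\hat f(\xi)$, and let $$h_\delta[f](t)=\int_{\mathbb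 R^n}|x|^{2\delta}|u(x,t)|^2\,dx .$$ Let $b_{n,\delta}=\dfrac{1}{2\pi^{n/2+2\delta}}\dfrac{\Gamma(\frac{n+2\delta}{2})}{|\Gamma(-\delta)|}$ and define the periodic limit $$h_{\mathrm p,\delta}[F](t)=-\frac{2b_{n,\delta}}{\|\psi\|_2^2}\sum_{\nu_1\ne\nu_2}\hat F(\nu_1)\overline{\hat F(\nu_2)}\,\frac{e^{\pi i t(|\nu_2|^2-|\nu_1|^2)}}{|\nu_1-\nu_2|^{n+2\delta}},$$ the $\varepsilon$-periodic part $$h_{\mathrm p,\varepsilon,\delta}[F](t)=-\frac{2b_{n,\delta}}{\varepsilon^{2n}\|\psi\|_2^2}\sum_{\nu_1\ne\nu_2}\hat F(\nu_1)\overline{\hat F(\nu_2)}\int_{\mathbb R^{2n}}\hat\psi\Big(\frac{\xi-\nu_1}{\varepsilon}\Big)\hat\psi\Big(\frac{\eta-\nu_2}{\varepsilon}\Big)e^{\pi i t(|\eta|^2-|\xi|^2)}\frac{d\xi\,d\eta}{|\xi-\eta|^{n+2\delta}},$$ and the background $h_{\mathrm b,\varepsilon,\delta}[F]=h_\delta[f_\varepsilon]-\varepsilon^n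 h_{\mathrm p,\varepsilon,\delta}[F]$. Let $P_{<1/4}$ be the Fourier multiplier $(P_{<1/4}g)^\wedge=\chi\hat g$ on $\mathbb R$ (acting as convolution with the inverse Fourier transform of $\chi$), where $\chi\in C_0^\infty(\mathbb R)$ is any fixed real cutoff with $\chi=1$ on $[-\frac14,\frac14]$. All asymptotics below are as $\varepsilon\to0^+$. 1. If $\hat F\in\ell^2(|\nu|^{2\delta})$, then $f_\varepsilon\in L^2(\mathbb R^n)$ for all $\varepsilon>0$, the integral defining $h_\delta[f_\varepsilon](t)$ converges for all small $\varepsilon>0$ and all $t$, and $$h_\delta[f_\varepsilon](t)=\frac{\varepsilon^{-2\delta}}{\|\psi\|_2^2}\int_{\mathbb R^n}|x|^{2\delta}|\psi(x)|^2\,dx+o(1).$$ 2. If $\hat F\in\ell^2(|\nu|^{n+2\delta})$, then the series defining $h_{\mathrm p,\delta}[F](t)$ and (for small $\varepsilon$) $h_{\mathrm p,\varepsilon,\delta}[F](t)$ and the convolution integral defining (for small $\varepsilon$) $P_{<1/4}h_{\mathrm b,\varepsilon,\delta}[F](t)$ converge absolutely for all $t$, and $$h_\delta[f_\varepsilon](t)=P_{<\frac14}h_{\mathrm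 b,\varepsilon,\delta}[F](t)+\varepsilon^n h_{\mathrm p,\delta}[F](t)+o(\varepsilon^n).$$ 3. If $n=1$, $\delta<\frac12$ and $\hat F\in\ell^2(|\nu|^{1+2\delta})$, then $$h_\delta[f_\varepsilon](t)=\frac{\varepsilon^{-2\delta}}{\|\psi\|_2^2}\int_{\mathbb R}|x|^{2\delta}|\psi(x)|^2\,dx+\varepsilon\,h_{\mathrm p,\delta}[F](t)+o(\varepsilon).$$ The error terms are uniform for $t$ in compact subsets of $\mathbb R$. -/

import Mathlib

open MeasureTheory Filter Topology
open scoped FourierTransform SchwartzMap ContDiff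

noncomputable section

namespace PeriodicSchrodinger

/-- Euclidean space `ℝⁿ`. -/
abbrev E (n : ℕ) : Type := EuclideanSpace ℝ (Fin n)

/-- The lattice point `ν ∈ ℤⁿ` as a vector of `ℝⁿ`, so that `‖lat ν‖` is its Euclidean length. -/
def lat {n : ℕ} (ν : Fin n → ℤ) : E n := WithLp.toLp 2 (fun i => (ν i : ℝ))

/-- The Haar probability measure of the torus `ℝⁿ/ℤⁿ`. -/
abbrev torusMeasure (n : ℕ) : Measure (UnitAddTorus (Fin n)) :=
  Measure.pi (fun _ => (AddCircle.haarAddCircle : Measure UnitAddCircle))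

/-- The projection `ℝⁿ → ℝⁿ/ℤⁿ`. -/
def toTorus {n : ℕ} (x : E n) : UnitAddTorus (Fin n) := fun i => ((x i : ℝ) : UnitAddCircle)

/-- `F̂ ∈ ℓ²(|ν|^s)`, i.e. `∑ |ν|^s |F̂(ν)|² < ∞`. -/
def CoeffInWeightedL2 {n : ℕ} (F : UnitAddTorus (Fin n) → ℂ) (s : ℝ) : Prop :=
  Summable fun ν : Fin n → ℤ => ‖lat ν‖ ^ s * ‖UnitAddTorus.mFourierCoeff F ν‖ ^ 2

/-! ### The Schrödinger evolution and the dispersion functional -/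

/-- The class in `L²(ℝⁿ)` of a square integrable function. -/
def toL2 {n : ℕ} (f : E n → ℂ) : Lp ℂ 2 (volume : Measure (E n)) :=
  open Classical in if hf : MemLp f 2 volume then hf.toLp f else 0

/-- The multiplier `e^{-π i t |ξ|²}` of the free Schrödinger group. -/
def phase {n : ℕ} (t : ℝ) (ξ : E n) : ℂ :=
  Complex.exp (((-(Real.pi * t * ‖ξ‖ ^ 2) : ℝ) : ℂ) * Complex.I)

lemma memLp_phase_mul {n : ℕ} (t : ℝ) (g : Lp ℂ 2 (volume : Measure (E n))) :
    MemLp (fun ξ => phase t ξ * g ξ) 2 volume := by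
  have hc : Continuous (phase t : E n → ℂ) := by
    unfold phase
    fun_prop
  refine (Lp.memLp g).of_le (hc.aestronglyMeasurable.mul (Lp.aestronglyMeasurable g))
    (Eventually.of_forall fun ξ => ?_)
  rw [norm_mul, phase, Complex.norm_exp_ofReal_mul_I, one_mul]

/-- The solution `u(·, t) = e^{i t ħ Δ / 2} f`, `ħ = 1 / (2π)`, of `∂ₜ u = (i/2) ħ Δ u`,
`u(·, 0) = f`; on the Fourier side `û(ξ, t) = e^{-π i t |ξ|²} f̂(ξ)`. -/
def evolve {n : ℕ} (f : Lp ℂ 2 (volume : Measure (E n))) (t : ℝ) :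
    Lp ℂ 2 (volume : Measure (E n)) :=
  𝓕⁻ ((memLp_phase_mul t (𝓕 f)).toLp (fun ξ => phase t ξ * (𝓕 f) ξ))

/-- The integrand `|x|^{2δ} |u(x, t)|²` of the dispersion functional. -/
def hIntegrand {n : ℕ} (δ : ℝ) (f : E n → ℂ) (t : ℝ) (x : E n) : ℝ :=
  ‖x‖ ^ (2 * δ) * ‖evolve (toL2 f) t x‖ ^ 2

/-- `h_δ[f](t) = ∫ |x|^{2δ} |u(x, t)|² dx`. -/
def h {n : ℕ} (δ : ℝ) (f : E n → ℂ) (t : ℝ) : ℝ := ∫ x, hIntegrand δ f t x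

/-! ### Localised periodic data -/

/-- `‖ψ‖₂²`. -/
def normSq {n : ℕ} (ψ : 𝓢(E n, ℂ)) : ℝ := ∫ x, ‖ψ x‖ ^ 2

/-- `f_ε(x) = N_ε⁻¹ ψ(ε x) F(x)` with `N_ε² = ε^{-n} ‖ψ‖₂²` (for normalized `F`). -/
def fEps {n : ℕ} (ψ : 𝓢(E n, ℂ)) (F : UnitAddTorus (Fin n) → ℂ) (ε : ℝ) (x : E n) : ℂ :=
  ((Real.sqrt ((ε ^ n)⁻¹ * normSq ψ))⁻¹ : ℝ) * ψ (ε • x) * F (toTorus x)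

/-- `b_{n,δ} = Γ((n + 2δ)/2) / (2 π^{n/2 + 2δ} |Γ(-δ)|)`. -/
def b (n : ℕ) (δ : ℝ) : ℝ :=
  1 / (2 * Real.pi ^ ((n : ℝ) / 2 + 2 * δ)) *
    (Real.Gamma (((n : ℝ) + 2 * δ) / 2) / |Real.Gamma (-δ)|)

/-- `-2 b_{n,δ} / ‖ψ‖₂²`. -/
def pref {n : ℕ} (δ : ℝ) (ψ : 𝓢(E n, ℂ)) : ℂ := ((-(2 * b n δ) / normSq ψ : ℝ) : ℂ)

/-- `e^{2π i t τ}` at `τ = (|η|² - |ξ|²)/2`. -/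
def osc {n : ℕ} (t : ℝ) (ξ η : E n) : ℂ :=
  Complex.exp (((2 * Real.pi * t * ((‖η‖ ^ 2 - ‖ξ‖ ^ 2) / 2) : ℝ) : ℂ) * Complex.I)

/-- The pairs `(ν₁, ν₂)` of distinct lattice points. -/
abbrev OffDiag (n : ℕ) : Type := {p : (Fin n → ℤ) × (Fin n → ℤ) // p.1 ≠ p.2}

/-- The summands of the periodic limit:
`F̂(ν₁) conj(F̂(ν₂)) e^{π i t (|ν₂|² - |ν₁|²)} / |ν₁ - ν₂|^{n + 2δ}`. -/
def hpTerm {n : ℕ} (δ : ℝ) (F : UnitAddTorus (Fin n) → ℂ) (t : ℝ) (p : OffDiag n) : ℂ :=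
  UnitAddTorus.mFourierCoeff F p.1.1 *
    (starRingEnd ℂ) (UnitAddTorus.mFourierCoeff F p.1.2) *
    osc t (lat p.1.1) (lat p.1.2) /
    ((‖lat p.1.1 - lat p.1.2‖ ^ ((n : ℝ) + 2 * δ) : ℝ) : ℂ)

/-- The periodic limit `h_{p,δ}[F](t)`: the inverse Fourier transform of the finite measure
`-2 b_{n,δ} ‖ψ‖₂⁻² ∑_{ν₁ ≠ ν₂} F̂(ν₁) conj(F̂(ν₂)) |ν₁ - ν₂|^{-n-2δ} δ_{(|ν₂|² - |ν₁|²)/2}`. -/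
def hp {n : ℕ} (δ : ℝ) (ψ : 𝓢(E n, ℂ)) (F : UnitAddTorus (Fin n) → ℂ) (t : ℝ) : ℂ :=
  pref δ ψ * ∑' p : OffDiag n, hpTerm δ F t p

/-- The summands of the `ε`-periodic (off-diagonal) part. -/
def hpEpsTerm {n : ℕ} (δ : ℝ) (ψ : 𝓢(E n, ℂ)) (F : UnitAddTorus (Fin n) → ℂ) (ε t : ℝ)
    (p : OffDiag n) : ℂ :=
  UnitAddTorus.mFourierCoeff F p.1.1 *
    (starRingEnd ℂ) (UnitAddTorus.mFourierCoeff F p.1.2) *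
    ∫ z : E n × E n,
      (𝓕 ψ) (ε⁻¹ • (z.1 - lat p.1.1)) * (𝓕 ψ) (ε⁻¹ • (z.2 - lat p.1.2)) *
        osc t z.1 z.2 / ((‖z.1 - z.2‖ ^ ((n : ℝ) + 2 * δ) : ℝ) : ℂ)

/-- The `ε`-periodic part `h_{p,ε,δ}[F](t)` (off-diagonal part of `ε^{-n} h_δ[f_ε]`). -/
def hpEps {n : ℕ} (δ : ℝ) (ψ : 𝓢(E n, ℂ)) (F : UnitAddTorus (Fin n) → ℂ) (ε t : ℝ) : ℂ :=
  pref δ ψ * (((ε ^ (2 * n))⁻¹ : ℝ) : ℂ) * ∑' p : OffDiag n, hpEpsTerm δ ψ F ε t p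

/-- The background `h_{b,ε,δ}[F] = h_δ[f_ε] - ε^n h_{p,ε,δ}[F]`. -/
def hb {n : ℕ} (δ : ℝ) (ψ : 𝓢(E n, ℂ)) (F : UnitAddTorus (Fin n) → ℂ) (ε t : ℝ) : ℂ :=
  ((h δ (fEps ψ F ε) t : ℝ) : ℂ) - ((ε ^ n : ℝ) : ℂ) * hpEps δ ψ F ε t

/-! ### Frequency cutoff and error terms -/

/-- A smooth, compactly supported cutoff of the interval `[-1/4, 1/4]`. -/
structure IsCutoff (χ : ℝ → ℝ) : Prop where
  smooth : ContDiff ℝ ∞ χ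
  compactSupport : HasCompactSupport χ
  eq_one : ∀ τ, |τ| ≤ 1 / 4 → χ τ = 1

/-- The integrand of the convolution of `g` with the inverse Fourier transform of `χ`. -/
def projIntegrand (χ : ℝ → ℝ) (g : ℝ → ℂ) (t s : ℝ) : ℂ :=
  (𝓕⁻ (fun τ : ℝ => (χ τ : ℂ))) s * g (t - s)

/-- The frequency projection with symbol `χ`, i.e. `(proj χ g)^ = χ ĝ`, as a convolution;
for a cutoff `χ` of `[-1/4, 1/4]` this is `P_{<1/4}`. -/
def proj (χ : ℝ → ℝ) (g : ℝ → ℂ) (t : ℝ) : ℂ := ∫ s, projIntegrand χ g t s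

/-- `err ε t = o(g ε)` as `ε → 0⁺`, uniformly for `t` in compact subsets of `ℝ`. -/
def IsLittleOLocUnif (err : ℝ → ℝ → ℂ) (g : ℝ → ℝ) : Prop :=
  ∀ K : Set ℝ, IsCompact K → ∀ c : ℝ, 0 < c →
    ∀ᶠ ε in 𝓝[>] (0 : ℝ), ∀ t ∈ K, ‖err ε t‖ ≤ c * g ε

/-- The leading term `ε^{-2δ} ‖ψ‖₂⁻² ∫ |x|^{2δ} |ψ(x)|² dx`. -/
def lead {n : ℕ} (δ : ℝ) (ψ : 𝓢(E n, ℂ)) (ε : ℝ) : ℂ :=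
  ((ε ^ (-(2 * δ)) / normSq ψ * ∫ x, ‖x‖ ^ (2 * δ) * ‖ψ x‖ ^ 2 : ℝ) : ℂ)

end PeriodicSchrodinger

end

noncomputable section

namespace PeriodicSchrodinger

open Set
open scoped ENNReal RealInnerProductSpace

variable {n : ℕ}

/-! The weight `|x|^{2δ}` is a superposition of the functions `|1 - e^{2πi x·ζ}|²` against `b_{n,δ}
|ζ|^{-n-2δ} dζ` (`lintegral_one_sub_cos_mul_kern`). By Plancherel, the weighted norm of `u` is
therefore a Gagliardo double integral of `|û(ξ) - û(η)|² / |ξ - η|^{n+2δ}` (`lintegral_weight_eq`),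
and the constant `b_{n,δ}` is the one that makes this exact.

For localized periodic data, `û` is a sum of wave packets, copies of `ψ̂` scaled to radius `ε` and
centred at the lattice points. For `ε ≤ 1/4` their supports are disjoint, so at most one packet is
nonzero at each frequency and the squared difference splits into a diagonal and an off-diagonal sum
(`hasSum_diag_sub_offDiag`, `IsProfile.integral_total`). After rescaling, the diagonal term at `ν`
is the dispersion of `ψ` plus a variation caused by the flow, with transport displacement `tεν` and
rescaled time `tε²`. Parseval sums the first pieces to the leading term. The outcome is the exact
identity `h = lead + diagVar + ε^n hpEps` (`IsAdmissible.h_eq`), so the background is `lead +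
diagVar`.

The off-diagonal part tends to the periodic limit by dominated convergence. Since `∫ ψ̂ = ψ(0) = 1`,
each interaction converges to its value at the lattice points. The pair sum is dominated through
Schur's test, because `|ν|^{-n-2δ}` is summable over nonzero lattice points; only `F̂ ∈ ℓ²` is
needed here (`IsAdmissible.hpEps_sub_hp`).

The variation of a packet is at most `C (min(|h|², |h|^{2δ}) + s²)` with `h = tεν`, `s = tε²`
(`IsProfile.exists_packetVar_bound`). If `F̂ ∈ ℓ²(|ν|^p)` with `2δ ≤ p < 2`, dominated convergence
over `ν` yields `diagVar = o(ε^{p-2δ})` (`IsAdmissible.diagVar_isLittleO`). The choice `p = 2δ`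
gives the first assertion, and `p = 1 + 2δ`, admissible when `δ < 1/2`, gives the third.

For the second assertion `p = n + 2δ` may exceed `2`, so the variation need not be small and the
projection retains it instead. A packet with `ε|ν| ≤ 1/16` has variation with time frequencies in
`[-1/4, 1/4]`, on which `χ = 1`; it is fixed by the projection (`IsProfile.proj_packetVar`). The
remaining packets contribute at most `ε^n` times a tail of the convergent series `∑ |ν|^{n+2δ}
|F̂(ν)|²`, hence `o(ε^n)` (`IsAdmissible.exists_proj_diagVar`). -/

/-! ### The power weight as an integral of squared character differences. -/

lemma lintegral_rpow_sub_one_mul_exp {a r : ℝ} (ha : 0 < a) (hr : 0 < r) :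
    ∫⁻ μ in Ioi (0 : ℝ), ENNReal.ofReal (μ ^ (a - 1) * Real.exp (-(r * μ))) =
      ENNReal.ofReal ((1 / r) ^ a * Real.Gamma a) := by
  rw [← Real.integral_rpow_mul_exp_neg_mul_Ioi ha hr, ofReal_integral_eq_lintegral_ofReal]
  · apply Integrable.of_integral_ne_zero
    rw [Real.integral_rpow_mul_exp_neg_mul_Ioi ha hr]
    have := Real.Gamma_pos_of_pos ha
    positivity
  · filter_upwards [ae_restrict_mem measurableSet_Ioi] with μ hμ
    have : (0 : ℝ) < μ := hμ
    positivity

/-- The recursion `Γ(s + 1) = s Γ(s)` at `s = -δ`. It trades the negative argument for a positive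
one, from which the positivity of `b` follows. -/
lemma abs_Gamma_neg {δ : ℝ} (hδ0 : 0 < δ) (hδ1 : δ < 1) :
    |Real.Gamma (-δ)| = Real.Gamma (1 - δ) / δ := by
  have h := Real.Gamma_add_one (s := -δ) (by linarith)
  have h1 : 0 < Real.Gamma (1 - δ) := Real.Gamma_pos_of_pos (by linarith)
  rw [show -δ + 1 = 1 - δ by ring] at h
  have h2 : Real.Gamma (-δ) = -(Real.Gamma (1 - δ) / δ) := by
    rw [h]; field_simp
  rw [h2, abs_neg, abs_of_pos (by positivity)]

/-- The indicator is kept inside an integral over the fixed half-line so that, together with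
`lintegral_rpow_Ioi_lt`, it can be exchanged by Tonelli. -/
lemma lintegral_exp_neg_Ioi_lt {s : ℝ} (hs : 0 ≤ s) :
    ∫⁻ v in Ioi (0 : ℝ), (Iio s).indicator (fun v => ENNReal.ofReal (Real.exp (-v))) v =
      ENNReal.ofReal (1 - Real.exp (-s)) := by
  rw [lintegral_indicator measurableSet_Iio, Measure.restrict_restrict measurableSet_Iio,
    Iio_inter_Ioi, ← ofReal_integral_eq_lintegral_ofReal]
  · rw [← integral_Ioc_eq_integral_Ioo, ← intervalIntegral.integral_of_le hs]
    simp
  · exact (Continuous.integrableOn_Icc (by fun_prop)).mono_set Ioo_subset_Icc_self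
  · exact Eventually.of_forall fun v => (Real.exp_pos _).le

lemma lintegral_rpow_Ioi_lt {δ s : ℝ} (hδ : 0 < δ) (hs : 0 ≤ s) :
    ∫⁻ μ in Ioi (0 : ℝ), (Iio s).indicator (fun μ => ENNReal.ofReal (μ ^ (δ - 1))) μ =
      ENNReal.ofReal (s ^ δ / δ) := by
  have hi : IntervalIntegrable (fun μ : ℝ => μ ^ (δ - 1)) volume 0 s :=
    intervalIntegral.intervalIntegrable_rpow' (by linarith)
  rw [lintegral_indicator measurableSet_Iio, Measure.restrict_restrict measurableSet_Iio,
    Iio_inter_Ioi, ← ofReal_integral_eq_lintegral_ofReal]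
  · rw [← integral_Ioc_eq_integral_Ioo, ← intervalIntegral.integral_of_le hs,
      integral_rpow (Or.inl (by linarith))]
    simp [Real.zero_rpow hδ.ne']
  · exact ((intervalIntegrable_iff_integrableOn_Ioc_of_le hs).1 hi).mono_set Ioo_subset_Ioc_self
  · filter_upwards [ae_restrict_mem measurableSet_Ioo] with μ hμ
    exact Real.rpow_nonneg hμ.1.le _

/-- `∫₀^∞ μ^{δ-1} (1 - e^{-s/μ}) dμ = |Γ(-δ)| s^δ`. -/
lemma lintegral_rpow_mul_one_sub_exp {δ s : ℝ} (hδ0 : 0 < δ) (hδ1 : δ < 1) (hs : 0 ≤ s) :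
    ∫⁻ μ in Ioi (0 : ℝ), ENNReal.ofReal (μ ^ (δ - 1) * (1 - Real.exp (-(s / μ)))) =
      ENNReal.ofReal (s ^ δ * |Real.Gamma (-δ)|) := by
  -- The integral is lifted to the region `μ v < s` of the quadrant. Integrating in `μ` first leaves
  -- `(s^δ / δ) ∫ v^{-δ} e^{-v} dv`, and `Γ(1 - δ) / δ = |Γ(-δ)|`.
  have step : ∀ μ ∈ Ioi (0 : ℝ), ENNReal.ofReal (μ ^ (δ - 1) * (1 - Real.exp (-(s / μ)))) =
      ∫⁻ v in Ioi (0 : ℝ), {p : ℝ × ℝ | p.1 * p.2 < s}.indicator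
        (fun p => ENNReal.ofReal (p.1 ^ (δ - 1)) * ENNReal.ofReal (Real.exp (-p.2))) (μ, v) := by
    intro μ hμ
    have hμ' : (0 : ℝ) < μ := hμ
    rw [ENNReal.ofReal_mul (Real.rpow_nonneg hμ'.le _),
      ← lintegral_exp_neg_Ioi_lt (div_nonneg hs hμ'.le), ← lintegral_const_mul']
    · refine setLIntegral_congr_fun measurableSet_Ioi fun v _ => ?_
      simp only [indicator, mem_Iio, mem_ofPred_eq, lt_div_iff₀ hμ', mul_comm v μ]
      split_ifs <;> simp
    · exact ENNReal.ofReal_ne_top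
  rw [setLIntegral_congr_fun measurableSet_Ioi step, lintegral_lintegral_swap]
  · have step2 : ∀ v ∈ Ioi (0 : ℝ), ∫⁻ μ in Ioi (0 : ℝ), {p : ℝ × ℝ | p.1 * p.2 < s}.indicator
        (fun p => ENNReal.ofReal (p.1 ^ (δ - 1)) * ENNReal.ofReal (Real.exp (-p.2))) (μ, v) =
        ENNReal.ofReal (s ^ δ / δ) * ENNReal.ofReal (v ^ ((1 - δ) - 1) * Real.exp (-(1 * v))) := by
      intro v hv
      have hv' : (0 : ℝ) < v := hv
      have : ENNReal.ofReal (s ^ δ / δ) * ENNReal.ofReal (v ^ ((1 - δ) - 1) * Real.exp (-(1 * v))) =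
          ENNReal.ofReal ((s / v) ^ δ / δ) * ENNReal.ofReal (Real.exp (-v)) := by
        rw [← ENNReal.ofReal_mul (by positivity), ← ENNReal.ofReal_mul (by positivity),
          Real.div_rpow hs hv'.le, show (1 - δ) - 1 = -δ by ring, Real.rpow_neg hv'.le, one_mul]
        congr 1; field_simp
      rw [this, ← lintegral_rpow_Ioi_lt hδ0 (div_nonneg hs hv'.le), ← lintegral_mul_const']
      · refine setLIntegral_congr_fun measurableSet_Ioi fun μ _ => ?_
        simp only [indicator, mem_Iio, mem_ofPred_eq, lt_div_iff₀ hv']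
        split_ifs <;> simp
      · exact ENNReal.ofReal_ne_top
    rw [setLIntegral_congr_fun measurableSet_Ioi step2, lintegral_const_mul' _ _ ENNReal.ofReal_ne_top,
      lintegral_rpow_sub_one_mul_exp (by linarith) one_pos, ← ENNReal.ofReal_mul (by positivity),
      abs_Gamma_neg hδ0 hδ1]
    congr 1; simp; ring
  · refine Measurable.aemeasurable ?_
    refine Measurable.indicator (by fun_prop) ?_
    exact measurableSet_lt (by fun_prop) (by fun_prop)

/-- Real part of the Fourier transform of a Gaussian. -/
lemma integral_cos_mul_gaussian {n : ℕ} {c : ℝ} (hc : 0 < c) (x : E n) :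
    Integrable (fun ζ : E n => Real.cos (2 * Real.pi * ⟪x, ζ⟫) * Real.exp (-c * ‖ζ‖ ^ 2)) ∧
    ∫ ζ : E n, Real.cos (2 * Real.pi * ⟪x, ζ⟫) * Real.exp (-c * ‖ζ‖ ^ 2) =
      (Real.pi / c) ^ ((n : ℝ) / 2) * Real.exp (-(Real.pi ^ 2 * ‖x‖ ^ 2 / c)) := by
  have hcr : 0 < (c : ℂ).re := by simpa using hc
  have hi := GaussianFourier.integrable_cexp_neg_mul_sq_norm_add (V := E n) hcr
    (2 * Real.pi * Complex.I) x
  have he := GaussianFourier.integral_cexp_neg_mul_sq_norm_add (V := E n) hcr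
    (2 * Real.pi * Complex.I) x
  have hre : ∀ ζ : E n, (Complex.exp (-(c : ℂ) * (‖ζ‖ : ℂ) ^ 2 +
      2 * Real.pi * Complex.I * (⟪x, ζ⟫ : ℝ))).re =
      Real.cos (2 * Real.pi * ⟪x, ζ⟫) * Real.exp (-c * ‖ζ‖ ^ 2) := by
    intro ζ
    rw [Complex.exp_re]
    have h1 : (-(c : ℂ) * (‖ζ‖ : ℂ) ^ 2 + 2 * Real.pi * Complex.I * (⟪x, ζ⟫ : ℝ)) =
      ((-c * ‖ζ‖ ^ 2 : ℝ) : ℂ) + ((2 * Real.pi * ⟪x, ζ⟫ : ℝ) : ℂ) * Complex.I := by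
      push_cast; ring
    rw [h1]
    simp [-Complex.ofReal_mul, -Complex.ofReal_pow, -Complex.ofReal_neg, mul_comm]
  have hre' : (fun ζ : E n => Real.cos (2 * Real.pi * ⟪x, ζ⟫) * Real.exp (-c * ‖ζ‖ ^ 2)) =
    fun ζ : E n => RCLike.re (Complex.exp (-(c : ℂ) * (‖ζ‖ : ℂ) ^ 2 +
      2 * Real.pi * Complex.I * (⟪x, ζ⟫ : ℝ))) := by
    ext ζ; exact (hre ζ).symm
  refine ⟨by rw [hre']; exact hi.re, ?_⟩
  rw [hre', integral_re hi, he]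
  have h2 : ((Real.pi / c : ℂ) ^ ((Module.finrank ℝ (E n) : ℂ) / 2) *
      Complex.exp ((2 * Real.pi * Complex.I) ^ 2 * (‖x‖ : ℂ) ^ 2 / (4 * c))) =
      (((Real.pi / c) ^ ((n : ℝ) / 2) * Real.exp (-(Real.pi ^ 2 * ‖x‖ ^ 2 / c)) : ℝ) : ℂ) := by
    push_cast
    rw [Complex.ofReal_cpow (by positivity)]
    push_cast
    congr 2
    · simp
    · rw [mul_pow, mul_pow, Complex.I_sq]
      have : (c : ℂ) ≠ 0 := by exact_mod_cast hc.ne'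
      field_simp; ring
  rw [h2]; exact Complex.ofReal_re _

/-- Difference of the Gaussian transforms at `0` and at `x`. -/
lemma lintegral_one_sub_cos_mul_gaussian {n : ℕ} {μ : ℝ} (hμ : 0 < μ) (x : E n) :
    ∫⁻ ζ : E n, ENNReal.ofReal (2 * (1 - Real.cos (2 * Real.pi * ⟪x, ζ⟫)) *
        Real.exp (-(Real.pi ^ 2 * ‖ζ‖ ^ 2 * μ))) =
      ENNReal.ofReal (2 * (Real.pi * μ) ^ (-((n : ℝ) / 2)) * (1 - Real.exp (-(‖x‖ ^ 2 / μ)))) := by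
  have hc : 0 < Real.pi ^ 2 * μ := by positivity
  obtain ⟨h1, h2⟩ := integral_cos_mul_gaussian hc (0 : E n)
  obtain ⟨h3, h4⟩ := integral_cos_mul_gaussian hc x
  have he : ∀ ζ : E n, 2 * (1 - Real.cos (2 * Real.pi * ⟪x, ζ⟫)) *
        Real.exp (-(Real.pi ^ 2 * ‖ζ‖ ^ 2 * μ)) =
      2 * (Real.cos (2 * Real.pi * ⟪(0 : E n), ζ⟫) * Real.exp (-(Real.pi ^ 2 * μ) * ‖ζ‖ ^ 2) -
        Real.cos (2 * Real.pi * ⟪x, ζ⟫) * Real.exp (-(Real.pi ^ 2 * μ) * ‖ζ‖ ^ 2)) := by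
    intro ζ
    rw [show -(Real.pi ^ 2 * μ) * ‖ζ‖ ^ 2 = -(Real.pi ^ 2 * ‖ζ‖ ^ 2 * μ) by ring]
    simp; ring
  rw [← ofReal_integral_eq_lintegral_ofReal]
  · simp_rw [he]
    rw [integral_const_mul, integral_sub h1 h3, h2, h4]
    congr 1
    have : (Real.pi * μ) ^ (-((n : ℝ) / 2)) = (Real.pi / (Real.pi ^ 2 * μ)) ^ ((n : ℝ) / 2) := by
      rw [Real.rpow_neg (by positivity), ← Real.inv_rpow (by positivity)]
      congr 1; field_simp
    rw [this, show Real.pi ^ 2 * ‖x‖ ^ 2 / (Real.pi ^ 2 * μ) = ‖x‖ ^ 2 / μ by field_simp]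
    simp; ring
  · simp_rw [he]
    exact (h1.sub h3).const_mul 2
  · refine Eventually.of_forall fun ζ => ?_
    have := Real.cos_le_one (2 * Real.pi * ⟪x, ζ⟫)
    have h : 0 ≤ 1 - Real.cos (2 * Real.pi * ⟪x, ζ⟫) := by linarith
    positivity

lemma b_pos {n : ℕ} (hn : 1 ≤ n) {δ : ℝ} (hδ0 : 0 < δ) (hδ1 : δ < 1) : 0 < b n δ := by
  have h1 : 0 < Real.Gamma (1 - δ) := Real.Gamma_pos_of_pos (by linarith)
  have hn' : (1 : ℝ) ≤ n := by exact_mod_cast hn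
  have h2 : 0 < Real.Gamma (((n : ℝ) + 2 * δ) / 2) := Real.Gamma_pos_of_pos (by linarith)
  rw [b, abs_Gamma_neg hδ0 hδ1]
  positivity

/-- The singular kernel `|ζ|^{-n-2δ}`. -/
def kern {n : ℕ} (δ : ℝ) (ζ : E n) : ℝ := (‖ζ‖ ^ ((n : ℝ) + 2 * δ))⁻¹

lemma kern_nonneg {n : ℕ} (δ : ℝ) (ζ : E n) : 0 ≤ kern δ ζ := by unfold kern; positivity

lemma kern_neg {n : ℕ} (δ : ℝ) (ζ : E n) : kern δ (-ζ) = kern δ ζ := by simp [kern]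

lemma measurable_kern {n : ℕ} (δ : ℝ) : Measurable (kern δ : E n → ℝ) := by
  unfold kern; fun_prop

/-- `|x|^{2δ}` as a superposition of `|1 - e^{2πi x·ζ}|²`. -/
lemma lintegral_one_sub_cos_mul_kern {n : ℕ} (hn : 1 ≤ n) {δ : ℝ} (hδ0 : 0 < δ) (hδ1 : δ < 1)
    (x : E n) :
    ∫⁻ ζ : E n, ENNReal.ofReal (b n δ * (2 * (1 - Real.cos (2 * Real.pi * ⟪x, ζ⟫)) * kern δ ζ)) =
      ENNReal.ofReal (‖x‖ ^ (2 * δ)) := by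
  have hn' : (1 : ℝ) ≤ n := by exact_mod_cast hn
  have hb := b_pos hn hδ0 hδ1
  set a : ℝ := (n : ℝ) / 2 + δ with ha
  have ha0 : 0 < a := by positivity
  have hGa := Real.Gamma_pos_of_pos ha0
  have hG1 : 0 < |Real.Gamma (-δ)| := by
    rw [abs_Gamma_neg hδ0 hδ1]
    have := Real.Gamma_pos_of_pos (show 0 < 1 - δ by linarith)
    positivity
  have hcos : ∀ ζ : E n, 0 ≤ 2 * (1 - Real.cos (2 * Real.pi * ⟪x, ζ⟫)) := fun ζ => by
    have := Real.cos_le_one (2 * Real.pi * ⟪x, ζ⟫); linarith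
  -- Subordination: with `2a = n + 2δ`, the kernel `|ζ|^{-2a}` equals `π^{2a} / Γ(a)` times `∫
  -- μ^{a-1} e^{-π²|ζ|²μ} dμ`, so only Gaussians have to be integrated in `ζ`. At `ζ = 0` the factor
  -- `1 - cos` vanishes.
  set C : ℝ := b n δ * (Real.pi ^ (2 * a) / Real.Gamma a) with hC
  have hC0 : 0 ≤ C := by positivity
  have step : ∀ ζ : E n,
      ENNReal.ofReal (b n δ * (2 * (1 - Real.cos (2 * Real.pi * ⟪x, ζ⟫)) * kern δ ζ)) =
      ENNReal.ofReal C * ∫⁻ μ in Ioi (0 : ℝ), ENNReal.ofReal (μ ^ (a - 1)) * ENNReal.ofReal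
        (2 * (1 - Real.cos (2 * Real.pi * ⟪x, ζ⟫)) * Real.exp (-(Real.pi ^ 2 * ‖ζ‖ ^ 2 * μ))) := by
    intro ζ
    rcases eq_or_ne ζ 0 with rfl | hζ
    · simp
    have hζ' : 0 < ‖ζ‖ := norm_pos_iff.2 hζ
    have h1 : ∀ μ ∈ Ioi (0 : ℝ), ENNReal.ofReal (μ ^ (a - 1)) * ENNReal.ofReal
        (2 * (1 - Real.cos (2 * Real.pi * ⟪x, ζ⟫)) * Real.exp (-(Real.pi ^ 2 * ‖ζ‖ ^ 2 * μ))) =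
        ENNReal.ofReal (2 * (1 - Real.cos (2 * Real.pi * ⟪x, ζ⟫))) *
        ENNReal.ofReal (μ ^ (a - 1) * Real.exp (-(Real.pi ^ 2 * ‖ζ‖ ^ 2 * μ))) := by
      intro μ hμ
      have hμ' : (0 : ℝ) < μ := hμ
      rw [← ENNReal.ofReal_mul (by positivity), ← ENNReal.ofReal_mul (hcos ζ)]
      congr 1; ring
    rw [setLIntegral_congr_fun measurableSet_Ioi h1, lintegral_const_mul' _ _ ENNReal.ofReal_ne_top,
      lintegral_rpow_sub_one_mul_exp ha0 (by positivity), ← ENNReal.ofReal_mul (hcos ζ),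
      ← ENNReal.ofReal_mul hC0]
    congr 1
    have h2 : (1 / (Real.pi ^ 2 * ‖ζ‖ ^ 2)) ^ a = (Real.pi ^ (2 * a))⁻¹ * kern δ ζ := by
      rw [kern, one_div, Real.inv_rpow (by positivity), Real.mul_rpow (by positivity) (by positivity),
        ← Real.rpow_natCast_mul Real.pi_pos.le, ← Real.rpow_natCast_mul hζ'.le, mul_inv]
      congr 3
      rw [ha]; push_cast; ring
    rw [h2, hC]
    have : 0 < Real.pi ^ (2 * a) := by positivity
    field_simp
  simp_rw [step]
  rw [lintegral_const_mul' _ _ ENNReal.ofReal_ne_top, lintegral_lintegral_swap]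
  -- The Gaussian integral contributes `μ^{-n/2}`, and `a - 1 - n/2 = δ - 1` leaves the integral
  -- that produces `|Γ(-δ)|`. Both Gamma factors then cancel against those of `b`.
  · have step2 : ∀ μ ∈ Ioi (0 : ℝ), ∫⁻ ζ : E n, ENNReal.ofReal (μ ^ (a - 1)) * ENNReal.ofReal
        (2 * (1 - Real.cos (2 * Real.pi * ⟪x, ζ⟫)) * Real.exp (-(Real.pi ^ 2 * ‖ζ‖ ^ 2 * μ))) =
        ENNReal.ofReal (2 * Real.pi ^ (-((n : ℝ) / 2))) *
          ENNReal.ofReal (μ ^ (δ - 1) * (1 - Real.exp (-(‖x‖ ^ 2 / μ)))) := by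
      intro μ hμ
      have hμ' : (0 : ℝ) < μ := hμ
      rw [lintegral_const_mul' _ _ ENNReal.ofReal_ne_top, lintegral_one_sub_cos_mul_gaussian hμ',
        ← ENNReal.ofReal_mul (by positivity), ← ENNReal.ofReal_mul (by positivity),
        Real.mul_rpow (by positivity) hμ'.le]
      congr 1
      rw [show μ ^ (δ - 1) = μ ^ (a - 1) * μ ^ (-((n : ℝ) / 2)) by
        rw [← Real.rpow_add hμ']; congr 1; rw [ha]; ring]
      ring
    rw [setLIntegral_congr_fun measurableSet_Ioi step2,
      lintegral_const_mul' _ _ ENNReal.ofReal_ne_top,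
      lintegral_rpow_mul_one_sub_exp hδ0 hδ1 (by positivity), ← ENNReal.ofReal_mul (by positivity),
      ← ENNReal.ofReal_mul hC0]
    congr 1
    rw [hC, b, ← Real.rpow_natCast_mul (norm_nonneg x),
      show ((n : ℝ) + 2 * δ) / 2 = a by rw [ha]; ring,
      show Real.pi ^ (2 * a) = Real.pi ^ ((n : ℝ) / 2 + 2 * δ) * Real.pi ^ ((n : ℝ) / 2) by
        rw [← Real.rpow_add Real.pi_pos]; congr 1; rw [ha]; ring,
      Real.rpow_neg Real.pi_pos.le]
    have : 0 < Real.pi ^ ((n : ℝ) / 2 + 2 * δ) := by positivity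
    have : 0 < Real.pi ^ ((n : ℝ) / 2) := by positivity
    generalize Real.pi ^ ((n : ℝ) / 2 + 2 * δ) = A at *
    generalize Real.pi ^ ((n : ℝ) / 2) = B at *
    push_cast
    field_simp
  · refine Measurable.aemeasurable ?_
    fun_prop

/-! ### The Fourier transform on `L²` and the Gagliardo form of the weighted norm. -/

lemma lintegral_ofReal_norm_sq {α : Type*} [MeasurableSpace α] {μ : Measure α} (f : Lp ℂ 2 μ) :
    ∫⁻ x, ENNReal.ofReal (‖f x‖ ^ 2) ∂μ = ENNReal.ofReal (‖f‖ ^ 2) := by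
  have h1 : Integrable (fun x => ‖f x‖ ^ 2) μ := (Lp.memLp f).integrable_norm_pow (by norm_num)
  rw [← ofReal_integral_eq_lintegral_ofReal h1 (Eventually.of_forall fun x => by positivity)]
  congr 1
  have h2 : inner ℂ f f = ((‖f‖ ^ 2 : ℝ) : ℂ) := by
    rw [inner_self_eq_norm_sq_to_K]; norm_cast
  rw [L2.inner_def] at h2
  have h3 : ∫ x, inner ℂ (f x) (f x) ∂μ = ((∫ x, ‖f x‖ ^ 2 ∂μ : ℝ) : ℂ) := by
    rw [← integral_complex_ofReal]
    congr 1; ext x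
    rw [inner_self_eq_norm_sq_to_K]; norm_cast
  rw [h3] at h2
  exact_mod_cast h2

lemma memLp_unimodular_mul (m : E n → ℂ) (hm : Continuous m) (h1 : ∀ x, ‖m x‖ = 1)
    (g : Lp ℂ 2 (volume : Measure (E n))) : MemLp (fun x => m x * g x) 2 volume :=
  (Lp.memLp g).of_le (hm.aestronglyMeasurable.mul (Lp.aestronglyMeasurable g))
    (Eventually.of_forall fun x => by rw [norm_mul, h1, one_mul])

/-- Multiplication by a continuous unimodular function on `L²`. -/
def mulUnimodular (m : E n → ℂ) (hm : Continuous m) (h1 : ∀ x, ‖m x‖ = 1) :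
    Lp ℂ 2 (volume : Measure (E n)) →L[ℂ] Lp ℂ 2 (volume : Measure (E n)) :=
  have hmem := memLp_unimodular_mul m hm h1
  LinearMap.mkContinuous
    { toFun := fun g => (hmem g).toLp _
      map_add' := fun f g => by
        apply Lp.ext
        filter_upwards [(hmem (f + g)).coeFn_toLp, (hmem f).coeFn_toLp, (hmem g).coeFn_toLp,
          Lp.coeFn_add f g, Lp.coeFn_add ((hmem f).toLp _) ((hmem g).toLp _)] with x h1 h2 h3 h4 h5
        rw [h1, h5, Pi.add_apply, h2, h3, h4, Pi.add_apply, mul_add]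
      map_smul' := fun c g => by
        apply Lp.ext
        filter_upwards [(hmem (c • g)).coeFn_toLp, (hmem g).coeFn_toLp,
          Lp.coeFn_smul c g, Lp.coeFn_smul c ((hmem g).toLp _)] with x h1 h2 h3 h4
        rw [RingHom.id_apply, h1, h4, Pi.smul_apply, h2, h3, Pi.smul_apply, smul_eq_mul, smul_eq_mul]
        ring } 1 (fun g => by
    rw [one_mul]
    refine Lp.norm_le_norm_of_ae_le ?_
    filter_upwards [(hmem g).coeFn_toLp] with x hx
    simp only [LinearMap.coe_mk, AddHom.coe_mk]
    rw [hx, norm_mul, h1, one_mul])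

lemma coeFn_mulUnimodular (m : E n → ℂ) (hm : Continuous m) (h1 : ∀ x, ‖m x‖ = 1)
    (g : Lp ℂ 2 (volume : Measure (E n))) :
    mulUnimodular m hm h1 g =ᵐ[volume] fun x => m x * g x :=
  (memLp_unimodular_mul m hm h1 g).coeFn_toLp

/-- The character `x ↦ e^{2πi x·ζ}`. -/
def char (ζ x : E n) : ℂ := Complex.exp (((2 * Real.pi * ⟪x, ζ⟫ : ℝ) : ℂ) * Complex.I)

lemma continuous_char (ζ : E n) : Continuous (char ζ) := by unfold char; fun_prop

lemma norm_char (ζ x : E n) : ‖char ζ x‖ = 1 := Complex.norm_exp_ofReal_mul_I _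

lemma norm_exp_sub_one_sq (θ : ℝ) :
    ‖Complex.exp ((θ : ℂ) * Complex.I) - 1‖ ^ 2 = 2 * (1 - Real.cos θ) := by
  rw [← Complex.normSq_eq_norm_sq, Complex.normSq_apply]
  simp only [Complex.sub_re, Complex.sub_im, Complex.exp_ofReal_mul_I_re,
    Complex.exp_ofReal_mul_I_im, Complex.one_re, Complex.one_im]
  nlinarith [Real.sin_sq_add_cos_sq θ]

lemma fourierInv_comp_sub_apply (g : E n → ℂ) (ζ x : E n) :
    𝓕⁻ (fun ξ => g (ξ - ζ)) x = char ζ x * 𝓕⁻ g x := by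
  simp only [Real.fourierInv_eq', smul_eq_mul]
  rw [← integral_const_mul, ← integral_add_right_eq_self _ ζ]
  refine integral_congr_ae (Eventually.of_forall fun ξ => ?_)
  simp only [add_sub_cancel_right, char]
  rw [← mul_assoc, ← Complex.exp_add]
  congr 2
  rw [inner_add_left, real_inner_comm x ζ]
  push_cast; ring

/-- Both sides are continuous in `g`, so it suffices to check Schwartz functions, for which the
inverse transform is an integral and the substitution `ξ ↦ ξ + ζ` applies. -/
lemma fourierInv_translate (g : Lp ℂ 2 (volume : Measure (E n))) (ζ : E n) :
    𝓕⁻ (Lp.compMeasurePreserving (fun ξ => ξ - ζ) (measurePreserving_sub_right volume ζ) g) =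
      mulUnimodular (char ζ) (continuous_char ζ) (norm_char ζ) (𝓕⁻ g) := by
  refine DenseRange.induction_on (p := fun g => 𝓕⁻ (Lp.compMeasurePreserving (fun ξ => ξ - ζ)
      (measurePreserving_sub_right volume ζ) g) =
      mulUnimodular (char ζ) (continuous_char ζ) (norm_char ζ) (𝓕⁻ g))
    (SchwartzMap.denseRange_toLpCLM (p := 2) (μ := (volume : Measure (E n))) ENNReal.ofNat_ne_top)
    g ?_ ?_
  · refine isClosed_eq ?_ ?_
    · exact (Lp.fourierTransformₗᵢ (E n) ℂ).symm.continuous.comp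
        (Lp.isometry_compMeasurePreserving (measurePreserving_sub_right volume ζ)).continuous
    · exact (mulUnimodular (char ζ) (continuous_char ζ) (norm_char ζ)).continuous.comp
        (Lp.fourierTransformₗᵢ (E n) ℂ).symm.continuous
  · intro f
    have h1 : Lp.compMeasurePreserving (fun ξ => ξ - ζ) (measurePreserving_sub_right volume ζ)
        (f.toLp 2 volume) = (f.compSubConstCLM ℂ ζ).toLp 2 volume := by
      apply Lp.ext
      filter_upwards [Lp.coeFn_compMeasurePreserving (f.toLp 2 volume)
        (measurePreserving_sub_right volume ζ), (f.compSubConstCLM ℂ ζ).coeFn_toLp 2 volume,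
        (measurePreserving_sub_right volume ζ).quasiMeasurePreserving.ae (f.coeFn_toLp 2 volume)]
        with x h1 h2 h3
      rw [h1, h2, Function.comp_apply, h3]; rfl
    simp only [SchwartzMap.toLpCLM_apply]
    rw [h1, SchwartzMap.toLp_fourierInv_eq, SchwartzMap.toLp_fourierInv_eq]
    apply Lp.ext
    filter_upwards [SchwartzMap.coeFn_toLp (𝓕⁻ (f.compSubConstCLM ℂ ζ)) 2 volume,
      SchwartzMap.coeFn_toLp (𝓕⁻ f) 2 volume,
      coeFn_mulUnimodular (char ζ) (continuous_char ζ) (norm_char ζ) ((𝓕⁻ f).toLp 2 volume)]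
      with x h1 h2 h3
    rw [h1, h3, h2, SchwartzMap.fourierInv_coe, SchwartzMap.fourierInv_coe]
    exact fourierInv_comp_sub_apply f ζ x

/-- Plancherel for the translate minus the function, with `|e^{iθ} - 1|² = 2(1 - cos θ)`. -/
lemma lintegral_norm_translate_sub_sq (g : Lp ℂ 2 (volume : Measure (E n))) (ζ : E n) :
    ∫⁻ ξ, ENNReal.ofReal (‖g (ξ - ζ) - g ξ‖ ^ 2) =
      ∫⁻ x, ENNReal.ofReal (2 * (1 - Real.cos (2 * Real.pi * ⟪x, ζ⟫))) *
        ENNReal.ofReal (‖(𝓕⁻ g : Lp ℂ 2 (volume : Measure (E n))) x‖ ^ 2) := by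
  set τ := Lp.compMeasurePreserving (fun ξ => ξ - ζ) (measurePreserving_sub_right volume ζ) g with hτ
  have h1 : ∫⁻ ξ, ENNReal.ofReal (‖g (ξ - ζ) - g ξ‖ ^ 2) = ENNReal.ofReal (‖τ - g‖ ^ 2) := by
    rw [← lintegral_ofReal_norm_sq]
    refine lintegral_congr_ae ?_
    filter_upwards [Lp.coeFn_sub τ g, Lp.coeFn_compMeasurePreserving g
      (measurePreserving_sub_right volume ζ)] with x h1 h2
    rw [h1, Pi.sub_apply, h2]; rfl
  have h2 : ‖τ - g‖ = ‖𝓕⁻ τ - 𝓕⁻ g‖ := by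
    have : 𝓕⁻ τ - 𝓕⁻ g = (Lp.fourierTransformₗᵢ (E n) ℂ).symm (τ - g) := by
      rw [map_sub]; rfl
    rw [this, LinearIsometryEquiv.norm_map]
  rw [h1, h2, hτ, fourierInv_translate, ← lintegral_ofReal_norm_sq]
  refine lintegral_congr_ae ?_
  filter_upwards [Lp.coeFn_sub (mulUnimodular (char ζ) (continuous_char ζ) (norm_char ζ) (𝓕⁻ g))
    (𝓕⁻ g), coeFn_mulUnimodular (char ζ) (continuous_char ζ) (norm_char ζ) (𝓕⁻ g)] with x h1 h2
  rw [h1, Pi.sub_apply, h2, ← ENNReal.ofReal_mul, ← norm_exp_sub_one_sq, ← mul_pow, ← norm_mul]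
  · congr 3; rw [sub_mul, one_mul]; rfl
  · have := Real.cos_le_one (2 * Real.pi * ⟪x, ζ⟫); linarith

/-- The Gagliardo-type form of the weighted norm. -/
theorem lintegral_weight_eq (hn : 1 ≤ n) {δ : ℝ} (hδ0 : 0 < δ) (hδ1 : δ < 1)
    {G : E n → ℂ} (hG : MemLp G 2 volume) :
    ∫⁻ x, ENNReal.ofReal (‖x‖ ^ (2 * δ) *
        ‖(𝓕⁻ (hG.toLp G) : Lp ℂ 2 (volume : Measure (E n))) x‖ ^ 2) =
      ∫⁻ z : E n × E n, ENNReal.ofReal (b n δ * (‖G z.1 - G z.2‖ ^ 2 * kern δ (z.1 - z.2))) := by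
  set g := hG.toLp G with hg
  set u := (𝓕⁻ g : Lp ℂ 2 (volume : Measure (E n))) with hu
  have hb := (b_pos hn hδ0 hδ1).le
  have hum : Measurable u := (Lp.stronglyMeasurable u).measurable
  have hgm : Measurable g := (Lp.stronglyMeasurable g).measurable
  have hk := measurable_kern (n := n) δ
  have hcos : ∀ x ζ : E n, 0 ≤ 2 * (1 - Real.cos (2 * Real.pi * ⟪x, ζ⟫)) := fun x ζ => by
    have := Real.cos_le_one (2 * Real.pi * ⟪x, ζ⟫); linarith
  -- Insert the formula for the weight; for fixed `ζ`, Plancherel turns the `x`-integral into a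
  -- translation difference, and `η = ξ - ζ` gives the double integral. Everything is nonnegative,
  -- so Tonelli needs no integrability.
  have s1 : ∀ x, ENNReal.ofReal (‖x‖ ^ (2 * δ) * ‖u x‖ ^ 2) =
      ∫⁻ ζ : E n, ENNReal.ofReal (b n δ * kern δ ζ) *
        (ENNReal.ofReal (2 * (1 - Real.cos (2 * Real.pi * ⟪x, ζ⟫))) *
          ENNReal.ofReal (‖u x‖ ^ 2)) := by
    intro x
    rw [ENNReal.ofReal_mul (by positivity), ← lintegral_one_sub_cos_mul_kern hn hδ0 hδ1,
      ← lintegral_mul_const' _ _ ENNReal.ofReal_ne_top]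
    refine lintegral_congr fun ζ => ?_
    rw [← mul_assoc (ENNReal.ofReal (b n δ * kern δ ζ)),
      ← ENNReal.ofReal_mul (mul_nonneg hb (kern_nonneg δ ζ))]
    congr 2; ring
  simp_rw [s1]
  rw [lintegral_lintegral_swap (by refine Measurable.aemeasurable ?_; fun_prop)]
  have s2 : ∀ ζ : E n, ∫⁻ x, ENNReal.ofReal (b n δ * kern δ ζ) *
        (ENNReal.ofReal (2 * (1 - Real.cos (2 * Real.pi * ⟪x, ζ⟫))) *
          ENNReal.ofReal (‖u x‖ ^ 2)) =
      ∫⁻ ξ, ENNReal.ofReal (b n δ * kern δ ζ) * ENNReal.ofReal (‖g (ξ - ζ) - g ξ‖ ^ 2) := by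
    intro ζ
    rw [lintegral_const_mul' _ _ ENNReal.ofReal_ne_top, lintegral_const_mul' _ _ ENNReal.ofReal_ne_top,
      lintegral_norm_translate_sub_sq]
  simp_rw [s2]
  rw [lintegral_lintegral_swap (by refine Measurable.aemeasurable ?_; fun_prop)]
  have s3 : ∀ ξ : E n, ∫⁻ ζ, ENNReal.ofReal (b n δ * kern δ ζ) *
        ENNReal.ofReal (‖g (ξ - ζ) - g ξ‖ ^ 2) =
      ∫⁻ η, ENNReal.ofReal (b n δ * (‖g ξ - g η‖ ^ 2 * kern δ (ξ - η))) := by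
    intro ξ
    rw [← lintegral_sub_left_eq_self _ ξ]
    refine lintegral_congr fun ζ => ?_
    rw [← ENNReal.ofReal_mul (mul_nonneg hb (kern_nonneg δ _)), sub_sub_cancel, norm_sub_rev]
    congr 1; ring
  simp_rw [s3]
  have hGg : (g : E n → ℂ) =ᵐ[volume] G := hG.coeFn_toLp
  rw [← lintegral_prod (f := fun z : E n × E n =>
    ENNReal.ofReal (b n δ * (‖g z.1 - g z.2‖ ^ 2 * kern δ (z.1 - z.2))))
    (by refine Measurable.aemeasurable ?_; fun_prop), ← Measure.volume_eq_prod]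
  refine lintegral_congr_ae ?_
  have e1 := (Measure.quasiMeasurePreserving_fst (μ := (volume : Measure (E n)))
    (ν := (volume : Measure (E n)))).ae hGg
  have e2 := (Measure.quasiMeasurePreserving_snd (μ := (volume : Measure (E n)))
    (ν := (volume : Measure (E n)))).ae hGg
  filter_upwards [e1, e2] with z h1 h2
  rw [h1, h2]

/-! ### Wave packets and the variation of their dispersion. -/

/-- A continuous real function supported in the closed unit ball. -/
structure IsProfile (φ : E n → ℝ) : Prop where
  cont : Continuous φ
  supp : ∀ ξ, 1 < ‖ξ‖ → φ ξ = 0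

lemma IsProfile.hasCompactSupport {φ : E n → ℝ} (hφ : IsProfile φ) : HasCompactSupport φ :=
  HasCompactSupport.intro (isCompact_closedBall (0 : E n) 1) fun x hx =>
    hφ.supp x (by simpa using hx)

lemma IsProfile.integrable {φ : E n → ℝ} (hφ : IsProfile φ) : Integrable φ :=
  hφ.cont.integrable_of_hasCompactSupport hφ.hasCompactSupport

lemma IsProfile.exists_bound {φ : E n → ℝ} (hφ : IsProfile φ) : ∃ M, 0 ≤ M ∧ ∀ ξ, |φ ξ| ≤ M := by
  obtain ⟨C, hC⟩ := hφ.cont.bounded_above_of_compact_support hφ.hasCompactSupport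
  exact ⟨max C 0, le_max_right _ _, fun ξ => (hC ξ).trans (le_max_left _ _)⟩

lemma IsProfile.norm_le {φ : E n → ℝ} (hφ : IsProfile φ) {ξ : E n} (h : φ ξ ≠ 0) : ‖ξ‖ ≤ 1 := by
  by_contra hc
  exact h (hφ.supp ξ (not_le.1 hc))

/-- In polar coordinates the radial density is `r^{1-2δ}`, integrable at the origin because `δ < 1`.
-/
lemma integrableOn_norm_sq_mul_kern (hn : 1 ≤ n) {δ : ℝ} (hδ1 : δ < 1) (r : ℝ) :
    IntegrableOn (fun ζ : E n => ‖ζ‖ ^ 2 * kern δ ζ) (Metric.ball 0 r) := by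
  have : Nonempty (Fin n) := ⟨⟨0, hn⟩⟩
  have hnt : Nontrivial (E n) := inferInstance
  unfold kern
  rw [integrableOn_fun_norm_addHaar (volume : Measure (E n)) (f := fun y : ℝ => y ^ 2 * (y ^ ((n : ℝ) + 2 * δ))⁻¹)]
  rcases le_or_gt r 0 with hr | hr
  · simp [Ioo_eq_empty (not_lt.2 hr)]
  have hi : IntegrableOn (fun y : ℝ => y ^ (1 - 2 * δ)) (Ioo 0 r) :=
    ((intervalIntegrable_iff_integrableOn_Ioc_of_le hr.le).1
      (intervalIntegral.intervalIntegrable_rpow' (by linarith))).mono_set Ioo_subset_Ioc_self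
  refine hi.congr_fun (fun y hy => ?_) measurableSet_Ioo
  have hy' : 0 < y := hy.1
  simp only [finrank_euclideanSpace, Fintype.card_fin, smul_eq_mul]
  rw [← Real.rpow_neg hy'.le, ← Real.rpow_natCast, ← Real.rpow_natCast, ← Real.rpow_add hy',
    ← Real.rpow_add hy', Nat.cast_sub hn]
  congr 1; push_cast; ring

lemma integrable_mul_comp_sub {A k : E n → ℝ} (hA : Integrable A) (hk : Integrable k) :
    Integrable (fun z : E n × E n => A z.2 * k (z.1 - z.2)) :=
  hA.convolution_integrand (ContinuousLinearMap.mul ℝ ℝ) hk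

lemma integral_mul_comp_sub {A k : E n → ℝ} (hA : Integrable A) (hk : Integrable k) :
    ∫ z : E n × E n, A z.2 * k (z.1 - z.2) = (∫ ξ, A ξ) * ∫ ζ, k ζ := by
  have := integral_convolution (ContinuousLinearMap.mul ℝ ℝ) (μ := (volume : Measure (E n)))
    (ν := (volume : Measure (E n))) hA hk
  simp only [ContinuousLinearMap.mul_apply'] at this
  rw [← this, Measure.volume_eq_prod, integral_prod _ (integrable_mul_comp_sub hA hk)]
  rfl

lemma IsProfile.integrable_sq_kern {φ : E n → ℝ} (hφ : IsProfile φ) (hn : 1 ≤ n) {δ : ℝ}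
    (hδ1 : δ < 1) :
    Integrable (fun z : E n × E n =>
      |φ z.1| * |φ z.2| * (‖z.1 - z.2‖ ^ 2 * kern δ (z.1 - z.2))) := by
  obtain ⟨M, hM0, hM⟩ := hφ.exists_bound
  -- Two points of the unit ball differ by at most `2`, so the open ball of radius `3` contains
  -- every difference that matters; the cut-off kernel is integrable and the convolution bound
  -- applies.
  have hk : Integrable ((Metric.ball (0 : E n) 3).indicator fun ζ => ‖ζ‖ ^ 2 * kern δ ζ) :=
    (integrable_indicator_iff measurableSet_ball).2 (integrableOn_norm_sq_mul_kern hn hδ1 3)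
  have hm := measurable_kern (n := n) δ
  have hc := hφ.cont.measurable
  refine ((integrable_mul_comp_sub hφ.integrable.abs hk).const_mul M).mono'
    (by refine Measurable.aestronglyMeasurable ?_; fun_prop) (Eventually.of_forall fun z => ?_)
  have hk0 := kern_nonneg δ (z.1 - z.2)
  rw [Real.norm_of_nonneg (by positivity)]
  rcases eq_or_ne (φ z.1) 0 with h1 | h1
  · simp only [h1, abs_zero, zero_mul]
    refine mul_nonneg hM0 (mul_nonneg (abs_nonneg _) (indicator_nonneg (fun ζ _ => ?_) _))
    exact mul_nonneg (by positivity) (kern_nonneg _ _)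
  rcases eq_or_ne (φ z.2) 0 with h2 | h2
  · simp [h2]
  rw [indicator_of_mem]
  · have := hM z.1
    calc |φ z.1| * |φ z.2| * (‖z.1 - z.2‖ ^ 2 * kern δ (z.1 - z.2))
        ≤ M * |φ z.2| * (‖z.1 - z.2‖ ^ 2 * kern δ (z.1 - z.2)) := by gcongr
      _ = _ := by ring
  · rw [mem_ball_zero_iff]
    have := norm_sub_le z.1 z.2
    linarith [hφ.norm_le h1, hφ.norm_le h2]

lemma integrable_one_sub_cos_mul_kern (hn : 1 ≤ n) {δ : ℝ} (hδ0 : 0 < δ) (hδ1 : δ < 1) (x : E n) :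
    Integrable (fun ζ : E n => b n δ * (2 * (1 - Real.cos (2 * Real.pi * ⟪x, ζ⟫)) * kern δ ζ)) ∧
    ∫ ζ : E n, b n δ * (2 * (1 - Real.cos (2 * Real.pi * ⟪x, ζ⟫)) * kern δ ζ) = ‖x‖ ^ (2 * δ) := by
  have hb := b_pos hn hδ0 hδ1
  have hk := measurable_kern (n := n) δ
  have h0 : ∀ ζ : E n, 0 ≤ b n δ * (2 * (1 - Real.cos (2 * Real.pi * ⟪x, ζ⟫)) * kern δ ζ) := by
    intro ζ
    have h1 := Real.cos_le_one (2 * Real.pi * ⟪x, ζ⟫)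
    have h2 : 0 ≤ 1 - Real.cos (2 * Real.pi * ⟪x, ζ⟫) := by linarith
    have := kern_nonneg δ ζ
    positivity
  have hm : AEStronglyMeasurable (fun ζ : E n =>
      b n δ * (2 * (1 - Real.cos (2 * Real.pi * ⟪x, ζ⟫)) * kern δ ζ)) volume := by
    refine Measurable.aestronglyMeasurable ?_; fun_prop
  have he := lintegral_one_sub_cos_mul_kern hn hδ0 hδ1 x
  constructor
  · rw [← lintegral_ofReal_ne_top_iff_integrable hm (Eventually.of_forall h0), he]
    exact ENNReal.ofReal_ne_top
  · rw [integral_eq_lintegral_of_nonneg_ae (Eventually.of_forall h0) hm, he,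
      ENNReal.toReal_ofReal (by positivity)]

/-- This is `|zw - 1|² ≤ 2|z - 1|² + 2|w - 1|²` for `z = e^{ia}`, `w = e^{ic}`. -/
lemma one_sub_cos_add_le (a c : ℝ) :
    1 - Real.cos (a + c) ≤ 2 * (1 - Real.cos a) + 2 * (1 - Real.cos c) := by
  rw [Real.cos_add]
  nlinarith [Real.sin_sq_add_cos_sq a, Real.sin_sq_add_cos_sq c, sq_nonneg (Real.sin a - Real.sin c),
    sq_nonneg (Real.cos a + Real.cos c - 2), sq_nonneg (Real.sin a + Real.sin c),
    sq_nonneg (Real.cos a - Real.cos c), Real.cos_le_one a, Real.cos_le_one c]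

lemma one_sub_cos_le (a : ℝ) : 1 - Real.cos a ≤ a ^ 2 / 2 := by
  linarith [Real.one_sub_sq_div_two_le_cos (x := a)]

lemma one_sub_cos_nonneg (a : ℝ) : 0 ≤ 1 - Real.cos a := by linarith [Real.cos_le_one a]

/-- The phase difference between two frequencies, at displacement `h` and time `s`. -/
def theta (h : E n) (s : ℝ) (z : E n × E n) : ℝ :=
  2 * Real.pi * ⟪h, z.1 - z.2⟫ + Real.pi * s * (‖z.1‖ ^ 2 - ‖z.2‖ ^ 2)

lemma continuous_theta (h : E n) (s : ℝ) : Continuous (theta h s) := by unfold theta; fun_prop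

/-- The integrand of the variation of the dispersion of a wave packet. -/
def varIntegrand (δ : ℝ) (φ : E n → ℝ) (h : E n) (s : ℝ) (z : E n × E n) : ℝ :=
  φ z.1 * φ z.2 * ((1 - Real.cos (theta h s z)) * kern δ (z.1 - z.2))

/-- The variation of the dispersion of a wave packet. -/
def packetVar (δ : ℝ) (φ : E n → ℝ) (h : E n) (s : ℝ) : ℝ :=
  2 * b n δ * ∫ z, varIntegrand δ φ h s z

/-- Factor the difference of squares and use the reverse triangle inequality. The dispersive phase
thus vanishes to first order on the diagonal, which compensates the singularity of the kernel. -/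
lemma sq_norm_sub_sq_le {x y : E n} (hx : ‖x‖ ≤ 1) (hy : ‖y‖ ≤ 1) :
    (‖x‖ ^ 2 - ‖y‖ ^ 2) ^ 2 ≤ 4 * ‖x - y‖ ^ 2 := by
  have h1 : (‖x‖ - ‖y‖) ^ 2 ≤ ‖x - y‖ ^ 2 := by
    rw [← sq_abs]
    exact pow_le_pow_left₀ (abs_nonneg _) (abs_norm_sub_norm_le x y) 2
  have h2 : (‖x‖ + ‖y‖) ^ 2 ≤ 4 := by nlinarith [norm_nonneg x, norm_nonneg y]
  calc (‖x‖ ^ 2 - ‖y‖ ^ 2) ^ 2 = (‖x‖ + ‖y‖) ^ 2 * (‖x‖ - ‖y‖) ^ 2 := by ring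
    _ ≤ 4 * ‖x - y‖ ^ 2 := by gcongr

/-- The phase splits into a transport part (from `h`) and a dispersive part (from `s`). Only the
second is replaced by its quadratic bound; the first keeps its cosine, because the bound by
`|h|^{2δ}` for large `h` needs it. -/
lemma IsProfile.norm_varIntegrand_le {φ : E n → ℝ} (hφ : IsProfile φ) (δ : ℝ) (h : E n) (s : ℝ)
    (z : E n × E n) :
    ‖varIntegrand δ φ h s z‖ ≤
      2 * (|φ z.1| * |φ z.2| * ((1 - Real.cos (2 * Real.pi * ⟪h, z.1 - z.2⟫)) *
        kern δ (z.1 - z.2))) +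
      4 * Real.pi ^ 2 * s ^ 2 * (|φ z.1| * |φ z.2| * (‖z.1 - z.2‖ ^ 2 * kern δ (z.1 - z.2))) := by
  have hk := kern_nonneg δ (z.1 - z.2)
  have hc1 := one_sub_cos_nonneg (theta h s z)
  have hc2 := one_sub_cos_nonneg (2 * Real.pi * ⟪h, z.1 - z.2⟫)
  rw [varIntegrand, norm_mul, norm_mul, Real.norm_eq_abs, Real.norm_eq_abs,
    Real.norm_of_nonneg (by positivity)]
  rcases eq_or_ne (φ z.1) 0 with h1 | h1
  · simp [h1]
  rcases eq_or_ne (φ z.2) 0 with h2 | h2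
  · simp [h2]
  have key : 1 - Real.cos (theta h s z) ≤ 2 * (1 - Real.cos (2 * Real.pi * ⟪h, z.1 - z.2⟫)) +
      4 * Real.pi ^ 2 * s ^ 2 * ‖z.1 - z.2‖ ^ 2 := by
    have e1 := one_sub_cos_add_le (2 * Real.pi * ⟪h, z.1 - z.2⟫)
      (Real.pi * s * (‖z.1‖ ^ 2 - ‖z.2‖ ^ 2))
    have e2 := one_sub_cos_le (Real.pi * s * (‖z.1‖ ^ 2 - ‖z.2‖ ^ 2))
    have e3 := sq_norm_sub_sq_le (hφ.norm_le h1) (hφ.norm_le h2)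
    have e4 : (Real.pi * s * (‖z.1‖ ^ 2 - ‖z.2‖ ^ 2)) ^ 2 ≤
        (Real.pi * s) ^ 2 * (4 * ‖z.1 - z.2‖ ^ 2) := by
      rw [mul_pow (Real.pi * s)]; gcongr
    rw [theta]
    nlinarith
  calc |φ z.1| * |φ z.2| * ((1 - Real.cos (theta h s z)) * kern δ (z.1 - z.2))
      ≤ |φ z.1| * |φ z.2| * ((2 * (1 - Real.cos (2 * Real.pi * ⟪h, z.1 - z.2⟫)) +
      4 * Real.pi ^ 2 * s ^ 2 * ‖z.1 - z.2‖ ^ 2) * kern δ (z.1 - z.2)) := by gcongr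
    _ = _ := by ring

lemma cos_inner_bound (h ζ : E n) :
    1 - Real.cos (2 * Real.pi * ⟪h, ζ⟫) ≤ 2 * Real.pi ^ 2 * ‖h‖ ^ 2 * ‖ζ‖ ^ 2 := by
  have e1 := one_sub_cos_le (2 * Real.pi * ⟪h, ζ⟫)
  have e2 : ⟪h, ζ⟫ ^ 2 ≤ (‖h‖ * ‖ζ‖) ^ 2 := by
    rw [← sq_abs]; exact pow_le_pow_left₀ (abs_nonneg _) (abs_real_inner_le_norm h ζ) 2
  have e3 : (2 * Real.pi * ⟪h, ζ⟫) ^ 2 ≤ (2 * Real.pi) ^ 2 * (‖h‖ * ‖ζ‖) ^ 2 := by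
    rw [mul_pow (2 * Real.pi)]; gcongr
  nlinarith

lemma IsProfile.integrable_cos_kern {φ : E n → ℝ} (hφ : IsProfile φ) (hn : 1 ≤ n) {δ : ℝ}
    (hδ1 : δ < 1) (h : E n) :
    Integrable (fun z : E n × E n =>
      |φ z.1| * |φ z.2| * ((1 - Real.cos (2 * Real.pi * ⟪h, z.1 - z.2⟫)) * kern δ (z.1 - z.2))) := by
  have hm := measurable_kern (n := n) δ
  have hc := hφ.cont.measurable
  refine ((hφ.integrable_sq_kern hn hδ1).const_mul (2 * Real.pi ^ 2 * ‖h‖ ^ 2)).mono'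
    (by refine Measurable.aestronglyMeasurable ?_; fun_prop) (Eventually.of_forall fun z => ?_)
  have hk := kern_nonneg δ (z.1 - z.2)
  have hc2 := one_sub_cos_nonneg (2 * Real.pi * ⟪h, z.1 - z.2⟫)
  rw [Real.norm_of_nonneg (by positivity)]
  calc _ ≤ |φ z.1| * |φ z.2| * ((2 * Real.pi ^ 2 * ‖h‖ ^ 2 * ‖z.1 - z.2‖ ^ 2) *
        kern δ (z.1 - z.2)) := by
        gcongr; exact cos_inner_bound _ _
    _ = _ := by ring

lemma measurable_varIntegrand {φ : E n → ℝ} (hφ : IsProfile φ) (δ : ℝ) (h : E n) (s : ℝ) :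
    Measurable (varIntegrand δ φ h s) := by
  have hm := measurable_kern (n := n) δ
  have hc := hφ.cont.measurable
  have ht := (continuous_theta h s).measurable
  unfold varIntegrand
  fun_prop

lemma IsProfile.integrable_varIntegrand {φ : E n → ℝ} (hφ : IsProfile φ) (hn : 1 ≤ n) {δ : ℝ}
    (hδ1 : δ < 1) (h : E n) (s : ℝ) : Integrable (varIntegrand δ φ h s) :=
  (((hφ.integrable_cos_kern hn hδ1 h).const_mul 2).add
    ((hφ.integrable_sq_kern hn hδ1).const_mul (4 * Real.pi ^ 2 * s ^ 2))).mono'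
    (measurable_varIntegrand hφ δ h s).aestronglyMeasurable
    (Eventually.of_forall fun z => hφ.norm_varIntegrand_le δ h s z)

/-- For the `|h|²` bound, estimate `1 - cos` quadratically. For the `|h|^{2δ}` bound, estimate one
profile by its supremum; integrating in the difference variable then reproduces the formula for the
weight at `h`. -/
lemma IsProfile.exists_cos_bound {φ : E n → ℝ} (hφ : IsProfile φ) (hn : 1 ≤ n) {δ : ℝ}
    (hδ0 : 0 < δ) (hδ1 : δ < 1) :
    ∃ C, 0 ≤ C ∧ ∀ h : E n, 2 * b n δ * ∫ z : E n × E n, |φ z.1| * |φ z.2| *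
      ((1 - Real.cos (2 * Real.pi * ⟪h, z.1 - z.2⟫)) * kern δ (z.1 - z.2)) ≤
      C * min (‖h‖ ^ 2) (‖h‖ ^ (2 * δ)) := by
  obtain ⟨M, hM0, hM⟩ := hφ.exists_bound
  have hb := b_pos hn hδ0 hδ1
  have hq := hφ.integrable_sq_kern hn hδ1
  set J := ∫ z : E n × E n, |φ z.1| * |φ z.2| * (‖z.1 - z.2‖ ^ 2 * kern δ (z.1 - z.2)) with hJ
  have hJ0 : 0 ≤ J := integral_nonneg fun z => by have := kern_nonneg δ (z.1 - z.2); positivity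
  set I := ∫ ξ, |φ ξ| with hI
  have hI0 : 0 ≤ I := integral_nonneg fun z => abs_nonneg _
  have hJ1 : 0 ≤ 2 * b n δ * (2 * Real.pi ^ 2 * J) := by positivity
  refine ⟨2 * b n δ * (2 * Real.pi ^ 2 * J) + M * I, by positivity, fun h => ?_⟩
  rcases le_total (‖h‖ ^ 2) (‖h‖ ^ (2 * δ)) with hle | hle
  · rw [min_eq_left hle]
    have h1 : ∫ z : E n × E n, |φ z.1| * |φ z.2| *
        ((1 - Real.cos (2 * Real.pi * ⟪h, z.1 - z.2⟫)) * kern δ (z.1 - z.2)) ≤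
        2 * Real.pi ^ 2 * ‖h‖ ^ 2 * J := by
      rw [hJ, ← integral_const_mul]
      refine integral_mono (hφ.integrable_cos_kern hn hδ1 h) (hq.const_mul _) fun z => ?_
      have hk := kern_nonneg δ (z.1 - z.2)
      calc _ ≤ |φ z.1| * |φ z.2| * ((2 * Real.pi ^ 2 * ‖h‖ ^ 2 * ‖z.1 - z.2‖ ^ 2) *
            kern δ (z.1 - z.2)) := by
            gcongr; exact cos_inner_bound _ _
        _ = _ := by ring
    have h2 := mul_le_mul_of_nonneg_left h1 (show 0 ≤ 2 * b n δ by positivity)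
    have h3 : 0 ≤ M * I * ‖h‖ ^ 2 := by positivity
    linarith
  · rw [min_eq_right hle]
    obtain ⟨hi, he⟩ := integrable_one_sub_cos_mul_kern hn hδ0 hδ1 h
    obtain ⟨k, hk⟩ : ∃ k : E n → ℝ, k = fun ζ : E n =>
      b n δ * (2 * (1 - Real.cos (2 * Real.pi * ⟪h, ζ⟫)) * kern δ ζ) := ⟨_, rfl⟩
    rw [← hk] at hi he
    have hle : ∀ z : E n × E n, 2 * b n δ * (|φ z.1| * |φ z.2| *
        ((1 - Real.cos (2 * Real.pi * ⟪h, z.1 - z.2⟫)) * kern δ (z.1 - z.2))) ≤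
        M * (|φ z.2| * k (z.1 - z.2)) := by
      intro z
      have hkn := kern_nonneg δ (z.1 - z.2)
      have hc2 := one_sub_cos_nonneg (2 * Real.pi * ⟪h, z.1 - z.2⟫)
      have := hM z.1
      calc 2 * b n δ * (|φ z.1| * |φ z.2| *
          ((1 - Real.cos (2 * Real.pi * ⟪h, z.1 - z.2⟫)) * kern δ (z.1 - z.2)))
          ≤ 2 * b n δ * (M * |φ z.2| *
          ((1 - Real.cos (2 * Real.pi * ⟪h, z.1 - z.2⟫)) * kern δ (z.1 - z.2))) := by gcongr
        _ = _ := by rw [hk]; ring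
    have hint := integrable_mul_comp_sub hφ.integrable.abs hi
    have heq := integral_mul_comp_sub hφ.integrable.abs hi
    have h1 : 2 * b n δ * ∫ z : E n × E n, |φ z.1| * |φ z.2| *
        ((1 - Real.cos (2 * Real.pi * ⟪h, z.1 - z.2⟫)) * kern δ (z.1 - z.2)) ≤
        M * (I * ‖h‖ ^ (2 * δ)) := by
      rw [hI, ← he, ← heq, ← integral_const_mul, ← integral_const_mul]
      exact integral_mono ((hφ.integrable_cos_kern hn hδ1 h).const_mul _) (hint.const_mul M) hle
    have h2 := mul_nonneg hJ1 (Real.rpow_nonneg (norm_nonneg h) (2 * δ))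
    rw [add_mul]
    linarith only [h1, h2]

/-- The dispersion of a wave packet varies by at most `C (min (|h|², |h|^{2δ}) + s²)`. -/
lemma IsProfile.exists_packetVar_bound {φ : E n → ℝ} (hφ : IsProfile φ) (hn : 1 ≤ n) {δ : ℝ}
    (hδ0 : 0 < δ) (hδ1 : δ < 1) :
    ∃ C, 0 ≤ C ∧ ∀ h s, 2 * b n δ * ∫ z, ‖varIntegrand δ φ h s z‖ ≤
      C * (min (‖h‖ ^ 2) (‖h‖ ^ (2 * δ)) + s ^ 2) := by
  have hb := b_pos hn hδ0 hδ1
  have hq := hφ.integrable_sq_kern hn hδ1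
  obtain ⟨C1, hC10, hcosle⟩ := hφ.exists_cos_bound hn hδ0 hδ1
  set J := ∫ z : E n × E n, |φ z.1| * |φ z.2| * (‖z.1 - z.2‖ ^ 2 * kern δ (z.1 - z.2)) with hJ
  have hJ0 : 0 ≤ J := integral_nonneg fun z => by have := kern_nonneg δ (z.1 - z.2); positivity
  set C2 := 2 * b n δ * (4 * Real.pi ^ 2 * J) with hC2
  have hC20 : 0 ≤ C2 := by positivity
  refine ⟨2 * C1 + C2, by positivity, fun h s => ?_⟩
  have hmin : 0 ≤ min (‖h‖ ^ 2) (‖h‖ ^ (2 * δ)) := by positivity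
  have h1 : ∫ z, ‖varIntegrand δ φ h s z‖ ≤
      2 * (∫ z : E n × E n, |φ z.1| * |φ z.2| *
      ((1 - Real.cos (2 * Real.pi * ⟪h, z.1 - z.2⟫)) * kern δ (z.1 - z.2))) +
      4 * Real.pi ^ 2 * s ^ 2 * J := by
    rw [hJ, ← integral_const_mul, ← integral_const_mul, ← integral_add
      ((hφ.integrable_cos_kern hn hδ1 h).const_mul _) (hq.const_mul _)]
    exact integral_mono (hφ.integrable_varIntegrand hn hδ1 h s).norm
      (((hφ.integrable_cos_kern hn hδ1 h).const_mul _).add (hq.const_mul _))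
      fun z => hφ.norm_varIntegrand_le δ h s z
  have h3 : 2 * b n δ * ∫ z, ‖varIntegrand δ φ h s z‖ ≤
      2 * (C1 * min (‖h‖ ^ 2) (‖h‖ ^ (2 * δ))) + C2 * s ^ 2 := by
    have := mul_le_mul_of_nonneg_left h1 (show 0 ≤ 2 * b n δ by positivity)
    have := hcosle h
    rw [hC2]
    linarith
  have h4 : 0 ≤ C1 * s ^ 2 := by positivity
  have h5 : 0 ≤ C2 * min (‖h‖ ^ 2) (‖h‖ ^ (2 * δ)) := by positivity
  linarith

lemma abs_packetVar_le (φ : E n → ℝ) (hn : 1 ≤ n) {δ : ℝ}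
    (hδ0 : 0 < δ) (hδ1 : δ < 1) (h : E n) (s : ℝ) :
    |packetVar δ φ h s| ≤ 2 * b n δ * ∫ z, ‖varIntegrand δ φ h s z‖ := by
  have hb := b_pos hn hδ0 hδ1
  rw [packetVar, abs_mul, abs_of_pos (by positivity : 0 < 2 * b n δ)]
  gcongr
  exact norm_integral_le_integral_norm (varIntegrand δ φ h s)

/-! ### Lattice sums and the splitting into diagonal and off-diagonal terms. -/

lemma lat_sub (ν μ : Fin n → ℤ) : lat (ν - μ) = lat ν - lat μ := by
  ext i; simp [lat]

lemma lat_injective : Function.Injective (lat : (Fin n → ℤ) → E n) := by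
  intro ν μ h
  ext i
  have := congrArg (fun x : E n => x i) h
  simpa [lat] using this

lemma lat_zero : lat (0 : Fin n → ℤ) = 0 := by ext i; simp [lat]

lemma one_le_norm_lat {ν : Fin n → ℤ} (h : ν ≠ 0) : 1 ≤ ‖lat ν‖ := by
  obtain ⟨i, hi⟩ := Function.ne_iff.1 h
  have h1 : (1 : ℝ) ≤ |(ν i : ℝ)| := by exact_mod_cast Int.one_le_abs hi
  exact h1.trans (by simpa [lat] using PiLp.norm_apply_le (lat ν) i)

lemma one_le_norm_lat_sub {ν μ : Fin n → ℤ} (h : ν ≠ μ) : 1 ≤ ‖lat ν - lat μ‖ := by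
  rw [← lat_sub]; exact one_le_norm_lat (sub_ne_zero.2 h)

/-- The lattice points lie in the `ℤ`-span of the standard basis, a lattice of rank `n`. -/
lemma summable_norm_lat_rpow {r : ℝ} (hr : r < -n) :
    Summable fun ν : Fin n → ℤ => ‖lat ν‖ ^ r := by
  set B := (EuclideanSpace.basisFun (Fin n) ℝ).toBasis with hB
  set L := Submodule.span ℤ (Set.range B) with hL
  have hfin : Module.finrank ℤ L = n := by
    rw [ZLattice.rank ℝ L]; simp
  have hs := ZLattice.summable_norm_rpow L r (by rw [hfin]; exact hr)
  have hmem : ∀ ν : Fin n → ℤ, lat ν ∈ L := by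
    intro ν
    have : lat ν = ∑ i, ν i • B i := by
      ext j
      simp [lat, hB, Pi.single_apply]
    rw [this]
    exact Submodule.sum_mem _ fun i _ => Submodule.smul_mem _ _ (Submodule.subset_span ⟨i, rfl⟩)
  exact hs.comp_injective (i := fun ν => (⟨lat ν, hmem ν⟩ : L))
    fun ν μ h => lat_injective (congrArg Subtype.val h)

lemma summable_kern_lat {δ : ℝ} (hδ : 0 < δ) :
    Summable fun ν : Fin n → ℤ => kern δ (lat ν) := by
  have := summable_norm_lat_rpow (n := n) (r := -((n : ℝ) + 2 * δ)) (by linarith)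
  refine this.congr fun ν => ?_
  rw [kern, Real.rpow_neg (norm_nonneg _)]

/-- Schur's test for a convolution kernel. -/
lemma summable_mul_mul_of_sq {a k : (Fin n → ℤ) → ℝ} (ha0 : ∀ ν, 0 ≤ a ν) (hk0 : ∀ ν, 0 ≤ k ν)
    (ha : Summable fun ν => a ν ^ 2) (hk : Summable k) :
    Summable fun p : (Fin n → ℤ) × (Fin n → ℤ) => a p.1 * a p.2 * k (p.1 - p.2) := by
  -- Since `xy ≤ x² + y²`, the double sum is dominated by two sums, each of which factors after the
  -- shear to the difference variable.
  have h1 : Summable fun p : (Fin n → ℤ) × (Fin n → ℤ) => a p.1 ^ 2 * k p.2 :=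
    ha.mul_of_nonneg hk (fun ν => sq_nonneg _) hk0
  have h1' : Summable fun p : (Fin n → ℤ) × (Fin n → ℤ) => a p.1 ^ 2 * k (p.1 - p.2) :=
    h1.comp_injective (i := fun p : (Fin n → ℤ) × (Fin n → ℤ) => (p.1, p.1 - p.2))
      (by rintro ⟨x, y⟩ ⟨x', y'⟩ h; simp at h; obtain ⟨rfl, h⟩ := h; simpa using h)
  have h2' : Summable fun p : (Fin n → ℤ) × (Fin n → ℤ) => a p.2 ^ 2 * k (p.1 - p.2) :=
    h1.comp_injective (i := fun p : (Fin n → ℤ) × (Fin n → ℤ) => (p.2, p.1 - p.2))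
      (by rintro ⟨x, y⟩ ⟨x', y'⟩ h; simp at h; obtain ⟨rfl, h⟩ := h; simpa using h)
  refine Summable.of_nonneg_of_le (fun p => ?_) (fun p => ?_) (h1'.add h2')
  · have := ha0 p.1; have := ha0 p.2; have := hk0 (p.1 - p.2); positivity
  · have := hk0 (p.1 - p.2)
    rw [← add_mul]
    gcongr
    nlinarith [sq_nonneg (a p.1 - a p.2), mul_nonneg (ha0 p.1) (ha0 p.2)]

lemma summable_offDiag {a : (Fin n → ℤ) → ℂ} {δ : ℝ} (hδ : 0 < δ)
    (ha : Summable fun ν => ‖a ν‖ ^ 2) :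
    Summable fun p : OffDiag n => ‖a p.1.1‖ * ‖a p.1.2‖ * kern δ (lat p.1.1 - lat p.1.2) := by
  have := summable_mul_mul_of_sq (fun ν => norm_nonneg (a ν)) (fun ν => kern_nonneg δ (lat ν)) ha
    (summable_kern_lat hδ)
  simp_rw [lat_sub] at this
  exact this.subtype _

/-- The pointwise decomposition of a squared difference into diagonal and off-diagonal parts. -/
lemma hasSum_diag_sub_offDiag {c d : (Fin n → ℤ) → ℂ} {i j : Fin n → ℤ}
    (hc : ∀ ν, ν ≠ i → c ν = 0) (hd : ∀ ν, ν ≠ j → d ν = 0) :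
    ∃ S : ℝ, ∃ X : ℂ, HasSum (fun ν => ‖c ν - d ν‖ ^ 2) S ∧
      HasSum (fun p : OffDiag n => c p.1.1 * (starRingEnd ℂ) (d p.1.2)) X ∧
      ‖(∑' ν, c ν) - ∑' ν, d ν‖ ^ 2 = S - 2 * X.re := by
  rw [tsum_eq_single i hc, tsum_eq_single j hd]
  -- If both points meet the same packet, no pair of distinct indices contributes. Otherwise the
  -- square expands, and `(i, j)` is the only pair that does.
  by_cases hij : i = j
  · subst hij
    refine ⟨‖c i - d i‖ ^ 2, 0, hasSum_single i fun ν hν => ?_, ?_, by simp⟩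
    · simp [hc ν hν, hd ν hν]
    · convert! hasSum_zero with p
      by_cases h1 : p.1.1 = i
      · have h2 : p.1.2 ≠ i := fun h => p.2 (h1.trans h.symm)
        simp [hd _ h2]
      · simp [hc _ h1]
  · refine ⟨‖c i‖ ^ 2 + ‖d j‖ ^ 2, c i * (starRingEnd ℂ) (d j), ?_, ?_, ?_⟩
    · have h1 : HasSum (fun ν => ‖c ν‖ ^ 2) (‖c i‖ ^ 2) :=
        hasSum_single i fun ν hν => by simp [hc ν hν]
      have h2 : HasSum (fun ν => ‖d ν‖ ^ 2) (‖d j‖ ^ 2) :=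
        hasSum_single j fun ν hν => by simp [hd ν hν]
      refine (h1.add h2).congr_fun fun ν => ?_
      by_cases hν : ν = i
      · rw [hd ν (fun h => hij (hν.symm.trans h))]; simp
      · rw [hc ν hν]; simp
    · refine hasSum_single (⟨(i, j), hij⟩ : OffDiag n) fun p hp => ?_
      by_cases h1 : p.1.1 = i
      · have h2 : p.1.2 ≠ j := fun h => hp (Subtype.ext (Prod.ext h1 h))
        simp [hd _ h2]
      · simp [hc _ h1]
    · rw [← Complex.normSq_eq_norm_sq, ← Complex.normSq_eq_norm_sq, ← Complex.normSq_eq_norm_sq,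
        Complex.normSq_sub]

/-! ### Off-diagonal integrals -/

lemma norm_osc (t : ℝ) (ξ η : E n) : ‖osc t ξ η‖ = 1 := Complex.norm_exp_ofReal_mul_I _

lemma continuous_osc (t : ℝ) : Continuous fun z : E n × E n => osc t z.1 z.2 := by
  unfold osc; fun_prop

lemma phase_mul_conj_phase (t : ℝ) (ξ η : E n) :
    phase t ξ * (starRingEnd ℂ) (phase t η) = osc t ξ η := by
  rw [phase, phase, osc, ← Complex.exp_conj, ← Complex.exp_add]
  congr 1
  simp only [map_mul, Complex.conj_ofReal, Complex.conj_I]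
  push_cast; ring

/-- The interaction of two wave packets. -/
def interIntegrand (δ : ℝ) (φ : E n → ℝ) (ε t : ℝ) (x y : E n) (z : E n × E n) : ℂ :=
  ((φ z.1 * φ z.2 : ℝ) : ℂ) * (osc t (x + ε • z.1) (y + ε • z.2) *
    (kern δ ((x + ε • z.1) - (y + ε • z.2)) : ℝ))

lemma measurable_interIntegrand {φ : E n → ℝ} (hφ : IsProfile φ) (δ ε t : ℝ) (x y : E n) :
    Measurable (interIntegrand δ φ ε t x y) := by
  have hm := measurable_kern (n := n) δ
  have hc := hφ.cont.measurable
  have ho : Measurable fun z : E n × E n => osc t (x + ε • z.1) (y + ε • z.2) :=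
    ((continuous_osc t).comp (g := fun z : E n × E n => osc t z.1 z.2)
      (f := fun z : E n × E n => (x + ε • z.1, y + ε • z.2)) (by fun_prop)).measurable
  unfold interIntegrand
  fun_prop

lemma kern_le_of_le {δ : ℝ} (hδ : 0 < δ) {ζ ζ' : E n} (h0 : ζ ≠ 0) (h : ‖ζ‖ / 2 ≤ ‖ζ'‖) :
    kern δ ζ' ≤ 2 ^ ((n : ℝ) + 2 * δ) * kern δ ζ := by
  have h1 : 0 < ‖ζ‖ := norm_pos_iff.2 h0
  have h2 : (‖ζ‖ / 2) ^ ((n : ℝ) + 2 * δ) ≤ ‖ζ'‖ ^ ((n : ℝ) + 2 * δ) :=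
    Real.rpow_le_rpow (by positivity) h (by positivity)
  calc kern δ ζ' ≤ ((‖ζ‖ / 2) ^ ((n : ℝ) + 2 * δ))⁻¹ := by
        unfold kern; gcongr
    _ = _ := by
        rw [Real.div_rpow h1.le (by norm_num), kern]
        field_simp

/-- For `ε ≤ 1/4` each centre moves by at most `1/4`, so the distance stays at least half of `‖x -
y‖ ≥ 1`; this costs the factor `2^{n+2δ}`. -/
lemma IsProfile.norm_interIntegrand_le {φ : E n → ℝ} (hφ : IsProfile φ) {δ : ℝ} (hδ : 0 < δ)
    {ε : ℝ} (hε0 : 0 ≤ ε) (hε : ε ≤ 1 / 4) (t : ℝ) {x y : E n} (hxy : 1 ≤ ‖x - y‖)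
    (z : E n × E n) :
    ‖interIntegrand δ φ ε t x y z‖ ≤
      2 ^ ((n : ℝ) + 2 * δ) * kern δ (x - y) * (|φ z.1| * |φ z.2|) := by
  rw [interIntegrand, norm_mul, norm_mul, norm_osc, one_mul, Complex.norm_real, Complex.norm_real,
    Real.norm_eq_abs, abs_mul, Real.norm_of_nonneg (kern_nonneg _ _)]
  rcases eq_or_ne (φ z.1) 0 with h1 | h1
  · simp [h1]
  rcases eq_or_ne (φ z.2) 0 with h2 | h2
  · simp [h2]
  have hx0 : x - y ≠ 0 := by
    intro h; rw [h, norm_zero] at hxy; linarith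
  have hz1 : ‖ε • z.1‖ ≤ 1 / 4 := by
    rw [norm_smul, Real.norm_of_nonneg hε0]; nlinarith [hφ.norm_le h1, norm_nonneg z.1]
  have hz2 : ‖ε • z.2‖ ≤ 1 / 4 := by
    rw [norm_smul, Real.norm_of_nonneg hε0]; nlinarith [hφ.norm_le h2, norm_nonneg z.2]
  have h3 : ‖x - y‖ / 2 ≤ ‖(x + ε • z.1) - (y + ε • z.2)‖ := by
    have h4 : x - y = ((x + ε • z.1) - (y + ε • z.2)) - ε • z.1 + ε • z.2 := by abel
    have h5 : ‖x - y‖ ≤ ‖(x + ε • z.1) - (y + ε • z.2)‖ + ‖ε • z.1‖ + ‖ε • z.2‖ := by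
      conv_lhs => rw [h4]
      exact (norm_add_le _ _).trans (by gcongr; exact norm_sub_le _ _)
    linarith
  have := kern_le_of_le hδ hx0 h3
  rw [mul_comm]
  gcongr

lemma IsProfile.integrable_abs_mul {φ : E n → ℝ} (hφ : IsProfile φ) :
    Integrable fun z : E n × E n => |φ z.1| * |φ z.2| :=
  hφ.integrable.abs.mul_prod hφ.integrable.abs

lemma IsProfile.integrable_interIntegrand {φ : E n → ℝ} (hφ : IsProfile φ) {δ : ℝ} (hδ : 0 < δ)
    {ε : ℝ} (hε0 : 0 ≤ ε) (hε : ε ≤ 1 / 4) (t : ℝ) {x y : E n} (hxy : 1 ≤ ‖x - y‖) :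
    Integrable (interIntegrand δ φ ε t x y) :=
  (hφ.integrable_abs_mul.const_mul _).mono'
    (measurable_interIntegrand hφ δ ε t x y).aestronglyMeasurable
    (Eventually.of_forall fun z => hφ.norm_interIntegrand_le hδ hε0 hε t hxy z)

lemma IsProfile.integral_norm_interIntegrand_le {φ : E n → ℝ} (hφ : IsProfile φ) {δ : ℝ}
    (hδ : 0 < δ) {ε : ℝ} (hε0 : 0 ≤ ε) (hε : ε ≤ 1 / 4) (t : ℝ) {x y : E n} (hxy : 1 ≤ ‖x - y‖) :
    ∫ z, ‖interIntegrand δ φ ε t x y z‖ ≤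
      2 ^ ((n : ℝ) + 2 * δ) * (∫ z : E n × E n, |φ z.1| * |φ z.2|) * kern δ (x - y) := by
  refine (integral_mono (hφ.integrable_interIntegrand hδ hε0 hε t hxy).norm
    (hφ.integrable_abs_mul.const_mul _)
    fun z => hφ.norm_interIntegrand_le hδ hε0 hε t hxy z).trans (le_of_eq ?_)
  rw [integral_const_mul]; ring

lemma norm_osc_sub_le (t : ℝ) (ξ η ξ' η' : E n) :
    ‖osc t ξ η - osc t ξ' η'‖ ≤
      |t| * (Real.pi * |(‖η‖ ^ 2 - ‖ξ‖ ^ 2) - (‖η'‖ ^ 2 - ‖ξ'‖ ^ 2)|) := by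
  have h := Complex.norm_exp_ofReal_mul_I
  have key : ∀ a c : ℝ, ‖Complex.exp ((a : ℂ) * Complex.I) - Complex.exp ((c : ℂ) * Complex.I)‖ ≤
      |a - c| := by
    intro a c
    have : Complex.exp ((a : ℂ) * Complex.I) - Complex.exp ((c : ℂ) * Complex.I) =
        Complex.exp ((c : ℂ) * Complex.I) * (Complex.exp (((a - c : ℝ) : ℂ) * Complex.I) - 1) := by
      rw [mul_sub, mul_one, ← Complex.exp_add]; congr 2; push_cast; ring
    rw [this, norm_mul, h, one_mul]
    refine abs_le_of_sq_le_sq' ?_ (abs_nonneg _) |>.2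
    rw [norm_exp_sub_one_sq, sq_abs]
    linarith [one_sub_cos_le (a - c)]
  refine (key _ _).trans (le_of_eq ?_)
  rw [show 2 * Real.pi * t * ((‖η‖ ^ 2 - ‖ξ‖ ^ 2) / 2) - 2 * Real.pi * t *
    ((‖η'‖ ^ 2 - ‖ξ'‖ ^ 2) / 2) =
    t * (Real.pi * ((‖η‖ ^ 2 - ‖ξ‖ ^ 2) - (‖η'‖ ^ 2 - ‖ξ'‖ ^ 2))) by ring, abs_mul, abs_mul,
    abs_of_pos Real.pi_pos]

/-- At `ε = 0` the phase and the kernel are constant in `z`, and the profiles integrate to `1`.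
Dominated convergence along the product of `𝓝[>] 0` with `𝓟 K` makes the limit uniform in `t ∈ K`.
-/
lemma IsProfile.tendsto_inter {φ : E n → ℝ} (hφ : IsProfile φ) (h1 : ∫ ξ, φ ξ = 1) {δ : ℝ}
    (hδ : 0 < δ) {x y : E n} (hxy : 1 ≤ ‖x - y‖) {K : Set ℝ} (hK : IsCompact K) :
    Tendsto (fun q : ℝ × ℝ => (∫ z, interIntegrand δ φ q.1 q.2 x y z) -
      osc q.2 x y * (kern δ (x - y) : ℝ)) (𝓝[>] 0 ×ˢ 𝓟 K) (𝓝 0) := by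
  obtain ⟨T, hT⟩ := hK.isBounded.exists_norm_le
  have hint0 : Integrable fun z : E n × E n => ((φ z.1 * φ z.2 : ℝ) : ℂ) :=
    (hφ.integrable.mul_prod hφ.integrable).ofReal
  have hone : ∫ z : E n × E n, ((φ z.1 * φ z.2 : ℝ) : ℂ) = 1 := by
    rw [integral_complex_ofReal, Measure.volume_eq_prod, integral_prod_mul, h1]; simp
  have hev : ∀ᶠ q : ℝ × ℝ in 𝓝[>] 0 ×ˢ 𝓟 K, 0 ≤ q.1 ∧ q.1 ≤ 1 / 4 ∧ |q.2| ≤ T := by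
    rw [eventually_prod_principal_iff]
    have : Ioc (0 : ℝ) (1 / 4) ∈ 𝓝[>] (0 : ℝ) := Ioc_mem_nhdsGT (by norm_num)
    filter_upwards [this] with ε hε t ht
    exact ⟨hε.1.le, hε.2, hT t ht⟩
  have hx0 : x - y ≠ 0 := by
    intro h; rw [h, norm_zero] at hxy; linarith
  have hlim : Tendsto (fun q : ℝ × ℝ => ∫ z : E n × E n, (interIntegrand δ φ q.1 q.2 x y z -
      ((φ z.1 * φ z.2 : ℝ) : ℂ) * (osc q.2 x y * (kern δ (x - y) : ℝ)))) (𝓝[>] 0 ×ˢ 𝓟 K)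
      (𝓝 (∫ z : E n × E n, (0 : ℂ))) := by
    refine tendsto_integral_filter_of_dominated_convergence
      (fun z => 2 ^ ((n : ℝ) + 2 * δ) * kern δ (x - y) * (|φ z.1| * |φ z.2|) +
        kern δ (x - y) * (|φ z.1| * |φ z.2|)) ?_ ?_ ?_ ?_
    · refine Eventually.of_forall fun q => ?_
      exact ((measurable_interIntegrand hφ δ q.1 q.2 x y).aestronglyMeasurable).sub
        (hint0.aestronglyMeasurable.mul_const _)
    · filter_upwards [hev] with q hq
      refine Eventually.of_forall fun z => (norm_sub_le _ _).trans ?_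
      refine add_le_add (hφ.norm_interIntegrand_le hδ hq.1 hq.2.1 q.2 hxy z) (le_of_eq ?_)
      rw [norm_mul, norm_mul, norm_osc, one_mul, Complex.norm_real, Complex.norm_real,
        Real.norm_eq_abs, abs_mul, Real.norm_of_nonneg (kern_nonneg _ _), mul_comm]
    · exact (hφ.integrable_abs_mul.const_mul _).add (hφ.integrable_abs_mul.const_mul _)
    · refine Eventually.of_forall fun z => ?_
      set κ : ℝ → ℝ := fun ε => kern δ ((x + ε • z.1) - (y + ε • z.2)) with hκ
      -- The displacement of the phase per unit of time. It does not involve `t`, so multiplying by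
      -- `T` gives a bound valid for all `t ∈ K`.
      set ρ : ℝ → ℝ := fun ε => Real.pi * |(‖y + ε • z.2‖ ^ 2 - ‖x + ε • z.1‖ ^ 2) -
        (‖y‖ ^ 2 - ‖x‖ ^ 2)| with hρ
      have hκ0 : Tendsto κ (𝓝 0) (𝓝 (kern δ (x - y))) := by
        have : ContinuousAt κ 0 := by
          have hc : Continuous fun ε : ℝ => ‖(x + ε • z.1) - (y + ε • z.2)‖ := by fun_prop
          refine ContinuousAt.inv₀ (hc.continuousAt.rpow_const (Or.inl ?_)) ?_
          · simpa using hx0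
          · simp only [zero_smul, add_zero]
            exact (Real.rpow_pos_of_pos (norm_pos_iff.2 hx0) _).ne'
        simpa [hκ, ContinuousAt] using this
      have hρ0 : Tendsto ρ (𝓝 0) (𝓝 0) := by
        have : Continuous ρ := by fun_prop
        simpa [hρ] using this.tendsto 0
      have hb : Tendsto (fun ε => |φ z.1 * φ z.2| * (T * ρ ε * κ ε + |κ ε - kern δ (x - y)|))
          (𝓝 0) (𝓝 0) := by
        have := (((hρ0.const_mul T).mul hκ0).add (hκ0.sub_const (kern δ (x - y))).abs).const_mul
          |φ z.1 * φ z.2|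
        simpa using this
      have hb' : Tendsto (fun q : ℝ × ℝ => |φ z.1 * φ z.2| *
          (T * ρ q.1 * κ q.1 + |κ q.1 - kern δ (x - y)|)) (𝓝[>] 0 ×ˢ 𝓟 K) (𝓝 0) :=
        (hb.mono_left nhdsWithin_le_nhds).comp tendsto_fst
      refine squeeze_zero_norm' ?_ hb'
      filter_upwards [hev] with q hq
      have hκn : 0 ≤ κ q.1 := kern_nonneg _ _
      have e1 : interIntegrand δ φ q.1 q.2 x y z -
          ((φ z.1 * φ z.2 : ℝ) : ℂ) * (osc q.2 x y * (kern δ (x - y) : ℝ)) =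
          ((φ z.1 * φ z.2 : ℝ) : ℂ) * ((osc q.2 (x + q.1 • z.1) (y + q.1 • z.2) - osc q.2 x y) *
            (κ q.1 : ℝ) + osc q.2 x y * ((κ q.1 - kern δ (x - y) : ℝ) : ℂ)) := by
        rw [interIntegrand]; push_cast; ring
      rw [e1, norm_mul, Complex.norm_real, Real.norm_eq_abs]
      refine mul_le_mul_of_nonneg_left ((norm_add_le _ _).trans ?_) (abs_nonneg _)
      rw [norm_mul, norm_mul, norm_osc, one_mul, Complex.norm_real, Complex.norm_real,
        Real.norm_of_nonneg hκn, Real.norm_eq_abs (κ q.1 - _)]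
      refine add_le_add_left (mul_le_mul_of_nonneg_right ?_ hκn) _
      exact (norm_osc_sub_le _ _ _ _ _).trans
        (mul_le_mul_of_nonneg_right hq.2.2 (by positivity))
  rw [integral_zero] at hlim
  refine hlim.congr' ?_
  filter_upwards [hev] with q hq
  rw [integral_sub (hφ.integrable_interIntegrand hδ hq.1 hq.2.1 q.2 hxy) (hint0.mul_const _),
    integral_mul_const, hone, one_mul]

/-! ### Periodic functions on `ℝⁿ` -/

/-- The half-open unit cell with corner `k`. -/
def cell (k : Fin n → ℤ) : Set (E n) := {x | ∀ i, x i ∈ Ioc (k i : ℝ) (k i + 1)}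

lemma measurableSet_cell (k : Fin n → ℤ) : MeasurableSet (cell k) := by
  have : cell k = ⋂ i, (fun x : E n => x i) ⁻¹' Ioc (k i : ℝ) (k i + 1) := by
    ext x; simp [cell]
  rw [this]
  exact MeasurableSet.iInter fun i => (by fun_prop : Measurable fun x : E n => x i) measurableSet_Ioc

lemma iUnion_cell : ⋃ k : Fin n → ℤ, cell k = univ := by
  refine eq_univ_of_forall fun x => mem_iUnion.2 ⟨fun i => ⌈x i⌉ - 1, fun i => ⟨?_, ?_⟩⟩
  · have := Int.ceil_lt_add_one (x i); push_cast; linarith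
  · have := Int.le_ceil (x i); push_cast; linarith

lemma pairwise_disjoint_cell : Pairwise (Function.onFun Disjoint (cell : (Fin n → ℤ) → Set (E n))) := by
  intro k l hkl
  refine disjoint_left.2 fun x hx hy => hkl ?_
  ext i
  obtain ⟨h1, h2⟩ := hx i
  obtain ⟨h3, h4⟩ := hy i
  have h5 : (k i : ℝ) < l i + 1 := by linarith
  have h6 : (l i : ℝ) < k i + 1 := by linarith
  have h7 : k i < l i + 1 := by exact_mod_cast h5
  have h8 : l i < k i + 1 := by exact_mod_cast h6
  omega

lemma setLIntegral_cell (H : UnitAddTorus (Fin n) → ℝ≥0∞) (k : Fin n → ℤ) :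
    ∫⁻ x in cell k, H (toTorus x) = ∫⁻ y, H y ∂torusMeasure n := by
  have h1 := UnitAddTorus.lintegral_preimage H (fun i => (k i : ℝ))
  refine Eq.trans ?_ h1.symm
  have h2 := (PiLp.volume_preserving_ofLp (Fin n)).setLIntegral_comp_preimage_emb
    (MeasurableEquiv.toLp 2 (Fin n → ℝ)).symm.measurableEmbedding
    (fun x : Fin n → ℝ => H (fun i => (x i : UnitAddCircle)))
    {x | ∀ i, x i ∈ Ioc (k i : ℝ) (k i + 1)}
  exact h2

lemma measurable_toTorus : Measurable (toTorus : E n → UnitAddTorus (Fin n)) :=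
  measurable_pi_lambda _ fun i => AddCircle.measurable_mk'.comp (by fun_prop)

/-- Each cell carries a copy of the torus measure, so the preimage of a null set is a countable
union of null sets. Hence identities that hold a.e. on the torus lift to `ℝⁿ`. -/
lemma quasiMeasurePreserving_toTorus :
    Measure.QuasiMeasurePreserving (toTorus : E n → UnitAddTorus (Fin n)) volume
      (torusMeasure n) := by
  refine ⟨measurable_toTorus, Measure.AbsolutelyContinuous.mk fun s hs h0 => ?_⟩
  rw [Measure.map_apply measurable_toTorus hs, ← univ_inter (toTorus ⁻¹' s), ← iUnion_cell,
    iUnion_inter]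
  refine measure_iUnion_null fun k => ?_
  have h1 := setLIntegral_cell (s.indicator 1) k
  rw [lintegral_indicator_one hs, h0] at h1
  have h2 : ∫⁻ x in cell k, (toTorus ⁻¹' s).indicator 1 x = 0 := h1
  rw [lintegral_indicator_one (measurable_toTorus hs),
    Measure.restrict_apply (measurable_toTorus hs), inter_comm] at h2
  exact h2

lemma summable_one_add_norm_lat_rpow :
    Summable fun k : Fin n → ℤ => ((1 + ‖lat k‖) ^ (n + 1))⁻¹ := by
  have h1 := summable_norm_lat_rpow (n := n) (r := -((n : ℝ) + 1)) (by linarith)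
  have h2 : Summable fun k : Fin n → ℤ => if k = 0 then (1 : ℝ) else 0 :=
    (hasSum_ite_eq 0 (1 : ℝ)).summable
  refine Summable.of_nonneg_of_le (fun k => by positivity) (fun k => ?_) (h1.add h2)
  by_cases hk : k = 0
  · subst hk
    simp only [lat_zero, norm_zero, add_zero, one_pow, inv_one, if_true]
    have : (0 : ℝ) ≤ 0 ^ (-((n : ℝ) + 1)) := Real.rpow_nonneg le_rfl _
    linarith
  · have hk1 := one_le_norm_lat hk
    have hk0 : 0 < ‖lat k‖ := by linarith
    rw [if_neg hk, add_zero, Real.rpow_neg hk0.le]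
    have : ‖lat k‖ ^ ((n : ℝ) + 1) = ‖lat k‖ ^ (n + 1) := by
      rw [← Real.rpow_natCast]; push_cast; rfl
    rw [this]
    gcongr
    linarith

lemma one_add_norm_lat_le {k : Fin n → ℤ} {x : E n} (hx : x ∈ cell k) :
    1 + ‖lat k‖ ≤ (1 + n) * (1 + ‖x‖) := by
  have h1 : ‖x - lat k‖ ≤ n := by
    rw [EuclideanSpace.norm_eq]
    refine Real.sqrt_le_iff.2 ⟨by positivity, ?_⟩
    calc ∑ i, ‖(x - lat k) i‖ ^ 2 ≤ ∑ _i : Fin n, (1 : ℝ) := by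
          refine Finset.sum_le_sum fun i _ => ?_
          obtain ⟨h1, h2⟩ := hx i
          have h3 : (x - lat k) i = x i - k i := by simp [lat]
          rw [h3, Real.norm_of_nonneg (by linarith)]
          nlinarith
      _ = n := by simp
      _ ≤ (n : ℝ) ^ 2 := by
          norm_cast
          nlinarith [Nat.zero_le n, Nat.le_self_pow two_ne_zero n]
  have h2 : ‖lat k‖ ≤ ‖x‖ + ‖x - lat k‖ := by
    have := norm_sub_le x (x - lat k)
    rwa [sub_sub_cancel] at this
  nlinarith [norm_nonneg x, mul_nonneg (Nat.cast_nonneg (α := ℝ) n) (norm_nonneg x)]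

/-- A rapidly decaying weight times a periodic function is integrable. -/
lemma exists_lintegral_weight_toTorus_le {w : E n → ℝ} {C : ℝ} (hC : 0 ≤ C)
    (hw : ∀ x, w x ≤ C * ((1 + ‖x‖) ^ (n + 1))⁻¹) :
    ∃ C' : ℝ, 0 ≤ C' ∧ ∀ H : UnitAddTorus (Fin n) → ℝ≥0∞,
      ∫⁻ x, ENNReal.ofReal (w x) * H (toTorus x) ≤
        ENNReal.ofReal C' * ∫⁻ y, H y ∂torusMeasure n := by
  have hs := (summable_one_add_norm_lat_rpow (n := n)).mul_left (C * (1 + n) ^ (n + 1))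
  -- On the cell at `k`, `1 + ‖x‖` is comparable to `1 + ‖lat k‖` up to the factor `1 + n`, while
  -- `H` has the same integral on every cell.
  refine ⟨∑' k : Fin n → ℤ, C * (1 + n) ^ (n + 1) * ((1 + ‖lat k‖) ^ (n + 1))⁻¹,
    tsum_nonneg fun k => by positivity, fun H => ?_⟩
  rw [← setLIntegral_univ, ← iUnion_cell, lintegral_iUnion measurableSet_cell
    pairwise_disjoint_cell, ENNReal.ofReal_tsum_of_nonneg (fun k => by positivity) hs,
    ← ENNReal.tsum_mul_right]
  refine ENNReal.tsum_le_tsum fun k => ?_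
  rw [← setLIntegral_cell H k, ← lintegral_const_mul' _ _ ENNReal.ofReal_ne_top]
  refine setLIntegral_mono' (measurableSet_cell k) fun x hx => ?_
  gcongr
  refine (hw x).trans ?_
  rw [mul_assoc]
  refine mul_le_mul_of_nonneg_left ?_ hC
  rw [← div_eq_mul_inv, inv_eq_one_div, div_le_div_iff₀ (by positivity) (by positivity), one_mul,
    ← mul_pow]
  exact pow_le_pow_left₀ (by positivity) (one_add_norm_lat_le hx) _

/-! ### Localization as a bounded operator from the torus to `ℝⁿ`. -/

lemma exists_schwartz_scaled_decay (ψ : 𝓢(E n, ℂ)) {ε : ℝ} (hε : 0 < ε) :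
    ∃ C, 0 ≤ C ∧ ∀ x, ‖ψ (ε • x)‖ ^ 2 ≤ C * ((1 + ‖x‖) ^ (n + 1))⁻¹ := by
  obtain ⟨C, hC⟩ : ∃ C, ∀ x, (1 + ‖x‖) ^ (n + 1) * ‖ψ x‖ ≤ C := by
    refine ⟨2 ^ (n + 1) * (Finset.Iic (n + 1, 0)).sup
      (fun m => SchwartzMap.seminorm ℂ m.1 m.2) ψ, fun x => ?_⟩
    simpa using SchwartzMap.one_add_le_sup_seminorm_apply (𝕜 := ℂ) (m := (n + 1, 0)) (k := n + 1)
      (n := 0) le_rfl le_rfl ψ x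
  have hC0 : 0 ≤ C := (by positivity : 0 ≤ (1 + ‖(0 : E n)‖) ^ (n + 1) * ‖ψ 0‖).trans (hC 0)
  refine ⟨C ^ 2 * (1 + ε⁻¹) ^ (n + 1), by positivity, fun x => ?_⟩
  have h1 : 1 + ‖x‖ ≤ (1 + ε⁻¹) * (1 + ‖ε • x‖) := by
    rw [norm_smul, Real.norm_of_nonneg hε.le]
    have : ε⁻¹ * (ε * ‖x‖) = ‖x‖ := by field_simp
    have h2 : 0 < ε⁻¹ := by positivity
    nlinarith [norm_nonneg x, mul_nonneg hε.le (norm_nonneg x)]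
  have h2 := pow_le_pow_left₀ (by positivity) h1 (n + 1)
  rw [mul_pow] at h2
  have h3 := pow_le_pow_left₀ (by positivity) (hC (ε • x)) 2
  rw [mul_pow] at h3
  set A := (1 + ‖ε • x‖) ^ (n + 1) with hA
  have hA1 : 1 ≤ A := one_le_pow₀ (by linarith [norm_nonneg (ε • x)])
  rw [← div_eq_mul_inv, le_div_iff₀ (by positivity)]
  have hB : (0 : ℝ) ≤ (1 + ε⁻¹) ^ (n + 1) := by positivity
  calc ‖ψ (ε • x)‖ ^ 2 * (1 + ‖x‖) ^ (n + 1)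
      ≤ ‖ψ (ε • x)‖ ^ 2 * ((1 + ε⁻¹) ^ (n + 1) * A) := by gcongr
    _ = (1 + ε⁻¹) ^ (n + 1) * (A * ‖ψ (ε • x)‖ ^ 2) := by ring
    _ ≤ (1 + ε⁻¹) ^ (n + 1) * (A ^ 2 * ‖ψ (ε • x)‖ ^ 2) := by gcongr; nlinarith
    _ ≤ (1 + ε⁻¹) ^ (n + 1) * C ^ 2 := by gcongr
    _ = _ := by ring

/-- The factor `N_ε⁻¹`. -/
def normFactor (ψ : 𝓢(E n, ℂ)) (ε : ℝ) : ℝ := (Real.sqrt ((ε ^ n)⁻¹ * normSq ψ))⁻¹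

lemma normFactor_nonneg (ψ : 𝓢(E n, ℂ)) (ε : ℝ) : 0 ≤ normFactor ψ ε := by
  unfold normFactor; positivity

lemma fEps_eq (ψ : 𝓢(E n, ℂ)) (F : UnitAddTorus (Fin n) → ℂ) (ε : ℝ) (x : E n) :
    fEps ψ F ε x = (normFactor ψ ε : ℂ) * ψ (ε • x) * F (toTorus x) := rfl

/-- The constant does not depend on `F`; this is the operator bound behind `localize`. -/
lemma exists_lintegral_fEps_le (ψ : 𝓢(E n, ℂ)) {ε : ℝ} (hε : 0 < ε) :
    ∃ C : ℝ, 0 ≤ C ∧ ∀ F : UnitAddTorus (Fin n) → ℂ,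
      ∫⁻ x, ENNReal.ofReal (‖fEps ψ F ε x‖ ^ 2) ≤
        ENNReal.ofReal C * ∫⁻ y, ENNReal.ofReal (‖F y‖ ^ 2) ∂torusMeasure n := by
  obtain ⟨C, hC0, hC⟩ := exists_schwartz_scaled_decay ψ hε
  obtain ⟨C', hC'0, hC'⟩ := exists_lintegral_weight_toTorus_le
    (w := fun x => normFactor ψ ε ^ 2 * ‖ψ (ε • x)‖ ^ 2) (C := normFactor ψ ε ^ 2 * C)
    (by positivity) (fun x => by rw [mul_assoc]; gcongr; exact hC x)
  refine ⟨C', hC'0, fun F => (le_of_eq ?_).trans (hC' fun y => ENNReal.ofReal (‖F y‖ ^ 2))⟩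
  refine lintegral_congr fun x => ?_
  rw [← ENNReal.ofReal_mul (by positivity), fEps_eq, norm_mul, norm_mul, Complex.norm_real,
    Real.norm_of_nonneg (normFactor_nonneg ψ ε), mul_pow, mul_pow]

lemma aestronglyMeasurable_fEps (ψ : 𝓢(E n, ℂ)) {F : UnitAddTorus (Fin n) → ℂ}
    (hF : AEStronglyMeasurable F (torusMeasure n)) (ε : ℝ) :
    AEStronglyMeasurable (fEps ψ F ε) volume := by
  have h1 : Continuous fun x : E n => (normFactor ψ ε : ℂ) * ψ (ε • x) :=
    continuous_const.mul (ψ.continuous.comp (by fun_prop))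
  exact h1.aestronglyMeasurable.mul
    (hF.comp_quasiMeasurePreserving quasiMeasurePreserving_toTorus)

lemma memLp_two_of_lintegral {α : Type*} [MeasurableSpace α] {μ : Measure α} {f : α → ℂ}
    (hf : AEStronglyMeasurable f μ) (h : ∫⁻ x, ENNReal.ofReal (‖f x‖ ^ 2) ∂μ ≠ ⊤) :
    MemLp f 2 μ := by
  rw [memLp_two_iff_integrable_sq_norm hf]
  exact (lintegral_ofReal_ne_top_iff_integrable (hf.norm.pow 2)
    (Eventually.of_forall fun x => sq_nonneg _)).1 h

lemma memLp_fEps (ψ : 𝓢(E n, ℂ)) {F : UnitAddTorus (Fin n) → ℂ}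
    (hF : MemLp F 2 (torusMeasure n)) {ε : ℝ} (hε : 0 < ε) : MemLp (fEps ψ F ε) 2 volume := by
  obtain ⟨C, hC0, hC⟩ := exists_lintegral_fEps_le ψ hε
  refine memLp_two_of_lintegral (aestronglyMeasurable_fEps ψ hF.1 ε) (ne_top_of_le_ne_top ?_ (hC F))
  refine ENNReal.mul_ne_top ENNReal.ofReal_ne_top ?_
  exact (lintegral_ofReal_ne_top_iff_integrable (hF.1.norm.pow 2)
    (Eventually.of_forall fun x => sq_nonneg _)).2 ((memLp_two_iff_integrable_sq_norm hF.1).1 hF)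

/-- `F ↦ f_ε` as a bounded operator. -/
def localize (ψ : 𝓢(E n, ℂ)) {ε : ℝ} (hε : 0 < ε) :
    Lp ℂ 2 (torusMeasure n) →L[ℂ] Lp ℂ 2 (volume : Measure (E n)) :=
  LinearMap.mkContinuousOfExistsBound
    { toFun := fun F => (memLp_fEps ψ (Lp.memLp F) hε).toLp _
      map_add' := fun F G => by
        apply Lp.ext
        filter_upwards [(memLp_fEps ψ (Lp.memLp (F + G)) hε).coeFn_toLp,
          (memLp_fEps ψ (Lp.memLp F) hε).coeFn_toLp, (memLp_fEps ψ (Lp.memLp G) hε).coeFn_toLp,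
          quasiMeasurePreserving_toTorus.ae (Lp.coeFn_add F G),
          Lp.coeFn_add ((memLp_fEps ψ (Lp.memLp F) hε).toLp _)
            ((memLp_fEps ψ (Lp.memLp G) hε).toLp _)] with x h1 h2 h3 h4 h5
        rw [h1, h5, Pi.add_apply, h2, h3, fEps, h4, Pi.add_apply, mul_add]; rfl
      map_smul' := fun c F => by
        apply Lp.ext
        filter_upwards [(memLp_fEps ψ (Lp.memLp (c • F)) hε).coeFn_toLp,
          (memLp_fEps ψ (Lp.memLp F) hε).coeFn_toLp,
          quasiMeasurePreserving_toTorus.ae (Lp.coeFn_smul c F),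
          Lp.coeFn_smul c ((memLp_fEps ψ (Lp.memLp F) hε).toLp _)] with x h1 h2 h3 h4
        rw [RingHom.id_apply, h1, h4, Pi.smul_apply, h2, fEps, h3, Pi.smul_apply, smul_eq_mul,
          smul_eq_mul, fEps]
        ring } (by
    obtain ⟨C, hC0, hC⟩ := exists_lintegral_fEps_le ψ hε
    refine ⟨Real.sqrt C, fun F => ?_⟩
    have h1 := hC F
    rw [lintegral_ofReal_norm_sq] at h1
    set T := (memLp_fEps ψ (Lp.memLp F) hε).toLp _ with hT
    have h2 : ENNReal.ofReal (‖T‖ ^ 2) ≤ ENNReal.ofReal C * ENNReal.ofReal (‖F‖ ^ 2) := by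
      rw [← lintegral_ofReal_norm_sq]
      refine (le_of_eq (lintegral_congr_ae ?_)).trans h1
      filter_upwards [(memLp_fEps ψ (Lp.memLp F) hε).coeFn_toLp] with x hx
      rw [hT, hx]
    rw [← ENNReal.ofReal_mul hC0, ENNReal.ofReal_le_ofReal_iff (by positivity)] at h2
    refine abs_le_of_sq_le_sq' (?_ : ‖T‖ ^ 2 ≤ (Real.sqrt C * ‖F‖) ^ 2) (by positivity) |>.2
    rwa [mul_pow, Real.sq_sqrt hC0])

lemma coeFn_localize (ψ : 𝓢(E n, ℂ)) {ε : ℝ} (hε : 0 < ε) (F : Lp ℂ 2 (torusMeasure n)) :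
    localize ψ hε F =ᵐ[volume] fEps ψ F ε :=
  (memLp_fEps ψ (Lp.memLp F) hε).coeFn_toLp

lemma localize_toLp (ψ : 𝓢(E n, ℂ)) {ε : ℝ} (hε : 0 < ε) {F : UnitAddTorus (Fin n) → ℂ}
    (hF : MemLp F 2 (torusMeasure n)) : localize ψ hε (hF.toLp F) = toL2 (fEps ψ F ε) := by
  rw [toL2, dif_pos (memLp_fEps ψ hF hε)]
  apply Lp.ext
  filter_upwards [coeFn_localize ψ hε (hF.toLp F), (memLp_fEps ψ hF hε).coeFn_toLp,
    quasiMeasurePreserving_toTorus.ae hF.coeFn_toLp] with x h1 h2 h3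
  rw [h1, h2, fEps, h3, fEps]

/-! ### The profile `ψ̂` and the dispersion of the window. -/

/-- The Fourier transform of `ψ`, as a real function. -/
def profile (ψ : 𝓢(E n, ℂ)) (ξ : E n) : ℝ := ((𝓕 ψ) ξ).re

/-- For real `ψ`, conjugating the transform amounts to reflecting `ψ`, which the symmetry undoes. -/
lemma fourier_eq_profile {ψ : 𝓢(E n, ℂ)} (hψreal : ∀ x, (ψ x).im = 0)
    (hψsymm : ∀ x, ψ (-x) = ψ x) (ξ : E n) : (𝓕 ψ) ξ = (profile ψ ξ : ℂ) := by
  have h : (starRingEnd ℂ) ((𝓕 ψ) ξ) = (𝓕 ψ) ξ := by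
    rw [SchwartzMap.fourier_coe]
    simp only [Real.fourier_eq', smul_eq_mul]
    rw [← integral_conj, ← integral_neg_eq_self]
    refine integral_congr_ae (Eventually.of_forall fun x => ?_)
    simp only
    rw [map_mul, ← Complex.exp_conj, hψsymm, Complex.conj_eq_iff_im.2 (hψreal x)]
    congr 2
    simp only [Complex.ofReal_mul, map_mul, Complex.conj_ofReal, Complex.conj_I, inner_neg_left]
    push_cast
    ring
  exact (Complex.conj_eq_iff_re.1 h).symm

lemma isProfile_profile {ψ : 𝓢(E n, ℂ)}
    (hψsupp : tsupport (𝓕 ψ : 𝓢(E n, ℂ)) ⊆ Metric.closedBall 0 1) : IsProfile (profile ψ) where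
  cont := Complex.continuous_re.comp (𝓕 ψ).continuous
  supp := fun ξ hξ => by
    have : ξ ∉ tsupport (𝓕 ψ : 𝓢(E n, ℂ)) := fun h => by
      have := hψsupp h
      rw [mem_closedBall_zero_iff] at this
      linarith
    rw [profile, image_eq_zero_of_notMem_tsupport this, Complex.zero_re]

/-- Fourier inversion at the origin. -/
lemma integral_profile {ψ : 𝓢(E n, ℂ)} (hψreal : ∀ x, (ψ x).im = 0)
    (hψsymm : ∀ x, ψ (-x) = ψ x) (hψ0 : ψ 0 = 1) : ∫ ξ, profile ψ ξ = 1 := by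
  have h1 : 𝓕⁻ (𝓕 ψ) = ψ := FourierTransform.fourierInv_fourier_eq ψ
  have h2 : (𝓕⁻ (𝓕 ψ)) 0 = ∫ ξ, (𝓕 ψ) ξ := by
    rw [SchwartzMap.fourierInv_coe, Real.fourierInv_eq']
    simp
  rw [h1, hψ0] at h2
  simp_rw [fourier_eq_profile hψreal hψsymm] at h2
  rw [integral_complex_ofReal] at h2
  exact_mod_cast h2.symm

lemma integrable_weight_schwartz (ψ : 𝓢(E n, ℂ)) {δ : ℝ} (hδ0 : 0 < δ) (hδ1 : δ < 1) :
    Integrable fun x => ‖x‖ ^ (2 * δ) * ‖ψ x‖ ^ 2 := by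
  obtain ⟨C, hC⟩ : ∃ C, ∀ x, ‖ψ x‖ ≤ C :=
    ⟨SchwartzMap.seminorm ℂ 0 0 ψ, fun x => by
      simpa using SchwartzMap.norm_le_seminorm ℂ ψ x⟩
  have h0 := SchwartzMap.integrable_pow_mul volume ψ 0
  have h2 := SchwartzMap.integrable_pow_mul volume ψ 2
  have hm : Measurable fun x => ‖x‖ ^ (2 * δ) * ‖ψ x‖ ^ 2 := by
    have := ψ.continuous.measurable
    fun_prop
  refine ((h0.add h2).const_mul C).mono' hm.aestronglyMeasurable (Eventually.of_forall fun x => ?_)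
  rw [Real.norm_of_nonneg (by positivity)]
  have h3 : ‖x‖ ^ (2 * δ) ≤ 1 + ‖x‖ ^ 2 := by
    rcases le_total ‖x‖ 1 with h | h
    · have := Real.rpow_le_one (norm_nonneg x) h (by positivity : 0 ≤ 2 * δ)
      nlinarith [sq_nonneg ‖x‖]
    · have := Real.rpow_le_rpow_of_exponent_le h (by linarith : 2 * δ ≤ 2)
      rw [Real.rpow_two] at this
      linarith
  have h4 : ‖ψ x‖ ^ 2 ≤ C * ‖ψ x‖ := by
    rw [sq]; exact mul_le_mul_of_nonneg_right (hC x) (norm_nonneg _)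
  calc ‖x‖ ^ (2 * δ) * ‖ψ x‖ ^ 2 ≤ (1 + ‖x‖ ^ 2) * (C * ‖ψ x‖) := by gcongr
    _ = C * (‖x‖ ^ 0 * ‖ψ x‖ + ‖x‖ ^ 2 * ‖ψ x‖) := by ring

lemma fourierInv_toLp_fourier (ψ : 𝓢(E n, ℂ)) (h : MemLp (𝓕 ψ : 𝓢(E n, ℂ)) 2 volume) :
    (𝓕⁻ (h.toLp _) : Lp ℂ 2 (volume : Measure (E n))) = ψ.toLp 2 volume := by
  have : h.toLp _ = (𝓕 ψ : 𝓢(E n, ℂ)).toLp 2 volume := rfl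
  rw [this, SchwartzMap.toLp_fourierInv_eq, FourierTransform.fourierInv_fourier_eq]

/-- The dispersion of `ψ` on the Fourier side. -/
lemma dispersion_profile (hn : 1 ≤ n) {δ : ℝ} (hδ0 : 0 < δ) (hδ1 : δ < 1) {ψ : 𝓢(E n, ℂ)}
    (hψreal : ∀ x, (ψ x).im = 0) (hψsymm : ∀ x, ψ (-x) = ψ x) :
    Integrable (fun z : E n × E n =>
      b n δ * ((profile ψ z.1 - profile ψ z.2) ^ 2 * kern δ (z.1 - z.2))) ∧
    ∫ z : E n × E n, b n δ * ((profile ψ z.1 - profile ψ z.2) ^ 2 * kern δ (z.1 - z.2)) =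
      ∫ x, ‖x‖ ^ (2 * δ) * ‖ψ x‖ ^ 2 := by
  have hb := b_pos hn hδ0 hδ1
  have hmem : MemLp (𝓕 ψ : 𝓢(E n, ℂ)) 2 volume := SchwartzMap.memLp _ 2 volume
  have h1 := lintegral_weight_eq hn hδ0 hδ1 hmem
  rw [fourierInv_toLp_fourier] at h1
  have h2 : ∫⁻ x, ENNReal.ofReal (‖x‖ ^ (2 * δ) * ‖(ψ.toLp 2 volume) x‖ ^ 2) =
      ENNReal.ofReal (∫ x, ‖x‖ ^ (2 * δ) * ‖ψ x‖ ^ 2) := by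
    rw [ofReal_integral_eq_lintegral_ofReal (integrable_weight_schwartz ψ hδ0 hδ1)
      (Eventually.of_forall fun x => by positivity)]
    refine lintegral_congr_ae ?_
    filter_upwards [ψ.coeFn_toLp 2 volume] with x hx
    rw [hx]
  have h3 : ∀ z : E n × E n, ‖(𝓕 ψ) z.1 - (𝓕 ψ) z.2‖ ^ 2 = (profile ψ z.1 - profile ψ z.2) ^ 2 := by
    intro z
    rw [fourier_eq_profile hψreal hψsymm, fourier_eq_profile hψreal hψsymm, ← Complex.ofReal_sub,
      Complex.norm_real, Real.norm_eq_abs, sq_abs]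
  rw [h2] at h1
  simp_rw [h3] at h1
  have hm : AEStronglyMeasurable (fun z : E n × E n =>
      b n δ * ((profile ψ z.1 - profile ψ z.2) ^ 2 * kern δ (z.1 - z.2))) volume := by
    have h4 : Measurable (profile ψ) := (Complex.continuous_re.comp (𝓕 ψ).continuous).measurable
    have h5 := measurable_kern (n := n) δ
    refine Measurable.aestronglyMeasurable ?_
    fun_prop
  have h0 : ∀ z : E n × E n,
      0 ≤ b n δ * ((profile ψ z.1 - profile ψ z.2) ^ 2 * kern δ (z.1 - z.2)) := fun z => by
    have := kern_nonneg δ (z.1 - z.2)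
    positivity
  constructor
  · rw [← lintegral_ofReal_ne_top_iff_integrable hm (Eventually.of_forall h0), ← h1]
    exact ENNReal.ofReal_ne_top
  · rw [integral_eq_lintegral_of_nonneg_ae (Eventually.of_forall h0) hm, ← h1,
      ENNReal.toReal_ofReal (integral_nonneg fun x => by positivity)]

/-! ### The Fourier transform of localized periodic data -/

/-- The frequency-side wave packet `ξ ↦ ψ̂((ξ - ν) / ε)`. -/
def packetSchwartz (ψ : 𝓢(E n, ℂ)) (ε : ℝ) (hε : ε ≠ 0) (ν : Fin n → ℤ) : 𝓢(E n, ℂ) :=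
  SchwartzMap.compSubConstCLM ℂ (lat ν)
    (SchwartzMap.compCLMOfContinuousLinearEquiv ℂ
      ((LinearEquiv.smulOfNeZero ℝ (E n) ε⁻¹ (inv_ne_zero hε)).toContinuousLinearEquiv) (𝓕 ψ))

lemma packetSchwartz_apply (ψ : 𝓢(E n, ℂ)) {ε : ℝ} (hε : ε ≠ 0) (ν : Fin n → ℤ) (ξ : E n) :
    packetSchwartz ψ ε hε ν ξ = (𝓕 ψ) (ε⁻¹ • (ξ - lat ν)) := rfl

lemma fourierInv_comp_smul_apply (g : E n → ℂ) {ε : ℝ} (hε : 0 < ε) (x : E n) :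
    𝓕⁻ (fun ξ => g (ε⁻¹ • ξ)) x = (ε ^ n : ℝ) * 𝓕⁻ g (ε • x) := by
  simp only [Real.fourierInv_eq', smul_eq_mul]
  have h := Measure.integral_comp_inv_smul (volume : Measure (E n))
    (fun ξ => Complex.exp (((2 * Real.pi * ⟪ξ, ε • x⟫ : ℝ) : ℂ) * Complex.I) * g ξ) ε
  rw [finrank_euclideanSpace, Fintype.card_fin, abs_of_pos (by positivity)] at h
  rw [← Complex.real_smul, ← h]
  refine integral_congr_ae (Eventually.of_forall fun ξ => ?_)
  simp only
  congr 4
  rw [real_inner_smul_left, real_inner_smul_right]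
  field_simp

lemma fourierInv_packetSchwartz (ψ : 𝓢(E n, ℂ)) {ε : ℝ} (hε : 0 < ε) (ν : Fin n → ℤ) (x : E n) :
    (𝓕⁻ (packetSchwartz ψ ε hε.ne' ν)) x = char (lat ν) x * ((ε ^ n : ℝ) * ψ (ε • x)) := by
  rw [SchwartzMap.fourierInv_coe]
  have h1 : (packetSchwartz ψ ε hε.ne' ν : E n → ℂ) =
      fun ξ => (fun ξ => (𝓕 ψ) (ε⁻¹ • ξ)) (ξ - lat ν) := rfl
  rw [h1]
  refine (fourierInv_comp_sub_apply (fun ξ => (𝓕 ψ) (ε⁻¹ • ξ)) (lat ν) x).trans ?_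
  rw [fourierInv_comp_smul_apply (⇑(𝓕 ψ : 𝓢(E n, ℂ))) hε, ← SchwartzMap.fourierInv_coe,
    FourierTransform.fourierInv_fourier_eq]

lemma mFourier_toTorus (ν : Fin n → ℤ) (x : E n) :
    UnitAddTorus.mFourier ν (toTorus x) = char (lat ν) x := by
  simp only [UnitAddTorus.mFourier, ContinuousMap.coe_mk, toTorus, fourier_coe_apply, char]
  rw [← Complex.exp_sum]
  congr 1
  simp only [lat, PiLp.inner_apply, RCLike.inner_apply, conj_trivial]
  push_cast
  rw [Finset.mul_sum, Finset.sum_mul]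
  refine Finset.sum_congr rfl fun i _ => ?_
  ring

lemma localize_mFourierLp (ψ : 𝓢(E n, ℂ)) {ε : ℝ} (hε : 0 < ε) (ν : Fin n → ℤ) :
    localize ψ hε (UnitAddTorus.mFourierLp 2 ν) =
      ((normFactor ψ ε * (ε ^ n)⁻¹ : ℝ) : ℂ) •
        (𝓕⁻ (packetSchwartz ψ ε hε.ne' ν)).toLp 2 volume := by
  apply Lp.ext
  filter_upwards [coeFn_localize ψ hε (UnitAddTorus.mFourierLp 2 ν),
    quasiMeasurePreserving_toTorus.ae (UnitAddTorus.coeFn_mFourierLp 2 ν),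
    (𝓕⁻ (packetSchwartz ψ ε hε.ne' ν)).coeFn_toLp 2 volume,
    Lp.coeFn_smul ((normFactor ψ ε * (ε ^ n)⁻¹ : ℝ) : ℂ)
      ((𝓕⁻ (packetSchwartz ψ ε hε.ne' ν)).toLp 2 volume)] with x h1 h2 h3 h4
  rw [h1, h4, Pi.smul_apply, h3, fourierInv_packetSchwartz ψ hε, fEps_eq, h2, mFourier_toTorus,
    smul_eq_mul]
  have : (ε : ℂ) ≠ 0 := by exact_mod_cast hε.ne'
  push_cast
  field_simp

/-- The Fourier series of `F` converges in `L²` of the torus; localization and the Fourier transform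
are bounded operators, and they carry each exponential to a packet. -/
lemma hasSum_fourier_fEps (ψ : 𝓢(E n, ℂ)) {F : UnitAddTorus (Fin n) → ℂ}
    (hF : MemLp F 2 (torusMeasure n)) {ε : ℝ} (hε : 0 < ε) :
    HasSum (fun ν : Fin n → ℤ => (UnitAddTorus.mFourierCoeff F ν *
        ((normFactor ψ ε * (ε ^ n)⁻¹ : ℝ) : ℂ)) •
        (packetSchwartz ψ ε hε.ne' ν).toLp 2 (volume : Measure (E n)))
      (𝓕 (toL2 (fEps ψ F ε))) := by
  have h1 := UnitAddTorus.hasSum_mFourier_series_L2 (hF.toLp F)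
  have hcoef : ∀ ν, UnitAddTorus.mFourierCoeff (hF.toLp F) ν = UnitAddTorus.mFourierCoeff F ν := by
    intro ν
    refine integral_congr_ae ?_
    filter_upwards [hF.coeFn_toLp] with y hy
    rw [hy]
  have h2 := (h1.mapL (localize ψ hε)).mapL
    (Lp.fourierTransformₗᵢ (E n) ℂ).toContinuousLinearEquiv.toContinuousLinearMap
  rw [localize_toLp] at h2
  refine HasSum.congr_fun h2 fun ν => ?_
  rw [hcoef, map_smul, localize_mFourierLp, map_smul, map_smul, smul_smul]
  congr 1
  have : ((Lp.fourierTransformₗᵢ (E n) ℂ).toContinuousLinearEquiv.toContinuousLinearMap)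
      ((𝓕⁻ (packetSchwartz ψ ε hε.ne' ν)).toLp 2 volume) =
      𝓕 ((𝓕⁻ (packetSchwartz ψ ε hε.ne' ν)).toLp 2 volume) := rfl
  rw [this, SchwartzMap.toLp_fourier_eq, FourierTransform.fourier_fourierInv_eq]

/-- Convergence in `L²` implies convergence in measure, hence a.e. convergence along a subsequence,
whose limit must be the pointwise sum. -/
lemma ae_eq_tsum_of_hasSum_Lp {α ι : Type*} [MeasurableSpace α] {μ : Measure α} [Countable ι]
    {g : ι → Lp ℂ 2 μ} {w : Lp ℂ 2 μ} {G : ι → α → ℂ} (hw : HasSum g w)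
    (hg : ∀ ν, g ν =ᵐ[μ] G ν) (hG : ∀ x, Summable fun ν => G ν x) :
    w =ᵐ[μ] fun x => ∑' ν, G ν x := by
  obtain ⟨s, hs⟩ := exists_seq_tendsto (atTop : Filter (Finset ι))
  have hfin : ∀ t : Finset ι, (∑ ν ∈ t, g ν : Lp ℂ 2 μ) =ᵐ[μ] fun x => ∑ ν ∈ t, G ν x := by
    intro t
    filter_upwards [Lp.coeFn_finsetSum t g, ae_all_iff.2 hg] with x h1 h2
    rw [h1, Finset.sum_apply]
    exact Finset.sum_congr rfl fun i _ => h2 i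
  have hw' : Tendsto (fun t : Finset ι => ∑ ν ∈ t, g ν) atTop (𝓝 w) := by simpa [HasSum] using hw
  have h1 : Tendsto (fun k => ∑ ν ∈ s k, g ν) atTop (𝓝 w) := hw'.comp hs
  obtain ⟨ns, hns, hlim⟩ := (tendstoInMeasure_of_tendsto_Lp h1).exists_seq_tendsto_ae
  filter_upwards [hlim, ae_all_iff.2 fun k => hfin (s (ns k))] with x hx1 hx2
  refine tendsto_nhds_unique hx1 ?_
  simp_rw [hx2]
  have hx : Tendsto (fun t : Finset ι => ∑ ν ∈ t, G ν x) atTop (𝓝 (∑' ν, G ν x)) := by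
    simpa [HasSum] using (hG x).hasSum
  exact hx.comp (hs.comp hns.tendsto_atTop)

/-- The frequency-side wave packet at the lattice point `ν` and time `t`. -/
def packet (φ : E n → ℝ) (a : (Fin n → ℤ) → ℂ) (c ε t : ℝ) (ν : Fin n → ℤ) (ξ : E n) : ℂ :=
  a ν * ((c * φ (ε⁻¹ • (ξ - lat ν)) : ℝ) : ℂ) * phase t ξ

/-- Two packets active at `ξ` would have centres within `2ε ≤ 1/2` of each other, whereas distinct
lattice points are at distance at least `1`. -/
lemma IsProfile.exists_packet_eq_zero {φ : E n → ℝ} (hφ : IsProfile φ) {ε : ℝ} (hε0 : 0 < ε)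
    (hε : ε ≤ 1 / 4) (a : (Fin n → ℤ) → ℂ) (c t : ℝ) (ξ : E n) :
    ∃ i, ∀ ν, ν ≠ i → packet φ a c ε t ν ξ = 0 := by
  by_cases h : ∃ i, φ (ε⁻¹ • (ξ - lat i)) ≠ 0
  · obtain ⟨i, hi⟩ := h
    refine ⟨i, fun ν hν => ?_⟩
    by_contra hne
    have h1 : φ (ε⁻¹ • (ξ - lat ν)) ≠ 0 := fun h0 => hne (by simp [packet, h0])
    have key : ∀ μ : Fin n → ℤ, φ (ε⁻¹ • (ξ - lat μ)) ≠ 0 → ‖ξ - lat μ‖ ≤ ε := by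
      intro μ hμ
      have := hφ.norm_le hμ
      rw [norm_smul, Real.norm_of_nonneg (by positivity), inv_mul_le_iff₀ hε0, mul_one] at this
      exact this
    have h2 := one_le_norm_lat_sub hν
    have h3 : lat ν - lat i = (ξ - lat i) - (ξ - lat ν) := by abel
    rw [h3] at h2
    have h4 := norm_sub_le (ξ - lat i) (ξ - lat ν)
    linarith [key i hi, key ν h1]
  · push Not at h
    exact ⟨0, fun ν _ => by simp [packet, h ν]⟩

lemma IsProfile.summable_packet {φ : E n → ℝ} (hφ : IsProfile φ) {ε : ℝ} (hε0 : 0 < ε)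
    (hε : ε ≤ 1 / 4) (a : (Fin n → ℤ) → ℂ) (c t : ℝ) (ξ : E n) :
    Summable fun ν => packet φ a c ε t ν ξ := by
  obtain ⟨i, hi⟩ := hφ.exists_packet_eq_zero hε0 hε a c t ξ
  exact (hasSum_single i hi).summable

lemma packet_eq_mul_phase (φ : E n → ℝ) (a : (Fin n → ℤ) → ℂ) (c ε t : ℝ) (ν : Fin n → ℤ)
    (ξ : E n) : packet φ a c ε t ν ξ = packet φ a c ε 0 ν ξ * phase t ξ := by
  simp [packet, phase]

lemma fourier_fEps_ae {ψ : 𝓢(E n, ℂ)} (hψreal : ∀ x, (ψ x).im = 0)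
    (hψsymm : ∀ x, ψ (-x) = ψ x)
    (hψsupp : tsupport (𝓕 ψ : 𝓢(E n, ℂ)) ⊆ Metric.closedBall 0 1)
    {F : UnitAddTorus (Fin n) → ℂ} (hF : MemLp F 2 (torusMeasure n)) {ε : ℝ} (hε0 : 0 < ε)
    (hε : ε ≤ 1 / 4) :
    (𝓕 (toL2 (fEps ψ F ε)) : Lp ℂ 2 (volume : Measure (E n))) =ᵐ[volume] fun ξ =>
      ∑' ν, packet (profile ψ) (UnitAddTorus.mFourierCoeff F) (normFactor ψ ε * (ε ^ n)⁻¹) ε 0 ν ξ := by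
  refine ae_eq_tsum_of_hasSum_Lp (hasSum_fourier_fEps ψ hF hε0) (fun ν => ?_) fun ξ =>
    (isProfile_profile hψsupp).summable_packet hε0 hε _ _ _ _
  filter_upwards [(packetSchwartz ψ ε hε0.ne' ν).coeFn_toLp 2 volume,
    Lp.coeFn_smul (UnitAddTorus.mFourierCoeff F ν * ((normFactor ψ ε * (ε ^ n)⁻¹ : ℝ) : ℂ))
      ((packetSchwartz ψ ε hε0.ne' ν).toLp 2 volume)] with ξ h1 h2
  rw [h2, Pi.smul_apply, h1, packetSchwartz_apply, fourier_eq_profile hψreal hψsymm, packet,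
    smul_eq_mul]
  simp [phase]
  ring

/-- The dispersion of localized periodic data on the Fourier side. -/
theorem lintegral_hIntegrand_fEps (hn : 1 ≤ n) {δ : ℝ} (hδ0 : 0 < δ) (hδ1 : δ < 1)
    {ψ : 𝓢(E n, ℂ)} (hψreal : ∀ x, (ψ x).im = 0)
    (hψsymm : ∀ x, ψ (-x) = ψ x)
    (hψsupp : tsupport (𝓕 ψ : 𝓢(E n, ℂ)) ⊆ Metric.closedBall 0 1)
    {F : UnitAddTorus (Fin n) → ℂ} (hF : MemLp F 2 (torusMeasure n)) {ε : ℝ} (hε0 : 0 < ε)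
    (hε : ε ≤ 1 / 4) (t : ℝ) {G : E n → ℂ} (hG : ∀ ξ, G ξ = ∑' ν, packet (profile ψ)
      (UnitAddTorus.mFourierCoeff F) (normFactor ψ ε * (ε ^ n)⁻¹) ε t ν ξ) :
    ∫⁻ x, ENNReal.ofReal (hIntegrand δ (fEps ψ F ε) t x) =
      ∫⁻ z : E n × E n, ENNReal.ofReal (b n δ * (‖G z.1 - G z.2‖ ^ 2 * kern δ (z.1 - z.2))) := by
  set w := (𝓕 (toL2 (fEps ψ F ε)) : Lp ℂ 2 (volume : Measure (E n))) with hw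
  have hae : (fun ξ => phase t ξ * w ξ) =ᵐ[volume] G := by
    filter_upwards [fourier_fEps_ae hψreal hψsymm hψsupp hF hε0 hε] with ξ hξ
    rw [hw, hξ, hG, ← tsum_mul_left]
    refine tsum_congr fun ν => ?_
    rw [packet_eq_mul_phase _ _ _ _ t, mul_comm]
  have hGm : MemLp G 2 volume := (memLp_congr_ae hae).1 (memLp_phase_mul t w)
  rw [← lintegral_weight_eq hn hδ0 hδ1 hGm]
  have : evolve (toL2 (fEps ψ F ε)) t = 𝓕⁻ (hGm.toLp G) := by
    rw [evolve]
    congr 1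
    exact (MemLp.toLp_eq_toLp_iff _ _).2 hae
  simp only [hIntegrand, this]

lemma measurable_hIntegrand (δ : ℝ) (f : E n → ℂ) (t : ℝ) : Measurable (hIntegrand δ f t) := by
  have := (Lp.stronglyMeasurable (evolve (toL2 f) t)).measurable
  unfold hIntegrand
  fun_prop

lemma hIntegrand_nonneg (δ : ℝ) (f : E n → ℂ) (t : ℝ) (x : E n) : 0 ≤ hIntegrand δ f t x := by
  unfold hIntegrand; positivity

instance isAddHaarMeasure_prod : (volume : Measure (E n × E n)).IsAddHaarMeasure := by
  rw [Measure.volume_eq_prod]; infer_instance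

/-- The pointwise sums give measurability of the limit; the summable `L¹` norms bound its integral.
-/
lemma integrable_tsum {α ι V : Type*} [MeasurableSpace α] {μ : Measure α} [Countable ι]
    [NormedAddCommGroup V] {f : ι → α → V} (hf : ∀ i, Integrable (f i) μ)
    (hs : Summable fun i => ∫ x, ‖f i x‖ ∂μ) (hp : ∀ x, Summable fun i => f i x) :
    Integrable (fun x => ∑' i, f i x) μ := by
  refine ⟨aestronglyMeasurable_of_tendsto_ae (atTop : Filter (Finset ι))
    (f := fun s x => ∑ i ∈ s, f i x)
    (fun s => Finset.aestronglyMeasurable_fun_sum s fun i _ => (hf i).1)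
    (Eventually.of_forall fun x => by simpa [HasSum] using (hp x).hasSum), ?_⟩
  rw [hasFiniteIntegral_iff_enorm]
  calc ∫⁻ x, ‖∑' i, f i x‖ₑ ∂μ ≤ ∫⁻ x, ∑' i, ‖f i x‖ₑ ∂μ :=
        lintegral_mono fun x => enorm_tsum_le_tsum_enorm
    _ = ∑' i, ∫⁻ x, ‖f i x‖ₑ ∂μ := lintegral_tsum fun i => (hf i).1.enorm
    _ = ∑' i, ENNReal.ofReal (∫ x, ‖f i x‖ ∂μ) :=
        tsum_congr fun i => (ofReal_integral_norm_eq_lintegral_enorm (hf i)).symm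
    _ < ⊤ := by
        rw [← ENNReal.ofReal_tsum_of_nonneg (fun i => integral_nonneg fun x => norm_nonneg _) hs]
        exact ENNReal.ofReal_lt_top

lemma integrable_affine_iff {V : Type*} [NormedAddCommGroup V] {ε : ℝ} (hε : ε ≠ 0)
    (w : E n × E n) (f : E n × E n → V) :
    Integrable (fun z => f (w + ε • z)) ↔ Integrable f :=
  (integrable_comp_smul_iff volume (fun z => f (w + z)) hε).trans
    ((measurePreserving_add_left volume w).integrable_comp_emb (measurableEmbedding_addLeft w))

lemma integral_affine {V : Type*} [NormedAddCommGroup V] [NormedSpace ℝ V] {ε : ℝ} (hε : 0 < ε)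
    (w : E n × E n) (f : E n × E n → V) :
    ∫ z, f z = ε ^ (2 * n) • ∫ z, f (w + ε • z) := by
  rw [Measure.integral_comp_smul volume (fun z => f (w + z)) ε, smul_smul]
  have : Module.finrank ℝ (E n × E n) = 2 * n := by
    rw [Module.finrank_prod, finrank_euclideanSpace, Fintype.card_fin]; ring
  rw [this, abs_of_pos (by positivity), mul_inv_cancel₀ (by positivity), one_smul,
    integral_add_left_eq_self]

lemma kern_smul {δ ε : ℝ} (hε : 0 < ε) (ζ : E n) :
    kern δ (ε • ζ) = (ε ^ ((n : ℝ) + 2 * δ))⁻¹ * kern δ ζ := by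
  rw [kern, kern, norm_smul, Real.norm_of_nonneg hε.le, Real.mul_rpow hε.le (norm_nonneg _), mul_inv]

/-- Separates a time-independent part, which yields the dispersion of `ψ`, from the phase part,
which yields the variation. -/
lemma norm_exp_mul_sub_sq (x y α β : ℝ) :
    ‖(x : ℂ) * Complex.exp ((α : ℂ) * Complex.I) - (y : ℂ) * Complex.exp ((β : ℂ) * Complex.I)‖ ^ 2 =
      (x - y) ^ 2 + 2 * (x * y * (1 - Real.cos (α - β))) := by
  rw [← Complex.normSq_eq_norm_sq, Complex.normSq_apply]
  simp only [Complex.sub_re, Complex.sub_im, Complex.re_ofReal_mul, Complex.im_ofReal_mul,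
    Complex.exp_ofReal_mul_I_re, Complex.exp_ofReal_mul_I_im, Real.cos_sub]
  linear_combination x ^ 2 * Real.sin_sq_add_cos_sq α + y ^ 2 * Real.sin_sq_add_cos_sq β

/-- The diagonal integrand. -/
def diagIntegrand (δ : ℝ) (φ : E n → ℝ) (a : (Fin n → ℤ) → ℂ) (c ε t : ℝ) (ν : Fin n → ℤ)
    (z : E n × E n) : ℝ :=
  b n δ * (‖packet φ a c ε t ν z.1 - packet φ a c ε t ν z.2‖ ^ 2 * kern δ (z.1 - z.2))

/-- The off-diagonal integrand. -/
def offIntegrand (δ : ℝ) (φ : E n → ℝ) (a : (Fin n → ℤ) → ℂ) (c ε t : ℝ) (p : OffDiag n)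
    (z : E n × E n) : ℂ :=
  packet φ a c ε t p.1.1 z.1 * (starRingEnd ℂ) (packet φ a c ε t p.1.2 z.2) *
    (kern δ (z.1 - z.2) : ℝ)

/-- Expanding the squares about the centre, the cross term is a transport by `tεx` and the quadratic
term is evolution over the rescaled time `tε²`. -/
lemma phase_affine_sub (t ε : ℝ) (x ξ η : E n) :
    (-(Real.pi * t * ‖x + ε • ξ‖ ^ 2)) - (-(Real.pi * t * ‖x + ε • η‖ ^ 2)) =
      -theta ((t * ε) • x) (t * ε ^ 2) (ξ, η) := by
  rw [theta, norm_add_sq_real, norm_add_sq_real, norm_smul, norm_smul, real_inner_smul_right,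
    real_inner_smul_right, real_inner_smul_left, inner_sub_right, mul_pow, mul_pow, Real.norm_eq_abs,
    sq_abs]
  ring

lemma diagIntegrand_affine {δ : ℝ} (φ : E n → ℝ) (a : (Fin n → ℤ) → ℂ) (c : ℝ) {ε : ℝ}
    (hε : 0 < ε) (t : ℝ) (ν : Fin n → ℤ) (z : E n × E n) :
    diagIntegrand δ φ a c ε t ν ((lat ν, lat ν) + ε • z) =
      ‖a ν‖ ^ 2 * c ^ 2 * (ε ^ ((n : ℝ) + 2 * δ))⁻¹ *
        (b n δ * ((φ z.1 - φ z.2) ^ 2 * kern δ (z.1 - z.2)) +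
          2 * b n δ * varIntegrand δ φ ((t * ε) • lat ν) (t * ε ^ 2) z) := by
  have h1 : ∀ ξ : E n, packet φ a c ε t ν (lat ν + ε • ξ) = a ν * ((c * φ ξ : ℝ) *
      Complex.exp (((-(Real.pi * t * ‖lat ν + ε • ξ‖ ^ 2) : ℝ) : ℂ) * Complex.I)) := by
    intro ξ
    rw [packet, phase, add_sub_cancel_left, smul_smul, inv_mul_cancel₀ hε.ne', one_smul, mul_assoc]
  simp only [diagIntegrand, Prod.fst_add, Prod.snd_add, Prod.smul_fst, Prod.smul_snd]
  rw [h1, h1, ← mul_sub, norm_mul, mul_pow, norm_exp_mul_sub_sq, phase_affine_sub, Real.cos_neg,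
    add_sub_add_left_eq_sub, ← smul_sub, kern_smul hε, varIntegrand]
  ring

/-- Recentre at `ν` and rescale by `ε`: the Jacobian is `ε^{2n}` and the kernel scales as
`ε^{-n-2δ}`. -/
lemma IsProfile.integral_diagIntegrand {φ : E n → ℝ} (hφ : IsProfile φ) (hn : 1 ≤ n) {δ : ℝ}
    (hδ1 : δ < 1)
    (hW : Integrable fun z : E n × E n => b n δ * ((φ z.1 - φ z.2) ^ 2 * kern δ (z.1 - z.2)))
    (a : (Fin n → ℤ) → ℂ) (c : ℝ) {ε : ℝ} (hε : 0 < ε) (t : ℝ) (ν : Fin n → ℤ) :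
    Integrable (diagIntegrand δ φ a c ε t ν) ∧
    ∫ z, diagIntegrand δ φ a c ε t ν z = ε ^ (2 * n) * c ^ 2 * (ε ^ ((n : ℝ) + 2 * δ))⁻¹ *
      (‖a ν‖ ^ 2 * ((∫ z : E n × E n, b n δ * ((φ z.1 - φ z.2) ^ 2 * kern δ (z.1 - z.2))) +
        packetVar δ φ ((t * ε) • lat ν) (t * ε ^ 2))) := by
  have hv := (hφ.integrable_varIntegrand hn hδ1 ((t * ε) • lat ν) (t * ε ^ 2)).const_mul (2 * b n δ)
  constructor
  · rw [← integrable_affine_iff hε.ne' (lat ν, lat ν)]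
    simp_rw [diagIntegrand_affine φ a c hε]
    exact (hW.add hv).const_mul _
  · rw [integral_affine hε (lat ν, lat ν)]
    simp_rw [diagIntegrand_affine φ a c hε]
    rw [integral_const_mul, integral_add hW hv, integral_const_mul (2 * b n δ), packetVar, smul_eq_mul]
    ring

lemma offIntegrand_affine {δ : ℝ} (φ : E n → ℝ) (a : (Fin n → ℤ) → ℂ) (c : ℝ) {ε : ℝ}
    (hε : 0 < ε) (t : ℝ) (p : OffDiag n) (z : E n × E n) :
    offIntegrand δ φ a c ε t p ((lat p.1.1, lat p.1.2) + ε • z) =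
      ((c ^ 2 : ℝ) : ℂ) * (a p.1.1 * (starRingEnd ℂ) (a p.1.2)) *
        interIntegrand δ φ ε t (lat p.1.1) (lat p.1.2) z := by
  have h1 : ∀ (ν : Fin n → ℤ) (ξ : E n), packet φ a c ε t ν (lat ν + ε • ξ) =
      a ν * (c * φ ξ : ℝ) * phase t (lat ν + ε • ξ) := by
    intro ν ξ
    rw [packet, add_sub_cancel_left, smul_smul, inv_mul_cancel₀ hε.ne', one_smul]
  simp only [offIntegrand, Prod.fst_add, Prod.snd_add, Prod.smul_fst, Prod.smul_snd]
  rw [h1, h1, interIntegrand, ← phase_mul_conj_phase]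
  simp only [map_mul, Complex.conj_ofReal]
  push_cast
  ring

lemma IsProfile.integral_offIntegrand {φ : E n → ℝ} (hφ : IsProfile φ) {δ : ℝ} (hδ0 : 0 < δ)
    (a : (Fin n → ℤ) → ℂ) (c : ℝ) {ε : ℝ} (hε0 : 0 < ε) (hε : ε ≤ 1 / 4) (t : ℝ) (p : OffDiag n) :
    Integrable (offIntegrand δ φ a c ε t p) ∧
    ∫ z, offIntegrand δ φ a c ε t p z = ((ε ^ (2 * n) * c ^ 2 : ℝ) : ℂ) *
      (a p.1.1 * (starRingEnd ℂ) (a p.1.2) *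
        ∫ z, interIntegrand δ φ ε t (lat p.1.1) (lat p.1.2) z) ∧
    ∫ z, ‖offIntegrand δ φ a c ε t p z‖ ≤ ε ^ (2 * n) * c ^ 2 *
      (2 ^ ((n : ℝ) + 2 * δ) * ∫ z : E n × E n, |φ z.1| * |φ z.2|) *
      (‖a p.1.1‖ * ‖a p.1.2‖ * kern δ (lat p.1.1 - lat p.1.2)) := by
  have hp := one_le_norm_lat_sub p.2
  have hi := hφ.integrable_interIntegrand hδ0 hε0.le hε t hp
  refine ⟨?_, ?_, ?_⟩
  · rw [← integrable_affine_iff hε0.ne' (lat p.1.1, lat p.1.2)]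
    simp_rw [offIntegrand_affine φ a c hε0]
    exact hi.const_mul _
  · rw [integral_affine hε0 (lat p.1.1, lat p.1.2)]
    simp_rw [offIntegrand_affine φ a c hε0]
    rw [integral_const_mul, Complex.real_smul]
    push_cast
    ring
  · rw [integral_affine hε0 (lat p.1.1, lat p.1.2)]
    simp_rw [offIntegrand_affine φ a c hε0, norm_mul, Complex.norm_real, RCLike.norm_conj]
    rw [integral_const_mul, smul_eq_mul, Real.norm_of_nonneg (sq_nonneg c)]
    have := hφ.integral_norm_interIntegrand_le hδ0 hε0.le hε t hp
    calc ε ^ (2 * n) * (c ^ 2 * (‖a p.1.1‖ * ‖a p.1.2‖) *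
          ∫ z, ‖interIntegrand δ φ ε t (lat p.1.1) (lat p.1.2) z‖)
        ≤ ε ^ (2 * n) * (c ^ 2 * (‖a p.1.1‖ * ‖a p.1.2‖) * (2 ^ ((n : ℝ) + 2 * δ) *
          (∫ z : E n × E n, |φ z.1| * |φ z.2|) * kern δ (lat p.1.1 - lat p.1.2))) := by gcongr
      _ = _ := by ring

/-- Exchanging the two packets conjugates their interaction. -/
lemma conj_integral_interIntegrand (δ : ℝ) (φ : E n → ℝ) (ε t : ℝ) (x y : E n) :
    (starRingEnd ℂ) (∫ z, interIntegrand δ φ ε t x y z) = ∫ z, interIntegrand δ φ ε t y x z := by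
  rw [← integral_conj, Measure.volume_eq_prod, ← integral_prod_swap]
  refine integral_congr_ae (Eventually.of_forall fun z => ?_)
  simp only [interIntegrand, Prod.fst_swap, Prod.snd_swap, map_mul, Complex.conj_ofReal]
  rw [← phase_mul_conj_phase, ← phase_mul_conj_phase, map_mul, Complex.conj_conj,
    ← kern_neg δ (_ - _), neg_sub]
  push_cast
  ring

/-- The sum of the interactions of distinct packets. -/
def interSum (δ : ℝ) (φ : E n → ℝ) (a : (Fin n → ℤ) → ℂ) (ε t : ℝ) : ℂ :=
  ∑' p : OffDiag n, a p.1.1 * (starRingEnd ℂ) (a p.1.2) *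
    ∫ z, interIntegrand δ φ ε t (lat p.1.1) (lat p.1.2) z

/-- Exchanging `ν₁` and `ν₂` conjugates the summands. The real part found in the dispersion can thus
be identified with the full complex sum. -/
lemma interSum_im (δ : ℝ) (φ : E n → ℝ) (a : (Fin n → ℤ) → ℂ) (ε t : ℝ) :
    (interSum δ φ a ε t).im = 0 := by
  rw [← Complex.conj_eq_iff_im, interSum, Complex.conj_tsum]
  let e : OffDiag n ≃ OffDiag n :=
    { toFun := fun p => ⟨(p.1.2, p.1.1), p.2.symm⟩
      invFun := fun p => ⟨(p.1.2, p.1.1), p.2.symm⟩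
      left_inv := fun p => rfl
      right_inv := fun p => rfl }
  rw [← e.tsum_eq]
  refine tsum_congr fun p => ?_
  simp only [e, Equiv.coe_fn_mk, map_mul, Complex.conj_conj, conj_integral_interIntegrand]
  ring

lemma IsProfile.summable_inter {φ : E n → ℝ} (hφ : IsProfile φ) {δ : ℝ} (hδ0 : 0 < δ)
    {a : (Fin n → ℤ) → ℂ} (ha : Summable fun ν => ‖a ν‖ ^ 2) {ε : ℝ} (hε0 : 0 ≤ ε)
    (hε : ε ≤ 1 / 4) (t : ℝ) :
    Summable fun p : OffDiag n => a p.1.1 * (starRingEnd ℂ) (a p.1.2) *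
      ∫ z, interIntegrand δ φ ε t (lat p.1.1) (lat p.1.2) z := by
  refine Summable.of_norm_bounded ((summable_offDiag hδ0 ha).mul_left
    (2 ^ ((n : ℝ) + 2 * δ) * ∫ z : E n × E n, |φ z.1| * |φ z.2|)) fun p => ?_
  have h1 := (norm_integral_le_integral_norm _).trans
    (hφ.integral_norm_interIntegrand_le hδ0 hε0 hε t (one_le_norm_lat_sub p.2))
  rw [norm_mul, norm_mul, RCLike.norm_conj]
  calc ‖a p.1.1‖ * ‖a p.1.2‖ * ‖∫ z, interIntegrand δ φ ε t (lat p.1.1) (lat p.1.2) z‖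
      ≤ ‖a p.1.1‖ * ‖a p.1.2‖ * (2 ^ ((n : ℝ) + 2 * δ) *
        (∫ z : E n × E n, |φ z.1| * |φ z.2|) * kern δ (lat p.1.1 - lat p.1.2)) := by gcongr
    _ = _ := by ring

/-- The decomposition of the dispersion into diagonal and off-diagonal parts. -/
theorem IsProfile.integral_total {φ : E n → ℝ} (hφ : IsProfile φ) (hn : 1 ≤ n) {δ : ℝ}
    (hδ0 : 0 < δ) (hδ1 : δ < 1)
    (hW : Integrable fun z : E n × E n => b n δ * ((φ z.1 - φ z.2) ^ 2 * kern δ (z.1 - z.2)))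
    {a : (Fin n → ℤ) → ℂ} (ha : Summable fun ν => ‖a ν‖ ^ 2) (c : ℝ) {ε : ℝ} (hε0 : 0 < ε)
    (hε : ε ≤ 1 / 4) (t : ℝ)
    (hs : Summable fun ν => ‖a ν‖ ^ 2 * packetVar δ φ ((t * ε) • lat ν) (t * ε ^ 2))
    {G : E n → ℂ} (hG : ∀ ξ, G ξ = ∑' ν, packet φ a c ε t ν ξ) :
    Integrable (fun z : E n × E n => b n δ * (‖G z.1 - G z.2‖ ^ 2 * kern δ (z.1 - z.2))) ∧
    ∫ z : E n × E n, b n δ * (‖G z.1 - G z.2‖ ^ 2 * kern δ (z.1 - z.2)) =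
      ε ^ (2 * n) * c ^ 2 * (ε ^ ((n : ℝ) + 2 * δ))⁻¹ *
        (∑' ν, ‖a ν‖ ^ 2 * ((∫ z : E n × E n, b n δ * ((φ z.1 - φ z.2) ^ 2 * kern δ (z.1 - z.2))) +
          packetVar δ φ ((t * ε) • lat ν) (t * ε ^ 2))) -
      2 * b n δ * (ε ^ (2 * n) * c ^ 2 * (interSum δ φ a ε t).re) := by
  have hb := b_pos hn hδ0 hδ1
  set W := ∫ z : E n × E n, b n δ * ((φ z.1 - φ z.2) ^ 2 * kern δ (z.1 - z.2)) with hWdef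
  have hdiag := fun ν => hφ.integral_diagIntegrand hn hδ1 hW a c hε0 t ν
  have hoff := fun p => hφ.integral_offIntegrand hδ0 a c hε0 hε t p
  have hdiag0 : ∀ ν z, 0 ≤ diagIntegrand δ φ a c ε t ν z := fun ν z => by
    have := kern_nonneg δ (z.1 - z.2)
    unfold diagIntegrand; positivity
  have hsum : Summable fun ν => ‖a ν‖ ^ 2 * (W + packetVar δ φ ((t * ε) • lat ν) (t * ε ^ 2)) := by
    simp_rw [mul_add]
    exact (ha.mul_right W).add hs
  have hD : Summable fun ν => ∫ z, ‖diagIntegrand δ φ a c ε t ν z‖ := by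
    simp_rw [Real.norm_of_nonneg (hdiag0 _ _), (hdiag _).2]
    exact hsum.mul_left _
  have hX : Summable fun p => ∫ z, ‖offIntegrand δ φ a c ε t p z‖ :=
    Summable.of_nonneg_of_le (fun p => integral_nonneg fun z => norm_nonneg _)
      (fun p => (hoff p).2.2) ((summable_offDiag hδ0 ha).mul_left _)
  -- Summability of the `L¹` norms permits integrating both series term by term.
  have hDsum := (hasSum_integral_of_summable_integral_norm (fun ν => (hdiag ν).1) hD).tsum_eq
  have hXsum := (hasSum_integral_of_summable_integral_norm (fun p => (hoff p).1) hX).tsum_eq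
  have hpt : ∀ z : E n × E n, (Summable fun ν => diagIntegrand δ φ a c ε t ν z) ∧
      (Summable fun p => offIntegrand δ φ a c ε t p z) ∧ b n δ * (‖G z.1 - G z.2‖ ^ 2 * kern δ (z.1 - z.2)) =
      (∑' ν, diagIntegrand δ φ a c ε t ν z) -
        2 * b n δ * (∑' p, offIntegrand δ φ a c ε t p z).re := by
    intro z
    obtain ⟨i, hi⟩ := hφ.exists_packet_eq_zero hε0 hε a c t z.1
    obtain ⟨j, hj⟩ := hφ.exists_packet_eq_zero hε0 hε a c t z.2
    obtain ⟨S, X, hS, hX, he⟩ := hasSum_diag_sub_offDiag hi hj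
    have h1 : HasSum (fun ν => diagIntegrand δ φ a c ε t ν z)
        (b n δ * (S * kern δ (z.1 - z.2))) := (hS.mul_right _).mul_left _
    have h2 : HasSum (fun p => offIntegrand δ φ a c ε t p z)
        (X * ((kern δ (z.1 - z.2) : ℝ) : ℂ)) := hX.mul_right _
    refine ⟨h1.summable, h2.summable, ?_⟩
    rw [h1.tsum_eq, h2.tsum_eq, hG, hG, he, Complex.re_mul_ofReal]
    ring
  have hDint : Integrable (fun z => ∑' ν, diagIntegrand δ φ a c ε t ν z) :=
    integrable_tsum (fun ν => (hdiag ν).1) hD fun z => (hpt z).1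
  have hXint : Integrable (fun z => ∑' p, offIntegrand δ φ a c ε t p z) :=
    integrable_tsum (fun p => (hoff p).1) hX fun z => (hpt z).2.1
  have hXre : Integrable (fun z => 2 * b n δ * (∑' p, offIntegrand δ φ a c ε t p z).re) :=
    hXint.re.const_mul _
  simp_rw [(hpt _).2.2]
  refine ⟨hDint.sub hXre, ?_⟩
  have hre : ∫ z, (∑' p, offIntegrand δ φ a c ε t p z).re =
      ε ^ (2 * n) * c ^ 2 * (interSum δ φ a ε t).re := by
    have h3 : ∫ z, (∑' p, offIntegrand δ φ a c ε t p z).re =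
        (∫ z, ∑' p, offIntegrand δ φ a c ε t p z).re := integral_re hXint
    rw [h3, ← hXsum, ← Complex.re_ofReal_mul, interSum, ← tsum_mul_left]
    congr 1
    exact tsum_congr fun p => (hoff p).2.1
  rw [integral_sub hDint hXre, integral_const_mul, ← hDsum]
  congr 1
  · simp_rw [(hdiag _).2]
    rw [tsum_mul_left]
  · rw [← hre]

/-! ### Admissible data and normalization. -/

/-- The standing assumptions on the window and on the periodic function. -/
structure IsAdmissible (n : ℕ) (δ : ℝ) (ψ : 𝓢(E n, ℂ)) (F : UnitAddTorus (Fin n) → ℂ) : Prop where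
  one_le : 1 ≤ n
  pos : 0 < δ
  lt_one : δ < 1
  real : ∀ x, (ψ x).im = 0
  symm : ∀ x, ψ (-x) = ψ x
  supp : tsupport (𝓕 ψ : 𝓢(E n, ℂ)) ⊆ Metric.closedBall 0 1
  apply_zero : ψ 0 = 1
  memLp : MemLp F 2 (torusMeasure n)
  norm_eq_one : eLpNorm F 2 (torusMeasure n) = 1

lemma normSq_pos {ψ : 𝓢(E n, ℂ)} (hψ0 : ψ 0 = 1) : 0 < normSq ψ := by
  have hi : Integrable fun x => ‖ψ x‖ ^ 2 := (SchwartzMap.memLp ψ 2 volume).integrable_norm_pow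
    (by norm_num)
  refine lt_of_le_of_ne (integral_nonneg fun x => sq_nonneg _) fun h => ?_
  have h1 := (integral_eq_zero_iff_of_nonneg (fun x => sq_nonneg _) hi).1 h.symm
  have hc : Continuous fun x => ‖ψ x‖ ^ 2 := ψ.continuous.norm.pow 2
  have h2 := (hc.ae_eq_iff_eq (μ := volume) (continuous_const (y := (0 : ℝ)))).1 h1
  have h3 := congrFun h2 0
  simp [hψ0] at h3

lemma normFactor_sq {ψ : 𝓢(E n, ℂ)} (hψ0 : ψ 0 = 1) {ε : ℝ} (hε : 0 < ε) :
    normFactor ψ ε ^ 2 = ε ^ n / normSq ψ := by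
  have := normSq_pos hψ0
  rw [normFactor, inv_pow, Real.sq_sqrt (by positivity)]
  field_simp

lemma hasSum_norm_sq_mFourierCoeff {F : UnitAddTorus (Fin n) → ℂ}
    (hF : MemLp F 2 (torusMeasure n)) (hF1 : eLpNorm F 2 (torusMeasure n) = 1) :
    HasSum (fun ν => ‖UnitAddTorus.mFourierCoeff F ν‖ ^ 2) 1 := by
  have h1 := UnitAddTorus.hasSum_sq_mFourierCoeff (hF.toLp F)
  have hcoef : ∀ ν, UnitAddTorus.mFourierCoeff (hF.toLp F) ν = UnitAddTorus.mFourierCoeff F ν := by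
    intro ν
    refine integral_congr_ae ?_
    filter_upwards [hF.coeFn_toLp] with y hy
    rw [hy]
  simp_rw [hcoef] at h1
  convert! h1 using 1
  have h2 := lintegral_ofReal_norm_sq (hF.toLp F)
  have hi : Integrable (fun y => ‖(hF.toLp F) y‖ ^ 2) (torusMeasure n) :=
    (Lp.memLp (hF.toLp F)).integrable_norm_pow (by norm_num)
  rw [← ofReal_integral_eq_lintegral_ofReal hi (Eventually.of_forall fun x => sq_nonneg _),
    Lp.norm_toLp, hF1] at h2
  have h3 := (ENNReal.ofReal_eq_ofReal_iff (integral_nonneg fun x => sq_nonneg _) (by simp)).1 h2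
  have h4 : (1 : ℝ) = ∫ y, ‖(hF.toLp F) y‖ ^ 2 ∂torusMeasure n := by simpa using h3.symm
  exact h4

/-! ### The off-diagonal part -/

/-- The change of variables that centres each packet at its lattice point; its Jacobian `ε^{2n}`
cancels the prefactor of `hpEps`. -/
lemma hpEpsTerm_eq {δ : ℝ} {ψ : 𝓢(E n, ℂ)} (hψreal : ∀ x, (ψ x).im = 0)
    (hψsymm : ∀ x, ψ (-x) = ψ x) (F : UnitAddTorus (Fin n) → ℂ) {ε : ℝ} (hε : 0 < ε) (t : ℝ)
    (p : OffDiag n) :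
    hpEpsTerm δ ψ F ε t p = ((ε ^ (2 * n) : ℝ) : ℂ) *
      (UnitAddTorus.mFourierCoeff F p.1.1 *
        (starRingEnd ℂ) (UnitAddTorus.mFourierCoeff F p.1.2) *
        ∫ z, interIntegrand δ (profile ψ) ε t (lat p.1.1) (lat p.1.2) z) := by
  rw [hpEpsTerm, integral_affine hε (lat p.1.1, lat p.1.2)]
  have : ∀ z : E n × E n, (𝓕 ψ) (ε⁻¹ • (((lat p.1.1, lat p.1.2) + ε • z).1 - lat p.1.1)) *
      (𝓕 ψ) (ε⁻¹ • (((lat p.1.1, lat p.1.2) + ε • z).2 - lat p.1.2)) *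
      osc t ((lat p.1.1, lat p.1.2) + ε • z).1 ((lat p.1.1, lat p.1.2) + ε • z).2 /
      ((‖((lat p.1.1, lat p.1.2) + ε • z).1 - ((lat p.1.1, lat p.1.2) + ε • z).2‖ ^
        ((n : ℝ) + 2 * δ) : ℝ) : ℂ) =
      interIntegrand δ (profile ψ) ε t (lat p.1.1) (lat p.1.2) z := by
    intro z
    simp only [Prod.fst_add, Prod.snd_add, Prod.smul_fst, Prod.smul_snd, add_sub_cancel_left,
      smul_smul, inv_mul_cancel₀ hε.ne', one_smul, interIntegrand, kern]
    rw [fourier_eq_profile hψreal hψsymm, fourier_eq_profile hψreal hψsymm]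
    push_cast
    rw [div_eq_mul_inv]
    ring
  simp_rw [this]
  rw [Complex.real_smul]
  ring

lemma hpEps_eq {δ : ℝ} {ψ : 𝓢(E n, ℂ)} (hψreal : ∀ x, (ψ x).im = 0)
    (hψsymm : ∀ x, ψ (-x) = ψ x) (F : UnitAddTorus (Fin n) → ℂ) {ε : ℝ} (hε : 0 < ε) (t : ℝ) :
    hpEps δ ψ F ε t = pref δ ψ *
      interSum δ (profile ψ) (UnitAddTorus.mFourierCoeff F) ε t := by
  rw [hpEps, interSum]
  simp_rw [hpEpsTerm_eq hψreal hψsymm F hε]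
  rw [tsum_mul_left, ← mul_assoc, mul_assoc (pref δ ψ), ← Complex.ofReal_mul,
    inv_mul_cancel₀ (by positivity), Complex.ofReal_one, mul_one]

lemma hpTerm_eq (δ : ℝ) (F : UnitAddTorus (Fin n) → ℂ) (t : ℝ) (p : OffDiag n) :
    hpTerm δ F t p = UnitAddTorus.mFourierCoeff F p.1.1 *
      (starRingEnd ℂ) (UnitAddTorus.mFourierCoeff F p.1.2) *
      (osc t (lat p.1.1) (lat p.1.2) * (kern δ (lat p.1.1 - lat p.1.2) : ℝ)) := by
  rw [hpTerm, kern, div_eq_mul_inv]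
  push_cast
  ring

lemma summable_hpTerm {δ : ℝ} (hδ : 0 < δ) {F : UnitAddTorus (Fin n) → ℂ}
    (ha : Summable fun ν => ‖UnitAddTorus.mFourierCoeff F ν‖ ^ 2) (t : ℝ) :
    Summable (hpTerm δ F t) := by
  refine Summable.of_norm_bounded (summable_offDiag hδ ha) fun p => le_of_eq ?_
  rw [hpTerm_eq, norm_mul, norm_mul, RCLike.norm_conj, norm_mul, norm_osc, one_mul,
    Complex.norm_real, Real.norm_of_nonneg (kern_nonneg _ _)]

/-- The variation of the diagonal part. -/
def diagVar (δ : ℝ) (ψ : 𝓢(E n, ℂ)) (F : UnitAddTorus (Fin n) → ℂ) (ε t : ℝ) : ℝ :=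
  ε ^ (-(2 * δ)) / normSq ψ * ∑' ν, ‖UnitAddTorus.mFourierCoeff F ν‖ ^ 2 *
    packetVar δ (profile ψ) ((t * ε) • lat ν) (t * ε ^ 2)

/-- The `|h|^{2δ}` branch of the minimum is used, so the weight `|ν|^{2δ}` on the coefficients
suffices. -/
lemma IsAdmissible.summable_packetVar {δ : ℝ} {ψ : 𝓢(E n, ℂ)} {F : UnitAddTorus (Fin n) → ℂ}
    (H : IsAdmissible n δ ψ F) (hc : CoeffInWeightedL2 F (2 * δ)) (ε t : ℝ) :
    Summable fun ν => ‖UnitAddTorus.mFourierCoeff F ν‖ ^ 2 *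
      packetVar δ (profile ψ) ((t * ε) • lat ν) (t * ε ^ 2) := by
  obtain ⟨C, hC0, hC⟩ := (isProfile_profile H.supp).exists_packetVar_bound H.one_le H.pos H.lt_one
  have ha := (hasSum_norm_sq_mFourierCoeff H.memLp H.norm_eq_one).summable
  refine Summable.of_norm_bounded ((hc.mul_left (C * |t * ε| ^ (2 * δ))).add
    (ha.mul_left (C * (t * ε ^ 2) ^ 2))) fun ν => ?_
  rw [norm_mul, Real.norm_of_nonneg (sq_nonneg _), Real.norm_eq_abs]
  have h1 := (abs_packetVar_le (profile ψ) H.one_le H.pos H.lt_one ((t * ε) • lat ν)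
    (t * ε ^ 2)).trans (hC _ _)
  have h2 : min (‖(t * ε) • lat ν‖ ^ 2) (‖(t * ε) • lat ν‖ ^ (2 * δ)) ≤
      |t * ε| ^ (2 * δ) * ‖lat ν‖ ^ (2 * δ) := by
    refine (min_le_right _ _).trans (le_of_eq ?_)
    rw [norm_smul, Real.mul_rpow (norm_nonneg _) (norm_nonneg _), Real.norm_eq_abs]
  calc ‖UnitAddTorus.mFourierCoeff F ν‖ ^ 2 *
        |packetVar δ (profile ψ) ((t * ε) • lat ν) (t * ε ^ 2)|
      ≤ ‖UnitAddTorus.mFourierCoeff F ν‖ ^ 2 *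
        (C * (|t * ε| ^ (2 * δ) * ‖lat ν‖ ^ (2 * δ) + (t * ε ^ 2) ^ 2)) := by
        gcongr
        exact h1.trans (by gcongr)
    _ = _ := by ring

/-- The dispersion is the leading term, plus the variation of the diagonal part, plus the
off-diagonal part. -/
theorem IsAdmissible.h_eq {δ : ℝ} {ψ : 𝓢(E n, ℂ)} {F : UnitAddTorus (Fin n) → ℂ}
    (H : IsAdmissible n δ ψ F) (hc : CoeffInWeightedL2 F (2 * δ)) {ε : ℝ} (hε0 : 0 < ε)
    (hε : ε ≤ 1 / 4) (t : ℝ) :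
    Integrable (hIntegrand δ (fEps ψ F ε) t) ∧
    (h δ (fEps ψ F ε) t : ℂ) =
      lead δ ψ ε + (diagVar δ ψ F ε t : ℂ) + ((ε ^ n : ℝ) : ℂ) * hpEps δ ψ F ε t := by
  have hφ := isProfile_profile H.supp
  have hN := normSq_pos H.apply_zero
  have hb := b_pos H.one_le H.pos H.lt_one
  obtain ⟨hW, hWe⟩ := dispersion_profile H.one_le H.pos H.lt_one H.real H.symm
  have hsum := hasSum_norm_sq_mFourierCoeff H.memLp H.norm_eq_one
  have hs := H.summable_packetVar hc ε t
  set a := UnitAddTorus.mFourierCoeff F with ha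
  set c := normFactor ψ ε * (ε ^ n)⁻¹ with hcdef
  obtain ⟨hi, he⟩ := hφ.integral_total H.one_le H.pos H.lt_one hW hsum.summable c hε0 hε t hs
    (G := fun ξ => ∑' ν, packet (profile ψ) a c ε t ν ξ) (fun ξ => rfl)
  have hl := lintegral_hIntegrand_fEps H.one_le H.pos H.lt_one H.real H.symm H.supp H.memLp hε0 hε t
    (G := fun ξ => ∑' ν, packet (profile ψ) a c ε t ν ξ) (fun ξ => rfl)
  have h0 : ∀ z : E n × E n, 0 ≤ b n δ * (‖(∑' ν, packet (profile ψ) a c ε t ν z.1) -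
      ∑' ν, packet (profile ψ) a c ε t ν z.2‖ ^ 2 * kern δ (z.1 - z.2)) := fun z => by
    have := kern_nonneg δ (z.1 - z.2)
    positivity
  rw [← ofReal_integral_eq_lintegral_ofReal hi (Eventually.of_forall h0)] at hl
  have hm := (measurable_hIntegrand δ (fEps ψ F ε) t).aestronglyMeasurable (μ := volume)
  have hnn := hIntegrand_nonneg δ (fEps ψ F ε) t
  refine ⟨(lintegral_ofReal_ne_top_iff_integrable hm (Eventually.of_forall hnn)).1
    (by rw [hl]; exact ENNReal.ofReal_ne_top), ?_⟩
  have hh : h δ (fEps ψ F ε) t = _ := Eq.trans (by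
    rw [h, integral_eq_lintegral_of_nonneg_ae (Eventually.of_forall hnn) hm, hl,
      ENNReal.toReal_ofReal (integral_nonneg h0)]) he
  -- The packet amplitude is `c = N_ε⁻¹ ε^{-n}`, so the Jacobian and the normalization combine to
  -- `ε^n / ‖ψ‖²`; on the diagonal the kernel scaling turns this into `ε^{-2δ} / ‖ψ‖²`.
  have hc2 : ε ^ (2 * n) * c ^ 2 = ε ^ n / normSq ψ := by
    rw [hcdef, mul_pow, normFactor_sq H.apply_zero hε0]
    field_simp
    ring
  have hc3 : ε ^ n / normSq ψ * (ε ^ ((n : ℝ) + 2 * δ))⁻¹ = ε ^ (-(2 * δ)) / normSq ψ := by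
    rw [Real.rpow_add hε0, Real.rpow_natCast, Real.rpow_neg hε0.le]
    field_simp
  have hsplit : ∑' ν, ‖a ν‖ ^ 2 * ((∫ x, ‖x‖ ^ (2 * δ) * ‖ψ x‖ ^ 2) +
      packetVar δ (profile ψ) ((t * ε) • lat ν) (t * ε ^ 2)) =
      (∫ x, ‖x‖ ^ (2 * δ) * ‖ψ x‖ ^ 2) +
      ∑' ν, ‖a ν‖ ^ 2 * packetVar δ (profile ψ) ((t * ε) • lat ν) (t * ε ^ 2) := by
    simp_rw [mul_add]
    rw [(hsum.summable.mul_right _).tsum_add hs, tsum_mul_right, hsum.tsum_eq, one_mul]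
  rw [hWe, hc2, hc3, hsplit] at hh
  obtain ⟨r, hr⟩ : ∃ r : ℝ, interSum δ (profile ψ) a ε t = (r : ℂ) :=
    ⟨_, (Complex.conj_eq_iff_re.1
      (Complex.conj_eq_iff_im.2 (interSum_im δ (profile ψ) a ε t))).symm⟩
  rw [hr, Complex.ofReal_re] at hh
  rw [hh, hpEps_eq H.real H.symm F hε0, lead, diagVar, pref, ← ha, hr]
  push_cast
  ring

/-! ### Error terms -/

/-- Convergence along the product with `𝓟 K` encodes uniformity in `t ∈ K`, which makes the
dominated convergence theorems for filters applicable. -/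
lemma IsLittleOLocUnif.of_tendsto {err : ℝ → ℝ → ℂ} {g : ℝ → ℝ} (hg : ∀ ε, 0 < ε → 0 < g ε)
    (h : ∀ K : Set ℝ, IsCompact K →
      Tendsto (fun q : ℝ × ℝ => ((g q.1)⁻¹ : ℝ) * err q.1 q.2) (𝓝[>] 0 ×ˢ 𝓟 K) (𝓝 0)) :
    IsLittleOLocUnif err g := by
  intro K hK c hc
  have h1 := (h K hK).norm.eventually_le_const (u := c) (by simpa using hc)
  rw [eventually_prod_principal_iff] at h1
  filter_upwards [h1, self_mem_nhdsWithin] with ε hε hε0 t ht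
  have h2 := hε t ht
  have h3 := hg ε hε0
  rwa [norm_mul, Complex.norm_real, norm_inv, Real.norm_of_nonneg h3.le,
    inv_mul_le_iff₀ h3, mul_comm] at h2

lemma IsLittleOLocUnif.add {err err' : ℝ → ℝ → ℂ} {g : ℝ → ℝ} (h : IsLittleOLocUnif err g)
    (h' : IsLittleOLocUnif err' g) : IsLittleOLocUnif (fun ε t => err ε t + err' ε t) g := by
  intro K hK c hc
  filter_upwards [h K hK (c / 2) (by positivity), h' K hK (c / 2) (by positivity)]
    with ε h1 h2 t ht
  linarith [norm_add_le (err ε t) (err' ε t), h1 t ht, h2 t ht]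

lemma IsLittleOLocUnif.congr {err err' : ℝ → ℝ → ℂ} {g g' : ℝ → ℝ} (h : IsLittleOLocUnif err g)
    (he : ∀ᶠ ε in 𝓝[>] (0 : ℝ), ∀ t, err' ε t = err ε t)
    (hg : ∀ᶠ ε in 𝓝[>] (0 : ℝ), g ε ≤ g' ε) : IsLittleOLocUnif err' g' := by
  intro K hK c hc
  filter_upwards [h K hK c hc, he, hg] with ε h1 h2 h3 t ht
  rw [h2 t]
  exact (h1 t ht).trans (by gcongr)

lemma IsLittleOLocUnif.mul_left {err : ℝ → ℝ → ℂ} {g m : ℝ → ℝ} (h : IsLittleOLocUnif err g)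
    (hm : ∀ ε, 0 < ε → 0 ≤ m ε) :
    IsLittleOLocUnif (fun ε t => (m ε : ℂ) * err ε t) (fun ε => m ε * g ε) := by
  intro K hK c hc
  filter_upwards [h K hK c hc, self_mem_nhdsWithin] with ε h1 h2 t ht
  rw [norm_mul, Complex.norm_real, Real.norm_of_nonneg (hm ε h2)]
  calc m ε * ‖err ε t‖ ≤ m ε * (c * g ε) := mul_le_mul_of_nonneg_left (h1 t ht) (hm ε h2)
    _ = _ := by ring

lemma eventually_small {c : ℝ} (hc : 0 < c) : ∀ᶠ ε in 𝓝[>] (0 : ℝ), 0 < ε ∧ ε ≤ c :=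
  Ioc_mem_nhdsGT hc

lemma eventually_small_prod {c : ℝ} (hc : 0 < c) {K : Set ℝ} {T : ℝ} (hT : ∀ t ∈ K, ‖t‖ ≤ T) :
    ∀ᶠ q : ℝ × ℝ in 𝓝[>] 0 ×ˢ 𝓟 K, 0 < q.1 ∧ q.1 ≤ c ∧ |q.2| ≤ T := by
  rw [eventually_prod_principal_iff]
  filter_upwards [eventually_small hc] with ε hε t ht
  exact ⟨hε.1, hε.2, hT t ht⟩

/-! ### The off-diagonal part -/

lemma IsProfile.exists_norm_inter_le {φ : E n → ℝ} (hφ : IsProfile φ) {δ : ℝ} (hδ0 : 0 < δ)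
    (a : (Fin n → ℤ) → ℂ) :
    ∃ C, 0 ≤ C ∧ ∀ ε, 0 ≤ ε → ε ≤ 1 / 4 → ∀ t, ∀ p : OffDiag n,
      ‖a p.1.1 * (starRingEnd ℂ) (a p.1.2) *
        ∫ z, interIntegrand δ φ ε t (lat p.1.1) (lat p.1.2) z‖ ≤
      C * (‖a p.1.1‖ * ‖a p.1.2‖ * kern δ (lat p.1.1 - lat p.1.2)) := by
  refine ⟨2 ^ ((n : ℝ) + 2 * δ) * ∫ z : E n × E n, |φ z.1| * |φ z.2|,
    mul_nonneg (by positivity) (integral_nonneg fun z => by positivity),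
    fun ε hε0 hε t p => ?_⟩
  have h1 := (norm_integral_le_integral_norm _).trans
    (hφ.integral_norm_interIntegrand_le hδ0 hε0 hε t (one_le_norm_lat_sub p.2))
  rw [norm_mul, norm_mul, RCLike.norm_conj]
  calc ‖a p.1.1‖ * ‖a p.1.2‖ * ‖∫ z, interIntegrand δ φ ε t (lat p.1.1) (lat p.1.2) z‖
      ≤ ‖a p.1.1‖ * ‖a p.1.2‖ * (2 ^ ((n : ℝ) + 2 * δ) *
        (∫ z : E n × E n, |φ z.1| * |φ z.2|) * kern δ (lat p.1.1 - lat p.1.2)) := by gcongr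
    _ = _ := by ring

/-- Dominated convergence over pairs: `IsProfile.tendsto_inter` gives the limit of each term,
Schur's test the summable majorant. -/
lemma IsProfile.tendsto_interSum {φ : E n → ℝ} (hφ : IsProfile φ) (h1 : ∫ ξ, φ ξ = 1) {δ : ℝ}
    (hδ : 0 < δ) {a : (Fin n → ℤ) → ℂ} (ha : Summable fun ν => ‖a ν‖ ^ 2) {K : Set ℝ}
    (hK : IsCompact K) :
    Tendsto (fun q : ℝ × ℝ => ∑' p : OffDiag n, a p.1.1 * (starRingEnd ℂ) (a p.1.2) *
      ((∫ z, interIntegrand δ φ q.1 q.2 (lat p.1.1) (lat p.1.2) z) -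
        osc q.2 (lat p.1.1) (lat p.1.2) * (kern δ (lat p.1.1 - lat p.1.2) : ℝ)))
      (𝓝[>] 0 ×ˢ 𝓟 K) (𝓝 0) := by
  obtain ⟨T, hT⟩ := hK.isBounded.exists_norm_le
  obtain ⟨C, hC0, hC⟩ := hφ.exists_norm_inter_le hδ a
  have hs := summable_offDiag hδ ha
  rw [← tsum_zero (α := ℂ) (β := OffDiag n)]
  refine tendsto_tsum_of_dominated_convergence (hs.mul_left (C + 1)) (fun p => ?_) ?_
  · simpa using (hφ.tendsto_inter h1 hδ (one_le_norm_lat_sub p.2) hK).const_mul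
      (a p.1.1 * (starRingEnd ℂ) (a p.1.2))
  · filter_upwards [eventually_small_prod (by norm_num : (0 : ℝ) < 1 / 4) hT] with q hq p
    rw [mul_sub, add_mul, one_mul]
    refine (norm_sub_le _ _).trans (add_le_add (hC q.1 hq.1.le hq.2.1 q.2 p) (le_of_eq ?_))
    rw [norm_mul, norm_mul, RCLike.norm_conj, norm_mul, norm_osc, one_mul,
      Complex.norm_real, Real.norm_of_nonneg (kern_nonneg _ _)]

lemma IsAdmissible.hpEps_sub_hp {δ : ℝ} {ψ : 𝓢(E n, ℂ)} {F : UnitAddTorus (Fin n) → ℂ}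
    (H : IsAdmissible n δ ψ F) :
    IsLittleOLocUnif (fun ε t => hpEps δ ψ F ε t - hp δ ψ F t) (fun _ => 1) := by
  have hφ := isProfile_profile H.supp
  have ha := (hasSum_norm_sq_mFourierCoeff H.memLp H.norm_eq_one).summable
  refine IsLittleOLocUnif.of_tendsto (fun _ _ => one_pos) fun K hK => ?_
  obtain ⟨T, hT⟩ := hK.isBounded.exists_norm_le
  have h1 := (hφ.tendsto_interSum (integral_profile H.real H.symm H.apply_zero) H.pos ha
    hK).const_mul (pref δ ψ)
  rw [mul_zero] at h1
  refine h1.congr' ?_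
  filter_upwards [eventually_small_prod (by norm_num : (0 : ℝ) < 1 / 4) hT] with q hq
  have hs := summable_hpTerm H.pos ha q.2
  simp_rw [mul_sub, ← hpTerm_eq]
  rw [(hφ.summable_inter H.pos ha hq.1.le hq.2.1 q.2).tsum_sub hs,
    hpEps_eq H.real H.symm F hq.1, hp, interSum]
  simp only [inv_one, Complex.ofReal_one, one_mul]
  ring

lemma IsAdmissible.summable_hpEpsTerm {δ : ℝ} {ψ : 𝓢(E n, ℂ)} {F : UnitAddTorus (Fin n) → ℂ}
    (H : IsAdmissible n δ ψ F) {ε : ℝ} (hε0 : 0 < ε) (hε : ε ≤ 1 / 4) (t : ℝ) :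
    Summable (hpEpsTerm δ ψ F ε t) := by
  have ha := (hasSum_norm_sq_mFourierCoeff H.memLp H.norm_eq_one).summable
  exact (((isProfile_profile H.supp).summable_inter H.pos ha hε0.le hε t).mul_left
    ((ε ^ (2 * n) : ℝ) : ℂ)).congr fun p => (hpEpsTerm_eq H.real H.symm F hε0 t p).symm

/-- The off-diagonal sum is bounded uniformly in `ε` and `t`, and `ε^n → 0` because `n ≥ 1`. -/
lemma IsAdmissible.pow_mul_hpEps {δ : ℝ} {ψ : 𝓢(E n, ℂ)} {F : UnitAddTorus (Fin n) → ℂ}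
    (H : IsAdmissible n δ ψ F) :
    IsLittleOLocUnif (fun ε t => ((ε ^ n : ℝ) : ℂ) * hpEps δ ψ F ε t) (fun _ => 1) := by
  have hφ := isProfile_profile H.supp
  have ha := (hasSum_norm_sq_mFourierCoeff H.memLp H.norm_eq_one).summable
  obtain ⟨C, hC0, hC⟩ := hφ.exists_norm_inter_le H.pos (UnitAddTorus.mFourierCoeff F)
  have hs := (summable_offDiag H.pos ha).mul_left C
  set S := ‖pref δ ψ‖ * ∑' p : OffDiag n, C * (‖UnitAddTorus.mFourierCoeff F p.1.1‖ *
    ‖UnitAddTorus.mFourierCoeff F p.1.2‖ * kern δ (lat p.1.1 - lat p.1.2)) with hS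
  have hS0 : 0 ≤ S := mul_nonneg (norm_nonneg _) (tsum_nonneg fun p => by
    have := kern_nonneg δ (lat p.1.1 - lat p.1.2); positivity)
  intro K hK c hc
  have hlim : Tendsto (fun ε : ℝ => ε ^ n * S) (𝓝[>] 0) (𝓝 0) := by
    have : Tendsto (fun ε : ℝ => ε ^ n * S) (𝓝 0) (𝓝 (0 ^ n * S)) :=
      (Continuous.tendsto (by fun_prop) 0)
    rw [zero_pow (by have := H.one_le; omega), zero_mul] at this
    exact this.mono_left nhdsWithin_le_nhds
  filter_upwards [hlim.eventually_le_const hc, eventually_small (by norm_num : (0 : ℝ) < 1 / 4)]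
    with ε h1 h2 t ht
  rw [mul_one, norm_mul, Complex.norm_real, Real.norm_of_nonneg (by have := h2.1; positivity)]
  refine le_trans (mul_le_mul_of_nonneg_left ?_ (by have := h2.1; positivity)) h1
  rw [hpEps_eq H.real H.symm F h2.1, norm_mul, hS, interSum]
  exact mul_le_mul_of_nonneg_left
    (tsum_of_norm_bounded hs.hasSum (hC ε h2.1.le h2.2 t)) (norm_nonneg _)

/-! ### The diagonal part -/

/-- Use the square when `X ≤ 1` and the power `q` when `X ≥ 1`. -/
lemma min_sq_rpow_le {X p q : ℝ} (hX : 0 ≤ X) (hp : 0 < p) (hqp : q ≤ p) (hp2 : p ≤ 2) :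
    min (X ^ 2) (X ^ q) ≤ X ^ p := by
  rcases hX.eq_or_lt with rfl | hX0
  · rw [Real.zero_rpow hp.ne']
    exact (min_le_left _ _).trans (by norm_num)
  rcases le_total X 1 with h | h
  · refine (min_le_left _ _).trans ?_
    rw [← Real.rpow_natCast]
    exact Real.rpow_le_rpow_of_exponent_ge hX0 h (by exact_mod_cast hp2)
  · exact (min_le_right _ _).trans (Real.rpow_le_rpow_of_exponent_le h hqp)

lemma tendsto_const_mul_rpow (c : ℝ) {r : ℝ} (hr : 0 < r) (K : Set ℝ) :
    Tendsto (fun q : ℝ × ℝ => c * q.1 ^ r) (𝓝[>] 0 ×ˢ 𝓟 K) (𝓝 0) := by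
  have h1 : Tendsto (fun ε : ℝ => c * ε ^ r) (𝓝 0) (𝓝 (c * 0 ^ r)) :=
    ((Real.continuousAt_rpow_const 0 r (Or.inr hr.le)).tendsto).const_mul c
  rw [Real.zero_rpow hr.ne', mul_zero] at h1
  exact (h1.mono_left nhdsWithin_le_nhds).comp tendsto_fst

/-- Divide by `ε^p` and apply dominated convergence over `ν`. The strict inequality `p < 2` makes
each fixed term vanish in the limit; the weight `|ν|^p` supplies the majorant. -/
lemma IsAdmissible.diagVar_isLittleO {δ : ℝ} {ψ : 𝓢(E n, ℂ)} {F : UnitAddTorus (Fin n) → ℂ}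
    (H : IsAdmissible n δ ψ F) {p : ℝ} (hδp : 2 * δ ≤ p) (hp2 : p < 2)
    (hc : CoeffInWeightedL2 F p) :
    IsLittleOLocUnif (fun ε t => (diagVar δ ψ F ε t : ℂ)) (fun ε => ε ^ (p - 2 * δ)) := by
  obtain ⟨C, hC0, hC⟩ := (isProfile_profile H.supp).exists_packetVar_bound H.one_le H.pos H.lt_one
  have ha := (hasSum_norm_sq_mFourierCoeff H.memLp H.norm_eq_one).summable
  have hδ := H.pos
  have hp0 : 0 < p := by linarith
  refine IsLittleOLocUnif.of_tendsto (fun ε hε => by positivity) fun K hK => ?_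
  obtain ⟨T, hT⟩ := hK.isBounded.exists_norm_le
  set φ := profile ψ with hφ
  have hV : ∀ q : ℝ × ℝ, 0 < q.1 → q.1 ≤ 1 → |q.2| ≤ T → ∀ ν : Fin n → ℤ, ∀ B,
      (min (‖(q.2 * q.1) • lat ν‖ ^ 2) (‖(q.2 * q.1) • lat ν‖ ^ (2 * δ)) : ℝ) ≤ B →
      ‖(q.1 ^ p)⁻¹ * (‖UnitAddTorus.mFourierCoeff F ν‖ ^ 2 *
        packetVar δ φ ((q.2 * q.1) • lat ν) (q.2 * q.1 ^ 2))‖ ≤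
      C * (‖UnitAddTorus.mFourierCoeff F ν‖ ^ 2 * ((q.1 ^ p)⁻¹ * B + T ^ 2 * q.1 ^ (4 - p))) := by
    intro q hq0 hq1 hqT ν B hB
    have h1 := ((abs_packetVar_le φ H.one_le H.pos H.lt_one ((q.2 * q.1) • lat ν)
      (q.2 * q.1 ^ 2)).trans (hC _ _)).trans
      (mul_le_mul_of_nonneg_left (add_le_add_left hB _) hC0)
    have h2 : (q.2 * q.1 ^ 2) ^ 2 ≤ T ^ 2 * q.1 ^ 4 := by
      have : q.2 ^ 2 ≤ T ^ 2 := by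
        rw [← sq_abs]; gcongr
      calc (q.2 * q.1 ^ 2) ^ 2 = q.2 ^ 2 * q.1 ^ 4 := by ring
        _ ≤ _ := by gcongr
    have h3 : (q.1 ^ p)⁻¹ * q.1 ^ 4 = q.1 ^ (4 - p) := by
      rw [Real.rpow_sub hq0]
      norm_cast
      rw [div_eq_inv_mul]
    have hp1 : 0 < (q.1 ^ p)⁻¹ := by positivity
    rw [norm_mul, norm_mul, Real.norm_of_nonneg hp1.le, Real.norm_of_nonneg (sq_nonneg _),
      Real.norm_eq_abs]
    calc (q.1 ^ p)⁻¹ * (‖UnitAddTorus.mFourierCoeff F ν‖ ^ 2 *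
          |packetVar δ φ ((q.2 * q.1) • lat ν) (q.2 * q.1 ^ 2)|)
        ≤ (q.1 ^ p)⁻¹ * (‖UnitAddTorus.mFourierCoeff F ν‖ ^ 2 *
          (C * (B + T ^ 2 * q.1 ^ 4))) := by
          gcongr
          exact h1.trans (by gcongr)
      _ = C * (‖UnitAddTorus.mFourierCoeff F ν‖ ^ 2 *
          ((q.1 ^ p)⁻¹ * B + T ^ 2 * ((q.1 ^ p)⁻¹ * q.1 ^ 4))) := by ring
      _ = _ := by rw [h3]
  have hnorm : ∀ q : ℝ × ℝ, 0 < q.1 → |q.2| ≤ T → ∀ ν : Fin n → ℤ,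
      ‖(q.2 * q.1) • lat ν‖ ≤ T * q.1 * ‖lat ν‖ := by
    intro q hq0 hqT ν
    rw [norm_smul, norm_mul, Real.norm_eq_abs, Real.norm_of_nonneg hq0.le]
    gcongr
  have key : Tendsto (fun q : ℝ × ℝ => ∑' ν, (q.1 ^ p)⁻¹ *
      (‖UnitAddTorus.mFourierCoeff F ν‖ ^ 2 *
        packetVar δ φ ((q.2 * q.1) • lat ν) (q.2 * q.1 ^ 2)))
      (𝓝[>] 0 ×ˢ 𝓟 K) (𝓝 (∑' ν : Fin n → ℤ, (0 : ℝ))) := by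
    refine tendsto_tsum_of_dominated_convergence
      (((hc.mul_left (T ^ p)).add (ha.mul_left (T ^ 2))).mul_left C) (fun ν => ?_) ?_
    -- For fixed `ν` the quadratic branch gives order `ε^{2-p}`, and the dispersive part gives
    -- `ε^{4-p}`.
    · have hlim := ((tendsto_const_mul_rpow (T ^ 2 * ‖lat ν‖ ^ 2) (sub_pos.2 hp2) K).add
        (tendsto_const_mul_rpow (T ^ 2) (by linarith : 0 < 4 - p) K)).const_mul
        (C * ‖UnitAddTorus.mFourierCoeff F ν‖ ^ 2)
      rw [add_zero, mul_zero] at hlim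
      refine squeeze_zero_norm' ?_ hlim
      filter_upwards [eventually_small_prod one_pos hT] with q hq
      refine (hV q hq.1 hq.2.1 hq.2.2 ν ((T * q.1 * ‖lat ν‖) ^ 2)
        ((min_le_left _ _).trans (by have := hnorm q hq.1 hq.2.2 ν; gcongr))).trans (le_of_eq ?_)
      have : q.1 ^ (2 - p) = (q.1 ^ p)⁻¹ * q.1 ^ 2 := by
        rw [Real.rpow_sub hq.1]
        norm_cast
        rw [div_eq_inv_mul]
      rw [this]
      ring
    -- For a bound uniform in `ε`, interpolate the minimum by the power `p`; the factor `ε^p` then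
    -- cancels.
    · filter_upwards [eventually_small_prod one_pos hT] with q hq ν
      have hT0 : 0 ≤ T := (abs_nonneg _).trans hq.2.2
      refine (hV q hq.1 hq.2.1 hq.2.2 ν ((T * q.1 * ‖lat ν‖) ^ p)
        ((min_sq_rpow_le (norm_nonneg _) hp0 hδp hp2.le).trans
          (Real.rpow_le_rpow (norm_nonneg _) (hnorm q hq.1 hq.2.2 ν) hp0.le))).trans ?_
      have hq0 := hq.1
      rw [Real.mul_rpow (by positivity) (norm_nonneg _), Real.mul_rpow hT0 hq0.le]
      have h1 : q.1 ^ (4 - p) ≤ 1 := Real.rpow_le_one hq0.le hq.2.1 (by linarith)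
      have h2 : (q.1 ^ p)⁻¹ * (T ^ p * q.1 ^ p * ‖lat ν‖ ^ p) = T ^ p * ‖lat ν‖ ^ p := by
        have : q.1 ^ p ≠ 0 := by positivity
        field_simp
      rw [h2]
      calc C * (‖UnitAddTorus.mFourierCoeff F ν‖ ^ 2 *
            (T ^ p * ‖lat ν‖ ^ p + T ^ 2 * q.1 ^ (4 - p)))
          ≤ C * (‖UnitAddTorus.mFourierCoeff F ν‖ ^ 2 *
            (T ^ p * ‖lat ν‖ ^ p + T ^ 2 * 1)) := by gcongr
        _ = _ := by ring
  rw [tsum_zero] at key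
  have h5 := (Complex.continuous_ofReal.tendsto 0).comp (key.const_mul (normSq ψ)⁻¹ |>.trans
    (by rw [mul_zero]))
  rw [Complex.ofReal_zero] at h5
  refine h5.congr' ?_
  filter_upwards [eventually_small_prod one_pos hT] with q hq
  have hq0 := hq.1
  simp only [Function.comp_apply]
  rw [diagVar, tsum_mul_left, ← Complex.ofReal_mul, Complex.ofReal_inj]
  have h6 : (q.1 ^ (p - 2 * δ))⁻¹ * q.1 ^ (-(2 * δ)) = (q.1 ^ p)⁻¹ := by
    rw [← Real.rpow_neg hq0.le, ← Real.rpow_neg hq0.le, ← Real.rpow_add hq0]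
    congr 1; ring
  rw [← h6]
  ring

lemma CoeffInWeightedL2.mono {F : UnitAddTorus (Fin n) → ℂ} {r s : ℝ} (hr : 0 < r) (hrs : r ≤ s)
    (h : CoeffInWeightedL2 F s) : CoeffInWeightedL2 F r := by
  refine Summable.of_nonneg_of_le (fun ν => by positivity) (fun ν => ?_) h
  refine mul_le_mul_of_nonneg_right ?_ (sq_nonneg _)
  -- At the origin the smaller weight vanishes because `r > 0`; nonzero lattice points have norm at
  -- least `1`.
  rcases eq_or_ne ν 0 with rfl | hν
  · rw [lat_zero, norm_zero, Real.zero_rpow hr.ne']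
    positivity
  · exact Real.rpow_le_rpow_of_exponent_le (one_le_norm_lat hν) hrs

/-! ### The leading behaviour and dimension one -/

theorem IsAdmissible.h_sub_lead {δ : ℝ} {ψ : 𝓢(E n, ℂ)} {F : UnitAddTorus (Fin n) → ℂ}
    (H : IsAdmissible n δ ψ F) (hc : CoeffInWeightedL2 F (2 * δ)) :
    IsLittleOLocUnif (fun ε t => (h δ (fEps ψ F ε) t : ℂ) - lead δ ψ ε) (fun _ => 1) := by
  have h1 := H.diagVar_isLittleO le_rfl (by linarith [H.lt_one]) hc
  simp only [sub_self, Real.rpow_zero] at h1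
  refine (h1.add H.pow_mul_hpEps).congr ?_ (Eventually.of_forall fun _ => le_rfl)
  filter_upwards [eventually_small (by norm_num : (0 : ℝ) < 1 / 4)] with ε hε t
  rw [(H.h_eq hc hε.1 hε.2 t).2]
  ring

theorem IsAdmissible.h_sub_lead_sub_hp {δ : ℝ} {ψ : 𝓢(E 1, ℂ)} {F : UnitAddTorus (Fin 1) → ℂ}
    (H : IsAdmissible 1 δ ψ F) (hδ : δ < 1 / 2) (hc : CoeffInWeightedL2 F (1 + 2 * δ)) :
    IsLittleOLocUnif
      (fun ε t => (h δ (fEps ψ F ε) t : ℂ) - (lead δ ψ ε + (ε : ℂ) * hp δ ψ F t))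
      (fun ε => ε) := by
  have h0 := H.pos
  -- Here `p = 1 + 2δ`, and the requirement `p < 2` is exactly `δ < 1/2`.
  have h1 := H.diagVar_isLittleO (by linarith) (by linarith) hc
  simp only [add_sub_cancel_right, Real.rpow_one] at h1
  have h2 := H.hpEps_sub_hp.mul_left (m := fun ε => ε) (fun ε hε => hε.le)
  simp only [mul_one] at h2
  refine (h1.add h2).congr ?_ (Eventually.of_forall fun _ => le_rfl)
  filter_upwards [eventually_small (by norm_num : (0 : ℝ) < 1 / 4)] with ε hε t
  rw [(H.h_eq (hc.mono (by linarith) (by linarith)) hε.1 hε.2 t).2]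
  push_cast
  ring

/-! ### The frequency projection -/

/-- A Schwartz kernel whose Fourier transform is a cutoff. -/
structure IsProjKernel (χ : ℝ → ℝ) (k : ℝ → ℂ) : Prop where
  continuous : Continuous k
  integrable : Integrable fun s => (1 + s ^ 2) * ‖k s‖
  fourier_eq : ∀ τ, 𝓕 k τ = χ τ

/-- The inverse transform of a test function is Schwartz, hence integrable against `1 + s²`, the
growth in time allowed for a packet variation. -/
lemma IsCutoff.isProjKernel {χ : ℝ → ℝ} (hχ : IsCutoff χ) :
    IsProjKernel χ (𝓕⁻ (fun τ : ℝ => (χ τ : ℂ))) := by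
  have hs : HasCompactSupport (fun τ : ℝ => (χ τ : ℂ)) :=
    hχ.compactSupport.comp_left (g := fun x : ℝ => (x : ℂ)) Complex.ofReal_zero
  have hd : ContDiff ℝ ∞ (fun τ : ℝ => (χ τ : ℂ)) := Complex.ofRealCLM.contDiff.comp hχ.smooth
  set X : 𝓢(ℝ, ℂ) := hs.toSchwartzMap hd with hX
  have hXc : (X : ℝ → ℂ) = fun τ : ℝ => (χ τ : ℂ) := rfl
  have hk : 𝓕⁻ (fun τ : ℝ => (χ τ : ℂ)) = ((𝓕⁻ X : 𝓢(ℝ, ℂ)) : ℝ → ℂ) := by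
    rw [SchwartzMap.fourierInv_coe, hXc]
  rw [hk]
  refine ⟨(𝓕⁻ X).continuous, ?_, fun τ => ?_⟩
  · refine (((𝓕⁻ X).integrable_pow_mul volume 0).add
      ((𝓕⁻ X).integrable_pow_mul volume 2)).congr (Eventually.of_forall fun s => ?_)
    simp only [Pi.add_apply, pow_zero, one_mul, Real.norm_eq_abs, sq_abs]
    ring
  · rw [← SchwartzMap.fourier_coe, FourierTransform.fourier_fourierInv_eq]
    rfl

lemma one_add_sub_sq_le (t s : ℝ) : 1 + (t - s) ^ 2 ≤ 2 * (1 + t ^ 2) * (1 + s ^ 2) := by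
  nlinarith [sq_nonneg (t + s), sq_nonneg (t * s)]

namespace IsProjKernel

variable {χ : ℝ → ℝ} {k : ℝ → ℂ}

lemma integrable_kernel (hk : IsProjKernel χ k) : Integrable k :=
  hk.integrable.mono' hk.continuous.aestronglyMeasurable (Eventually.of_forall fun s => by
    nlinarith [norm_nonneg (k s), mul_nonneg (sq_nonneg s) (norm_nonneg (k s))])

lemma norm_mul_le {g : ℝ → ℝ} {C : ℝ} (hg : ∀ t, |g t| ≤ C * (1 + t ^ 2)) (t s : ℝ) :
    ‖k s * (g (t - s) : ℂ)‖ ≤ C * (2 * (1 + t ^ 2)) * ((1 + s ^ 2) * ‖k s‖) := by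
  have hC : 0 ≤ C := by have := (abs_nonneg _).trans (hg 0); linarith
  rw [norm_mul, Complex.norm_real, Real.norm_eq_abs]
  calc ‖k s‖ * |g (t - s)| ≤ ‖k s‖ * (C * (2 * (1 + t ^ 2) * (1 + s ^ 2))) := by
        gcongr
        exact (hg _).trans (mul_le_mul_of_nonneg_left (one_add_sub_sq_le t s) hC)
    _ = _ := by ring

lemma integrable_mul (hk : IsProjKernel χ k) {g : ℝ → ℝ} (hm : Measurable g) {C : ℝ}
    (hg : ∀ t, |g t| ≤ C * (1 + t ^ 2)) (t : ℝ) : Integrable fun s => k s * (g (t - s) : ℂ) := by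
  have hkm := hk.continuous.measurable
  refine (hk.integrable.const_mul (C * (2 * (1 + t ^ 2)))).mono'
    (Measurable.aestronglyMeasurable (by fun_prop))
    (Eventually.of_forall fun s => norm_mul_le hg t s)

lemma integral_norm_mul_le (hk : IsProjKernel χ k) {g : ℝ → ℝ} (hm : Measurable g) {C : ℝ}
    (hg : ∀ t, |g t| ≤ C * (1 + t ^ 2)) (t : ℝ) :
    ∫ s, ‖k s * (g (t - s) : ℂ)‖ ≤
      C * (2 * (1 + t ^ 2)) * ∫ s, (1 + s ^ 2) * ‖k s‖ := by
  rw [← integral_const_mul]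
  exact integral_mono (hk.integrable_mul hm hg t).norm (hk.integrable.const_mul _)
    fun s => norm_mul_le hg t s

/-- Pure exponentials are eigenfunctions of convolution with `k`, with eigenvalue the symbol. -/
lemma integral_mul_exp (hk : IsProjKernel χ k) (τ t : ℝ) :
    ∫ s, k s * Complex.exp (((2 * Real.pi * τ * (t - s) : ℝ) : ℂ) * Complex.I) =
      χ τ * Complex.exp (((2 * Real.pi * τ * t : ℝ) : ℂ) * Complex.I) := by
  rw [← hk.fourier_eq τ, Real.fourier_real_eq_integral_exp_smul, ← integral_mul_const]
  refine integral_congr_ae (Eventually.of_forall fun s => ?_)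
  simp only [smul_eq_mul]
  rw [mul_right_comm (Complex.exp _) (k s), ← Complex.exp_add, mul_comm (k s)]
  congr 2
  push_cast; ring

lemma integral_eq_one (hk : IsProjKernel χ k) (hχ : IsCutoff χ) : ∫ s, k s = 1 := by
  have := hk.integral_mul_exp 0 0
  rw [hχ.eq_one 0 (by norm_num)] at this
  simpa using this

/-- The frequencies `0` and `±τ` all lie where `χ = 1`. -/
lemma integral_mul_one_sub_cos (hk : IsProjKernel χ k) (hχ : IsCutoff χ) {τ : ℝ}
    (hτ : |τ| ≤ 1 / 4) (t : ℝ) :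
    ∫ s, k s * ((1 - Real.cos (2 * Real.pi * τ * (t - s)) : ℝ) : ℂ) =
      ((1 - Real.cos (2 * Real.pi * τ * t) : ℝ) : ℂ) := by
  have h1 := hk.integral_mul_exp τ t
  have h2 := hk.integral_mul_exp (-τ) t
  rw [hχ.eq_one _ hτ] at h1
  rw [hχ.eq_one _ (by rwa [abs_neg])] at h2
  have hi : ∀ τ' : ℝ, Integrable fun s =>
      k s * Complex.exp (((2 * Real.pi * τ' * (t - s) : ℝ) : ℂ) * Complex.I) := fun τ' => by
    refine hk.integrable_kernel.norm.mono' (Continuous.aestronglyMeasurable (by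
      have := hk.continuous; fun_prop)) (Eventually.of_forall fun s => ?_)
    rw [norm_mul, Complex.norm_exp_ofReal_mul_I, mul_one]
  have hcos : ∀ x : ℝ, ((1 - Real.cos x : ℝ) : ℂ) = 1 - (Complex.exp ((x : ℂ) * Complex.I) +
      Complex.exp (((-x : ℝ) : ℂ) * Complex.I)) / 2 := fun x => by
    rw [Complex.ofReal_sub, Complex.ofReal_cos, Complex.cos, Complex.ofReal_neg]
    simp
  have he : ∀ s, k s * ((1 - Real.cos (2 * Real.pi * τ * (t - s)) : ℝ) : ℂ) = k s -
      (k s * Complex.exp (((2 * Real.pi * τ * (t - s) : ℝ) : ℂ) * Complex.I) +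
      k s * Complex.exp (((2 * Real.pi * (-τ) * (t - s) : ℝ) : ℂ) * Complex.I)) / 2 := fun s => by
    rw [hcos, show -(2 * Real.pi * τ * (t - s)) = 2 * Real.pi * (-τ) * (t - s) by ring]
    ring
  simp_rw [he]
  have hi2 := ((hi τ).add (hi (-τ))).div_const 2
  simp only [Pi.add_apply] at hi2
  rw [integral_sub hk.integrable_kernel hi2, integral_div,
    integral_add (hi τ) (hi (-τ)), h1, h2, hk.integral_eq_one hχ, hcos,
    show -(2 * Real.pi * τ * t) = 2 * Real.pi * (-τ) * t by ring]
  push_cast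
  ring

end IsProjKernel

/-! ### The projection of a packet -/

/-- Half the frequency difference of two modes of the packet at `v`. -/
def omega (v : E n) (ε : ℝ) (z : E n × E n) : ℝ :=
  ε * ⟪v, z.1 - z.2⟫ + ε ^ 2 * (‖z.1‖ ^ 2 - ‖z.2‖ ^ 2) / 2

lemma theta_smul (v : E n) (ε t : ℝ) (z : E n × E n) :
    theta ((t * ε) • v) (t * ε ^ 2) z = 2 * Real.pi * omega v ε z * t := by
  rw [theta, omega, real_inner_smul_left]; ring

/-- The threshold `1/16` comes from here: differences in the unit ball have length at most `2`, so
the linear part is at most `1/8`, and the quadratic part is at most `1/16`. -/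
lemma abs_omega_le {v : E n} {ε : ℝ} (hε0 : 0 ≤ ε) (hε : ε ≤ 1 / 4) (hv : ε * ‖v‖ ≤ 1 / 16)
    {z : E n × E n} (h1 : ‖z.1‖ ≤ 1) (h2 : ‖z.2‖ ≤ 1) : |omega v ε z| ≤ 1 / 4 := by
  have h3 : |ε * ⟪v, z.1 - z.2⟫| ≤ 1 / 8 := by
    rw [abs_mul, abs_of_nonneg hε0]
    have h4 := abs_real_inner_le_norm v (z.1 - z.2)
    have h5 := norm_sub_le z.1 z.2
    calc ε * |⟪v, z.1 - z.2⟫| ≤ ε * (‖v‖ * 2) := by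
          gcongr
          exact h4.trans (by gcongr; linarith)
      _ ≤ _ := by linarith
  have h6 : |ε ^ 2 * (‖z.1‖ ^ 2 - ‖z.2‖ ^ 2) / 2| ≤ 1 / 16 := by
    have h7 : |‖z.1‖ ^ 2 - ‖z.2‖ ^ 2| ≤ 1 := by
      rw [abs_le]
      constructor <;> nlinarith [norm_nonneg z.1, norm_nonneg z.2]
    rw [abs_div, abs_mul, abs_of_nonneg (sq_nonneg ε), abs_two]
    have : ε ^ 2 ≤ 1 / 16 := by nlinarith
    have : ε ^ 2 * |‖z.1‖ ^ 2 - ‖z.2‖ ^ 2| ≤ 1 / 16 * 1 := by gcongr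
    linarith
  exact (abs_add_le _ _).trans (by linarith)

/-- The factor `‖z.1 - z.2‖²` cancels enough of the kernel singularity for Fubini in time and
frequency. -/
lemma sq_omega_le (v : E n) (ε : ℝ) {z : E n × E n} (h1 : ‖z.1‖ ≤ 1) (h2 : ‖z.2‖ ≤ 1) :
    omega v ε z ^ 2 ≤ (2 * ε ^ 2 * ‖v‖ ^ 2 + 2 * ε ^ 4) * ‖z.1 - z.2‖ ^ 2 := by
  have h3 : ⟪v, z.1 - z.2⟫ ^ 2 ≤ ‖v‖ ^ 2 * ‖z.1 - z.2‖ ^ 2 := by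
    rw [← sq_abs, ← mul_pow]
    exact pow_le_pow_left₀ (abs_nonneg _) (abs_real_inner_le_norm _ _) 2
  have h4 := sq_norm_sub_sq_le h1 h2
  set A := ⟪v, z.1 - z.2⟫
  set B := ‖z.1‖ ^ 2 - ‖z.2‖ ^ 2
  calc omega v ε z ^ 2 ≤ 2 * (ε ^ 2 * A ^ 2) + ε ^ 4 * B ^ 2 / 2 := by
        rw [omega]
        nlinarith [sq_nonneg (ε * A - ε ^ 2 * B / 2)]
    _ ≤ 2 * (ε ^ 2 * (‖v‖ ^ 2 * ‖z.1 - z.2‖ ^ 2)) + ε ^ 4 * (4 * ‖z.1 - z.2‖ ^ 2) / 2 := by gcongr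
    _ = _ := by ring

lemma measurable_varIntegrand_uncurry {φ : E n → ℝ} (hφ : IsProfile φ) (δ : ℝ) (v : E n) (ε t : ℝ) :
    Measurable fun q : ℝ × (E n × E n) =>
      varIntegrand δ φ (((t - q.1) * ε) • v) ((t - q.1) * ε ^ 2) q.2 := by
  have hk := measurable_kern (n := n) δ
  have hc := hφ.cont.measurable
  unfold varIntegrand theta
  fun_prop

lemma IsProfile.measurable_packetVar {φ : E n → ℝ} (hφ : IsProfile φ) (δ : ℝ) (v : E n) (ε : ℝ) :
    Measurable fun t : ℝ => packetVar δ φ ((t * ε) • v) (t * ε ^ 2) := by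
  have h1 := (measurable_varIntegrand_uncurry hφ δ v ε 0).stronglyMeasurable.integral_prod_right'
    (ν := (volume : Measure (E n × E n)))
  have h2 := (h1.measurable.comp measurable_neg).const_mul (2 * b n δ)
  simpa only [Function.comp_def, zero_sub, neg_neg] using! h2

/-- By Fubini, the projection acts on each cosine mode under the frequency integral. On the support
of the profiles every mode has frequency at most `1/4` and is fixed. -/
lemma IsProfile.proj_packetVar {φ : E n → ℝ} (hφ : IsProfile φ) (hn : 1 ≤ n) {δ : ℝ}
    (hδ1 : δ < 1) {χ : ℝ → ℝ} (hχ : IsCutoff χ) {k : ℝ → ℂ}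
    (hk : IsProjKernel χ k) {v : E n} {ε : ℝ} (hε0 : 0 ≤ ε) (hε : ε ≤ 1 / 4)
    (hv : ε * ‖v‖ ≤ 1 / 16) (t : ℝ) :
    ∫ s, k s * (packetVar δ φ (((t - s) * ε) • v) ((t - s) * ε ^ 2) : ℂ) =
      packetVar δ φ ((t * ε) • v) (t * ε ^ 2) := by
  have hkm := hk.continuous.measurable
  -- Collects `1 - cos x ≤ x²/2`, the bound for `omega²`, and `(t - s)² ≤ 2(1 + t²)(1 + s²)`.
  set B := (2 * Real.pi) ^ 2 / 2 * (2 * ε ^ 2 * ‖v‖ ^ 2 + 2 * ε ^ 4) * (2 * (1 + t ^ 2)) with hB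
  have hint : Integrable (fun q : ℝ × (E n × E n) => k q.1 *
      (varIntegrand δ φ (((t - q.1) * ε) • v) ((t - q.1) * ε ^ 2) q.2 : ℂ))
      ((volume : Measure ℝ).prod volume) := by
    refine ((hk.integrable.mul_prod (hφ.integrable_sq_kern hn hδ1)).const_mul B).mono'
      ((hkm.comp measurable_fst).mul
        (Complex.measurable_ofReal.comp
          (measurable_varIntegrand_uncurry hφ δ v ε t))).aestronglyMeasurable
      (Eventually.of_forall fun q => ?_)
    obtain ⟨s, z⟩ := q
    simp only
    have hk0 := kern_nonneg δ (z.1 - z.2)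
    rw [norm_mul, Complex.norm_real, varIntegrand, Real.norm_eq_abs, abs_mul, abs_mul,
      abs_of_nonneg (mul_nonneg (one_sub_cos_nonneg _) hk0)]
    rcases eq_or_ne (φ z.1) 0 with h1 | h1
    · simp [h1]
    rcases eq_or_ne (φ z.2) 0 with h2 | h2
    · simp [h2]
    have h3 : 1 - Real.cos (theta (((t - s) * ε) • v) ((t - s) * ε ^ 2) z) ≤
        B * (1 + s ^ 2) * ‖z.1 - z.2‖ ^ 2 := by
      rw [theta_smul]
      refine (one_sub_cos_le _).trans ?_
      have h4 := sq_omega_le v ε (hφ.norm_le h1) (hφ.norm_le h2)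
      have h5 : (t - s) ^ 2 ≤ 2 * (1 + t ^ 2) * (1 + s ^ 2) :=
        le_trans (by linarith) (one_add_sub_sq_le t s)
      calc (2 * Real.pi * omega v ε z * (t - s)) ^ 2 / 2
          = (2 * Real.pi) ^ 2 / 2 * (omega v ε z ^ 2 * (t - s) ^ 2) := by ring
        _ ≤ (2 * Real.pi) ^ 2 / 2 * ((2 * ε ^ 2 * ‖v‖ ^ 2 + 2 * ε ^ 4) * ‖z.1 - z.2‖ ^ 2 *
            (2 * (1 + t ^ 2) * (1 + s ^ 2))) := by gcongr
        _ = _ := by rw [hB]; ring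
    calc ‖k s‖ * (|φ z.1| * |φ z.2| *
          ((1 - Real.cos (theta (((t - s) * ε) • v) ((t - s) * ε ^ 2) z)) * kern δ (z.1 - z.2)))
        ≤ ‖k s‖ * (|φ z.1| * |φ z.2| *
          ((B * (1 + s ^ 2) * ‖z.1 - z.2‖ ^ 2) * kern δ (z.1 - z.2))) := by gcongr
      _ = _ := by ring
  have hpv : ∀ (h : E n) (s : ℝ), (packetVar δ φ h s : ℂ) =
      (2 * b n δ : ℝ) * ∫ z, (varIntegrand δ φ h s z : ℂ) := fun h s => by
    rw [packetVar, integral_complex_ofReal, Complex.ofReal_mul]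
  simp_rw [hpv]
  calc ∫ s, k s * (((2 * b n δ : ℝ) : ℂ) *
        ∫ z, (varIntegrand δ φ (((t - s) * ε) • v) ((t - s) * ε ^ 2) z : ℂ))
      = ((2 * b n δ : ℝ) : ℂ) * ∫ s, ∫ z, k s *
        (varIntegrand δ φ (((t - s) * ε) • v) ((t - s) * ε ^ 2) z : ℂ) := by
        rw [← integral_const_mul]
        refine integral_congr_ae (Eventually.of_forall fun s => ?_)
        simp only
        rw [integral_const_mul]; ring
    _ = ((2 * b n δ : ℝ) : ℂ) * ∫ z, ∫ s, k s *
        (varIntegrand δ φ (((t - s) * ε) • v) ((t - s) * ε ^ 2) z : ℂ) := by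
        rw [integral_integral_swap hint]
    _ = _ := by
        congr 1
        refine integral_congr_ae (Eventually.of_forall fun z => ?_)
        simp only [varIntegrand, theta_smul]
        rcases eq_or_ne (φ z.1) 0 with h1 | h1
        · simp [h1]
        rcases eq_or_ne (φ z.2) 0 with h2 | h2
        · simp [h2]
        have h3 := hk.integral_mul_one_sub_cos hχ
          (abs_omega_le hε0 hε hv (hφ.norm_le h1) (hφ.norm_le h2)) t
        calc ∫ s, k s * ((φ z.1 * φ z.2 * ((1 - Real.cos (2 * Real.pi * omega v ε z * (t - s))) *
              kern δ (z.1 - z.2)) : ℝ) : ℂ)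
            = ∫ s, ((φ z.1 * φ z.2 * kern δ (z.1 - z.2) : ℝ) : ℂ) *
              (k s * ((1 - Real.cos (2 * Real.pi * omega v ε z * (t - s)) : ℝ) : ℂ)) := by
              refine integral_congr_ae (Eventually.of_forall fun s => ?_)
              simp only
              push_cast; ring
          _ = _ := by
              rw [integral_const_mul, h3]
              push_cast; ring

/-! ### The projection of the background -/

lemma abs_rpow_le_one_add_sq (t : ℝ) {q : ℝ} (hq0 : 0 ≤ q) (hq2 : q ≤ 2) :
    |t| ^ q ≤ 1 + t ^ 2 := by
  rcases le_total |t| 1 with h | h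
  · exact (Real.rpow_le_one (abs_nonneg t) h hq0).trans (by linarith [sq_nonneg t])
  · refine (Real.rpow_le_rpow_of_exponent_le h hq2).trans ?_
    rw [Real.rpow_two, sq_abs]
    linarith

/-- Again from the `|h|^{2δ}` branch; since `2δ ≤ 2`, the growth in `t` is at most quadratic and is
absorbed by the projection kernel. -/
lemma IsProfile.exists_packetVar_growth {φ : E n → ℝ} (hφ : IsProfile φ) (hn : 1 ≤ n) {δ : ℝ}
    (hδ0 : 0 < δ) (hδ1 : δ < 1) :
    ∃ C, 0 ≤ C ∧ ∀ (v : E n) (ε : ℝ), 0 ≤ ε → ∀ t : ℝ,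
      |packetVar δ φ ((t * ε) • v) (t * ε ^ 2)| ≤
        C * ((ε * ‖v‖) ^ (2 * δ) + ε ^ 4) * (1 + t ^ 2) := by
  obtain ⟨C, hC0, hC⟩ := hφ.exists_packetVar_bound hn hδ0 hδ1
  refine ⟨C, hC0, fun v ε hε t => ?_⟩
  refine ((abs_packetVar_le φ hn hδ0 hδ1 _ _).trans (hC _ _)).trans ?_
  rw [mul_assoc]
  refine mul_le_mul_of_nonneg_left ?_ hC0
  have h1 : min (‖(t * ε) • v‖ ^ 2) (‖(t * ε) • v‖ ^ (2 * δ)) ≤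
      (1 + t ^ 2) * (ε * ‖v‖) ^ (2 * δ) := by
    refine (min_le_right _ _).trans ?_
    rw [norm_smul, Real.norm_eq_abs, abs_mul, abs_of_nonneg hε, mul_assoc,
      Real.mul_rpow (abs_nonneg _) (by positivity)]
    gcongr
    exact abs_rpow_le_one_add_sq t (by linarith) (by linarith)
  have h2 : (t * ε ^ 2) ^ 2 ≤ (1 + t ^ 2) * ε ^ 4 := by
    have : 0 ≤ ε ^ 4 := by positivity
    calc (t * ε ^ 2) ^ 2 = t ^ 2 * ε ^ 4 := by ring
      _ ≤ _ := by gcongr; linarith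
  linarith

/-- The high-frequency tail of the weighted norm of the coefficients. -/
def tail (δ : ℝ) (F : UnitAddTorus (Fin n) → ℂ) (ε : ℝ) (ν : Fin n → ℤ) : ℝ :=
  if ε * ‖lat ν‖ ≤ 1 / 16 then 0 else
    ‖lat ν‖ ^ ((n : ℝ) + 2 * δ) * ‖UnitAddTorus.mFourierCoeff F ν‖ ^ 2

lemma tail_nonneg (δ : ℝ) (F : UnitAddTorus (Fin n) → ℂ) (ε : ℝ) (ν : Fin n → ℤ) :
    0 ≤ tail δ F ε ν := by
  unfold tail; split_ifs <;> positivity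

lemma tail_le (δ : ℝ) (F : UnitAddTorus (Fin n) → ℂ) (ε : ℝ) (ν : Fin n → ℤ) :
    tail δ F ε ν ≤ ‖lat ν‖ ^ ((n : ℝ) + 2 * δ) * ‖UnitAddTorus.mFourierCoeff F ν‖ ^ 2 := by
  unfold tail; split_ifs <;> first | positivity | rfl

/-- Each fixed `ν` leaves the tail once `ε|ν| ≤ 1/16`, and the full weighted series dominates. -/
lemma tendsto_tsum_tail {δ : ℝ} {F : UnitAddTorus (Fin n) → ℂ}
    (hc : CoeffInWeightedL2 F ((n : ℝ) + 2 * δ)) :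
    Tendsto (fun ε => ∑' ν, tail δ F ε ν) (𝓝[>] 0) (𝓝 0) := by
  suffices Tendsto (fun ε => ∑' ν, tail δ F ε ν) (𝓝[>] 0) (𝓝 (∑' _ : Fin n → ℤ, (0 : ℝ))) by
    rwa [tsum_zero] at this
  refine tendsto_tsum_of_dominated_convergence hc (fun ν => ?_)
    (Eventually.of_forall fun ε ν => ?_)
  · refine tendsto_const_nhds.congr' ?_
    have h1 : Tendsto (fun ε : ℝ => ε * ‖lat ν‖) (𝓝[>] 0) (𝓝 0) := by
      have : Tendsto (fun ε : ℝ => ε * ‖lat ν‖) (𝓝 0) (𝓝 (0 * ‖lat ν‖)) :=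
        Continuous.tendsto (by fun_prop) 0
      rw [zero_mul] at this
      exact this.mono_left nhdsWithin_le_nhds
    filter_upwards [h1.eventually_le_const (by norm_num : (0 : ℝ) < 1 / 16)] with ε hε
    rw [tail, if_pos hε]
  · rw [Real.norm_of_nonneg (tail_nonneg δ F ε ν)]
    exact tail_le δ F ε ν

/-- On the tail `16εX > 1`, so multiplying by `(16εX)^n` only increases the bound and yields the
gain `ε^n` at the price of the weight `X^{n+2δ}`. The term `ε⁴ ≤ (1/16)²` is absorbed into
`(εX)^{2δ}`. -/
lemma tail_weight_le {δ ε X : ℝ} (hδ0 : 0 < δ) (hδ1 : δ < 1) (hε0 : 0 < ε) (hε : ε ≤ 1 / 4) (hX0 : 0 ≤ X)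
    (hX : 1 / 16 < ε * X) :
    (ε * X) ^ (2 * δ) + ε ^ 4 ≤ 2 * 16 ^ n * (ε ^ n * ε ^ (2 * δ) * X ^ ((n : ℝ) + 2 * δ)) := by
  set Y := ε * X with hY
  have hY0 : 0 < Y := by linarith
  have h1 : ε ^ 4 ≤ Y ^ (2 * δ) := by
    have h2 : ε ^ 4 ≤ (1 / 16 : ℝ) ^ (2 : ℝ) := by
      rw [Real.rpow_two]
      calc ε ^ 4 ≤ (1 / 4) ^ 4 := by gcongr
        _ = _ := by norm_num
    rcases le_total Y 1 with h | h
    · refine h2.trans (le_trans ?_ (Real.rpow_le_rpow_of_exponent_ge hY0 h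
        (by linarith : 2 * δ ≤ 2)))
      exact Real.rpow_le_rpow (by norm_num) hX.le (by norm_num)
    · exact (h2.trans (by norm_num)).trans (Real.one_le_rpow h (by linarith))
  have h3 : 1 ≤ 16 ^ n * Y ^ n := by
    rw [← mul_pow]
    exact one_le_pow₀ (by linarith)
  have h4 : ε ^ n * ε ^ (2 * δ) * X ^ ((n : ℝ) + 2 * δ) = Y ^ n * Y ^ (2 * δ) := by
    have hX1 : 0 < X := by
      rcases hX0.eq_or_lt with h | h
      · rw [hY, ← h, mul_zero] at hY0; exact absurd hY0 (lt_irrefl _)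
      · exact h
    rw [Real.rpow_add hX1, Real.rpow_natCast, hY, mul_pow, Real.mul_rpow hε0.le hX0]
    ring
  rw [h4]
  have h5 : 0 ≤ Y ^ (2 * δ) := by positivity
  nlinarith [mul_le_mul_of_nonneg_right h3 h5]

/-- The projection commutes with the sum over `ν`. Packets with `ε|ν| ≤ 1/16` leave no error; for
the others the function and its projection are estimated separately. -/
lemma IsAdmissible.exists_proj_diagVar {δ : ℝ} {ψ : 𝓢(E n, ℂ)} {F : UnitAddTorus (Fin n) → ℂ}
    (H : IsAdmissible n δ ψ F) (hc : CoeffInWeightedL2 F ((n : ℝ) + 2 * δ)) {χ : ℝ → ℝ}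
    (hχ : IsCutoff χ) {k : ℝ → ℂ} (hk : IsProjKernel χ k) :
    ∃ C, 0 ≤ C ∧ ∀ ε, 0 < ε → ε ≤ 1 / 4 → ∀ t,
      Integrable (fun s => k s * (diagVar δ ψ F ε (t - s) : ℂ)) ∧
      ‖(∫ s, k s * (diagVar δ ψ F ε (t - s) : ℂ)) - diagVar δ ψ F ε t‖ ≤
        C * (1 + t ^ 2) * (ε ^ n * ∑' ν, tail δ F ε ν) := by
  have hφ := isProfile_profile H.supp
  have hN := normSq_pos H.apply_zero
  have hδ0 := H.pos
  have ha := (hasSum_norm_sq_mFourierCoeff H.memLp H.norm_eq_one).summable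
  have hc2 : CoeffInWeightedL2 F (2 * δ) :=
    hc.mono (by linarith) (by linarith [(Nat.cast_nonneg n : (0 : ℝ) ≤ n)])
  obtain ⟨C, hC0, hC⟩ := hφ.exists_packetVar_growth H.one_le H.pos H.lt_one
  set M := ∫ s, (1 + s ^ 2) * ‖k s‖ with hM
  have hM0 : 0 ≤ M := integral_nonneg fun s => by positivity
  set w : (Fin n → ℤ) → ℝ := fun ν => ‖UnitAddTorus.mFourierCoeff F ν‖ ^ 2 with hw
  refine ⟨(normSq ψ)⁻¹ * (C * (2 * M + 1) * (2 * 16 ^ n)), by positivity, fun ε hε0 hε t => ?_⟩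
  set r : (Fin n → ℤ) → ℝ → ℝ := fun ν t => packetVar δ (profile ψ) ((t * ε) • lat ν) (t * ε ^ 2)
    with hr
  set B : (Fin n → ℤ) → ℝ := fun ν => C * ((ε * ‖lat ν‖) ^ (2 * δ) + ε ^ 4) with hB
  have hrB : ∀ ν t, |r ν t| ≤ B ν * (1 + t ^ 2) := fun ν t => hC (lat ν) ε hε0.le t
  have hrm : ∀ ν, Measurable (r ν) := fun ν => hφ.measurable_packetVar δ (lat ν) ε
  have hint : ∀ ν, Integrable fun s => k s * (r ν (t - s) : ℂ) := fun ν =>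
    hk.integrable_mul (hrm ν) (hrB ν) t
  have hnorm : ∀ ν, ∫ s, ‖k s * (r ν (t - s) : ℂ)‖ ≤ B ν * (2 * (1 + t ^ 2)) * M := fun ν =>
    hk.integral_norm_mul_le (hrm ν) (hrB ν) t
  have hwB : Summable fun ν => w ν * B ν := by
    refine ((hc2.mul_left (C * ε ^ (2 * δ))).add (ha.mul_left (C * ε ^ 4))).congr fun ν => ?_
    simp only [hw, hB]
    rw [Real.mul_rpow hε0.le (norm_nonneg _)]
    ring
  have hsN : Summable fun ν => ∫ s, ‖(w ν : ℂ) * (k s * (r ν (t - s) : ℂ))‖ := by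
    refine Summable.of_nonneg_of_le (fun ν => integral_nonneg fun s => norm_nonneg _)
      (fun ν => ?_) (hwB.mul_right (2 * (1 + t ^ 2) * M))
    simp_rw [norm_mul (w ν : ℂ)]
    rw [integral_const_mul, Complex.norm_real, Real.norm_of_nonneg (sq_nonneg _)]
    calc w ν * ∫ s, ‖k s * (r ν (t - s) : ℂ)‖ ≤ w ν * (B ν * (2 * (1 + t ^ 2)) * M) :=
          mul_le_mul_of_nonneg_left (hnorm ν) (sq_nonneg _)
      _ = _ := by ring
  have hsr : ∀ t, Summable fun ν => w ν * r ν t := fun t => H.summable_packetVar hc2 ε t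
  have hsrC : ∀ t, Summable fun ν => ((w ν : ℂ) * (r ν t : ℂ)) := fun t => by
    exact_mod_cast Complex.summable_ofReal.2 (hsr t)
  set c : ℝ := ε ^ (-(2 * δ)) / normSq ψ with hcdef
  have hdiag : ∀ t, (diagVar δ ψ F ε t : ℂ) = (c : ℂ) * ∑' ν, (w ν : ℂ) * (r ν t : ℂ) := fun t => by
    rw [diagVar, Complex.ofReal_mul, Complex.ofReal_tsum]
    simp only [hcdef, hw, hr, Complex.ofReal_mul]
  have hfun : (fun s => k s * (diagVar δ ψ F ε (t - s) : ℂ)) =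
      fun s => (c : ℂ) * ∑' ν, (w ν : ℂ) * (k s * (r ν (t - s) : ℂ)) := by
    funext s
    rw [hdiag, mul_left_comm, ← tsum_mul_left]
    congr 1
    exact tsum_congr fun ν => by ring
  have hwint : ∀ ν, Integrable fun s => (w ν : ℂ) * (k s * (r ν (t - s) : ℂ)) := fun ν =>
    (hint ν).const_mul _
  rw [hfun]
  refine ⟨(integrable_tsum hwint hsN fun s => ?_).const_mul _, ?_⟩
  · exact ((hsrC (t - s)).mul_left (k s)).congr fun ν => by ring
  have hS := hasSum_integral_of_summable_integral_norm hwint hsN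
  have hdiff := (hS.sub (hsrC t).hasSum).mul_left (c : ℂ)
  rw [integral_const_mul, hdiag t, ← mul_sub, ← hdiff.tsum_eq]
  have htail : Summable (tail δ F ε) :=
    Summable.of_nonneg_of_le (tail_nonneg δ F ε) (tail_le δ F ε) hc
  have hgoal := (htail.mul_left ((normSq ψ)⁻¹ * (C * (2 * M + 1) * (2 * 16 ^ n)) *
    (1 + t ^ 2) * ε ^ n)).hasSum
  refine (tsum_of_norm_bounded hgoal fun ν => ?_).trans (le_of_eq ?_)
  · rw [integral_const_mul, ← mul_sub]
    rcases le_or_gt (ε * ‖lat ν‖) (1 / 16) with hv | hv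
    · have := hφ.proj_packetVar H.one_le H.lt_one hχ hk hε0.le hε hv t
      rw [this, sub_self, mul_zero, mul_zero, norm_zero, tail, if_pos hv, mul_zero]
    · have hc0 : 0 ≤ c := by positivity
      rw [tail, if_neg (not_le.2 hv), norm_mul, norm_mul, Complex.norm_real, Complex.norm_real,
        Real.norm_of_nonneg hc0, Real.norm_of_nonneg (sq_nonneg _)]
      -- No cancellation is used on the tail: `2M` comes from the projected term and `1` from the
      -- term itself.
      have h1 : ‖(∫ s, k s * (r ν (t - s) : ℂ)) - (r ν t : ℂ)‖ ≤
          B ν * ((2 * M + 1) * (1 + t ^ 2)) := by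
        refine (norm_sub_le _ _).trans ?_
        rw [Complex.norm_real, Real.norm_eq_abs]
        have := (norm_integral_le_integral_norm _).trans (hnorm ν)
        linarith [hrB ν t]
      have h2 : B ν ≤ C * (2 * 16 ^ n *
          (ε ^ n * ε ^ (2 * δ) * ‖lat ν‖ ^ ((n : ℝ) + 2 * δ))) :=
        mul_le_mul_of_nonneg_left (tail_weight_le H.pos H.lt_one hε0 hε (norm_nonneg _) hv) hC0
      have h3 : ε ^ (-(2 * δ)) * ε ^ (2 * δ) = 1 := by
        rw [← Real.rpow_add hε0, neg_add_cancel, Real.rpow_zero]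
      calc c * (w ν * ‖(∫ s, k s * (r ν (t - s) : ℂ)) - (r ν t : ℂ)‖)
          ≤ c * (w ν * (C * (2 * 16 ^ n *
            (ε ^ n * ε ^ (2 * δ) * ‖lat ν‖ ^ ((n : ℝ) + 2 * δ))) *
              ((2 * M + 1) * (1 + t ^ 2)))) := by
            gcongr
            exact h1.trans (by gcongr)
        _ = (ε ^ (-(2 * δ)) * ε ^ (2 * δ)) * ((normSq ψ)⁻¹ * (C * (2 * M + 1) * (2 * 16 ^ n)) *
            (1 + t ^ 2) * ε ^ n * (‖lat ν‖ ^ ((n : ℝ) + 2 * δ) * w ν)) := by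
            rw [hcdef]; ring
        _ = _ := by rw [h3, one_mul]
  · rw [tsum_mul_left]; ring

/-- The background is exactly `lead + diagVar`. The leading term is constant in time and is
preserved because the kernel has integral `1`, so only `diagVar` produces an error. -/
theorem IsAdmissible.exists_proj_hb {δ : ℝ} {ψ : 𝓢(E n, ℂ)} {F : UnitAddTorus (Fin n) → ℂ}
    (H : IsAdmissible n δ ψ F) (hc : CoeffInWeightedL2 F ((n : ℝ) + 2 * δ)) {χ : ℝ → ℝ}
    (hχ : IsCutoff χ) :
    ∃ C, 0 ≤ C ∧ ∀ ε, 0 < ε → ε ≤ 1 / 4 → ∀ t,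
      Integrable (projIntegrand χ (hb δ ψ F ε) t) ∧
      ‖proj χ (hb δ ψ F ε) t - hb δ ψ F ε t‖ ≤
        C * (1 + t ^ 2) * (ε ^ n * ∑' ν, tail δ F ε ν) := by
  have hk := hχ.isProjKernel
  obtain ⟨C, hC0, hC⟩ := H.exists_proj_diagVar hc hχ hk
  refine ⟨C, hC0, fun ε hε0 hε t => ?_⟩
  obtain ⟨h1, h2⟩ := hC ε hε0 hε t
  have hc2 : CoeffInWeightedL2 F (2 * δ) :=
    hc.mono (by linarith [H.pos]) (by linarith [(Nat.cast_nonneg n : (0 : ℝ) ≤ n)])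
  have hhb : ∀ t, hb δ ψ F ε t = lead δ ψ ε + (diagVar δ ψ F ε t : ℂ) := fun t => by
    rw [hb, (H.h_eq hc2 hε0 hε t).2, add_sub_cancel_right]
  have hp : projIntegrand χ (hb δ ψ F ε) t = fun s =>
      (𝓕⁻ (fun τ : ℝ => (χ τ : ℂ))) s * lead δ ψ ε +
      (𝓕⁻ (fun τ : ℝ => (χ τ : ℂ))) s * (diagVar δ ψ F ε (t - s) : ℂ) := by
    funext s
    rw [projIntegrand, hhb, mul_add]
  rw [proj, hp]
  refine ⟨(hk.integrable_kernel.mul_const _).add h1, ?_⟩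
  rw [integral_add (hk.integrable_kernel.mul_const _) h1, integral_mul_const,
    hk.integral_eq_one hχ, hhb, one_mul, add_sub_add_left_eq_sub]
  exact h2

/-- The error is the projection error of the background, governed by the tail, plus `ε^n (hpEps -
hp)`. Both are `o(ε^n)` uniformly on compact time sets. -/
theorem IsAdmissible.h_sub_proj_sub_hp {δ : ℝ} {ψ : 𝓢(E n, ℂ)} {F : UnitAddTorus (Fin n) → ℂ}
    (H : IsAdmissible n δ ψ F) (hc : CoeffInWeightedL2 F ((n : ℝ) + 2 * δ)) {χ : ℝ → ℝ}
    (hχ : IsCutoff χ) :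
    IsLittleOLocUnif
      (fun ε t => (h δ (fEps ψ F ε) t : ℂ) -
        (proj χ (hb δ ψ F ε) t + (ε : ℂ) ^ n * hp δ ψ F t))
      (fun ε => ε ^ n) := by
  obtain ⟨C, hC0, hC⟩ := H.exists_proj_hb hc hχ
  have h1 : IsLittleOLocUnif (fun ε t => hb δ ψ F ε t - proj χ (hb δ ψ F ε) t)
      (fun ε => ε ^ n) := by
    intro K hK c hc0
    obtain ⟨T, hT⟩ := hK.isBounded.exists_norm_le
    have hlim := (tendsto_tsum_tail hc).const_mul (C * (1 + T ^ 2))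
    rw [mul_zero] at hlim
    filter_upwards [hlim.eventually_le_const hc0, eventually_small (by norm_num : (0 : ℝ) < 1 / 4)]
      with ε h2 hε t ht
    have hε0 := hε.1
    have ht2 : t ^ 2 ≤ T ^ 2 := by
      rw [← sq_abs]
      exact pow_le_pow_left₀ (abs_nonneg _) (hT t ht) 2
    have hS : 0 ≤ ∑' ν, tail δ F ε ν := tsum_nonneg (tail_nonneg δ F ε)
    rw [norm_sub_rev]
    calc ‖proj χ (hb δ ψ F ε) t - hb δ ψ F ε t‖
        ≤ C * (1 + t ^ 2) * (ε ^ n * ∑' ν, tail δ F ε ν) := (hC ε hε.1 hε.2 t).2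
      _ ≤ C * (1 + T ^ 2) * (ε ^ n * ∑' ν, tail δ F ε ν) := by gcongr
      _ = (C * (1 + T ^ 2) * ∑' ν, tail δ F ε ν) * ε ^ n := by ring
      _ ≤ c * ε ^ n := by gcongr
  have h3 := H.hpEps_sub_hp.mul_left (m := fun ε => ε ^ n) (fun ε hε => by positivity)
  simp only [mul_one] at h3
  refine (h1.add h3).congr (Eventually.of_forall fun ε t => ?_)
    (Eventually.of_forall fun _ => le_rfl)
  rw [hb]
  push_cast
  ring

end PeriodicSchrodinger

end

open PeriodicSchrodinger in
theorem mainTheorem8 (n : ℕ) (hn : 1 ≤ n) (δ : ℝ) (hδ0 : 0 < δ) (hδ1 : δ < 1)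
    (ψ : 𝓢(E n, ℂ)) (hψreal : ∀ x, (ψ x).im = 0) (hψsymm : ∀ x, ψ (-x) = ψ x)
    (hψsupp : tsupport (𝓕 ψ : 𝓢(E n, ℂ)) ⊆ Metric.closedBall 0 1) (hψ0 : ψ 0 = 1)
    (F : UnitAddTorus (Fin n) → ℂ) (hF : MemLp F 2 (torusMeasure n))
    (hFnorm : eLpNorm F 2 (torusMeasure n) = 1) :
    -- the leading behaviour
    (CoeffInWeightedL2 F (2 * δ) →
      (∀ ε : ℝ, 0 < ε → MemLp (fEps ψ F ε) 2 volume) ∧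
      (∀ᶠ ε in 𝓝[>] (0 : ℝ), ∀ t : ℝ, Integrable (hIntegrand δ (fEps ψ F ε) t)) ∧
      IsLittleOLocUnif
        (fun ε t => (h δ (fEps ψ F ε) t : ℂ) - lead δ ψ ε)
        (fun _ => 1)) ∧
    -- smooth background plus periodic part
    (CoeffInWeightedL2 F ((n : ℝ) + 2 * δ) →
      (∀ t : ℝ, Summable (hpTerm δ F t)) ∧
      (∀ᶠ ε in 𝓝[>] (0 : ℝ), ∀ t : ℝ, Summable (hpEpsTerm δ ψ F ε t)) ∧
      ∀ χ : ℝ → ℝ, IsCutoff χ →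
        (∀ᶠ ε in 𝓝[>] (0 : ℝ), ∀ t : ℝ, Integrable (projIntegrand χ (hb δ ψ F ε) t)) ∧
        IsLittleOLocUnif
          (fun ε t => (h δ (fEps ψ F ε) t : ℂ) -
            (proj χ (hb δ ψ F ε) t + (ε : ℂ) ^ n * hp δ ψ F t))
          (fun ε => ε ^ n)) ∧
    -- dimension one
    (n = 1 → δ < 1 / 2 → CoeffInWeightedL2 F (1 + 2 * δ) →
      IsLittleOLocUnif
        (fun ε t => (h δ (fEps ψ F ε) t : ℂ) - (lead δ ψ ε + (ε : ℂ) * hp δ ψ F t))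
        (fun ε => ε)) := by
  have H : IsAdmissible n δ ψ F :=
    ⟨hn, hδ0, hδ1, hψreal, hψsymm, hψsupp, hψ0, hF, hFnorm⟩
  have hsmall := eventually_small (by norm_num : (0 : ℝ) < 1 / 4)
  have ha := (hasSum_norm_sq_mFourierCoeff hF hFnorm).summable
  refine ⟨fun hc => ⟨fun ε hε => memLp_fEps ψ hF hε, ?_, H.h_sub_lead hc⟩,
    fun hc => ⟨summable_hpTerm hδ0 ha, ?_, fun χ hχ => ⟨?_, ?_⟩⟩, ?_⟩
  · filter_upwards [hsmall] with ε hε t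
    exact (H.h_eq hc hε.1 hε.2 t).1
  · filter_upwards [hsmall] with ε hε t
    exact H.summable_hpEpsTerm hε.1 hε.2 t
  · obtain ⟨C, -, hC⟩ := H.exists_proj_hb hc hχ
    filter_upwards [hsmall] with ε hε t
    exact (hC ε hε.1 hε.2 t).1
  · exact H.h_sub_proj_sub_hp hc hχ
  · rintro rfl hδ hc
    exact H.h_sub_lead_sub_hp hδ hc
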